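/- A *virtual double category* (in the sense of Cruttwell and Shulman) has objects, a category of vertical arrows, proarrows $J : X \nrightarrow Y$, and cells $\alpha$ with vertical boundaries $f : X_0 \to Y_0$, $g : X_k \to Y_1$, horizontal domain a finite, possibly empty, composable list of proarrows $J_1,\dots,J_k$ from $X_0$ to $X_k$, and horizontal codomain a single proarrow $K : Y_0 \nrightarrow Y_1$, together with identity cells and composites $\beta(\alpha_1,\dots,\alpha_\ell)$ subject to the identity and associativity laws. A proarrow $J$ is a *composite* of $J_1,\dots,J_k$ if there is a cell $\mu : J_1,\dots,J_k \to J$ with identity vertical boundaries such that every cell with horizontal domain $R_1,\dots,R_m,J_1,\dots,J_k,S_1,\dots,S_n$ factors uniquely through $(\mathrm{id},\dots,\mathrm{id},\mu,\mathrm{id},\dots,\mathrm{id})$. A *unit* of an object $A$ is a composite of the empty list at $A$. A cell $K(f,g) \to K$ with boundaries $f,g$ is *cartesian*, and $K(f,g)$ is the *restriction* of $K$ along $f,g$, if every cell into $K$ with boundaries $fh$ and $gk$ factors uniquely through it as a cell with boundaries $h,k$. A *virtual equipment* is a virtual double category in which every object has a unit and all restrictions exist. Two objects $A$, $B$ of a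 virtual double category are *horizontally equivalent* if there are proarrows $J : A \nrightarrow B$ and $K : B \nrightarrow A$ such that the composites $JK$ and $KJ$ exist and $JK \cong U_A$, $KJ \cong U_B$ for units $U_A$ of $A$ and $U_B$ of $B$. Let $\mathcal E$ be a virtual equipment. An *$\mathcal E$-category* $\mathcal C$ has a collection of objects $c$, each with an extent $\mathcal C(c) \in \mathcal E$, proarrows $\mathcal C(c,d) : \mathcal C(c) \nrightarrow \mathcal C(d)$, identity cells from the empty list to $\mathcal C(c,c)$ and composition cells $\mathcal C(c,d),\mathcal C(d,e) \to \mathcal C(c,e)$ satisfying the unit and associativity laws. A *functor* $F : \mathcal C \to \mathcal D$ sends objects $c$ to objects $Fc$, with a vertical arrow $F_c$ from the extent of $c$ to that of $Fc$, and has cells $\mathcal C(c,d) \to \mathcal D(Fc,Fd)$ with boundaries $F_c, F_d$ respecting identities and composition. A *profunctor* $J : \mathcal C \nrightarrow \mathcal D$ consists of proarrows $J(c,d)$ from the extent of $c$ to that of $d$ with commuting unital and associative actions $\mathcal C(c,c'),J(c',d) \to J(c,d)$ and $J(c,d),\mathcal D(d,d') \to J(c,d')$. A *cell* $J_1,\dots,J_k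 \to K$ of profunctors $J_i : \mathcal C_{i-1} \nrightarrow \mathcal C_i$, with boundaries $F : \mathcal C_0 \to \mathcal D_0$ and $G : \mathcal C_k \to \mathcal D_1$, is a family of cells $J_1(c_0,c_1),\dots,J_k(c_{k-1},c_k) \to K(Fc_0,Gc_k)$ of $\mathcal E$ with boundaries $F_{c_0}, G_{c_k}$ which equalizes the two actions of each $\mathcal C_i$ with $0<i<k$ and commutes with the actions of $\mathcal C_0$ and $\mathcal C_k$ through $F$ and $G$ (for $k=0$: is natural). These form a virtual double category $\mathbf{VCat}(\mathcal E)$. For an object $A$ of $\mathcal E$, let $|A|$ be the $\mathcal E$-category whose objects are the vertical arrows $a : X \to A$ of $\mathcal E$, with extent the domain $X$, whose hom from $a$ to $b$ is the restriction $U_A(a,b)$ of the unit $U_A$ of $A$ along $a$ and $b$ (equivalently, the composite of the companion of $a$ and the conjoint of $b$), and whose identities and composition are induced by the universal properties of $U_A$ and of the restrictions. **Corollary.** Let $A$ and $B$ be objects of a virtual equipment $\mathcal E$. If $|A|$ and $|B|$ are Morita equivalent, that is, horizontally equivalent in $\mathbf{VCat}(\mathcal E)$ (there are profunctors $J : |A|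 \nrightarrow |B|$ and $K : |B| \nrightarrow |A|$ whose composites $JK$ and $KJ$ exist in $\mathbf{VCat}(\mathcal E)$ and are isomorphic to units of $|A|$ and $|B|$), then $A$ and $B$ are horizontally equivalent in $\mathcal E$. In other words, $|\cdot|$ reflects Morita equivalence. -/

import Mathlib

open CategoryTheory

universe t w p v u

attribute [instance] CategoryTheory.CategoryStruct.toQuiver

namespace VDC

/-- Composable lists of proarrows: `ProPath H A B` is the type of lists `J₁, …, Jₖ` (`k ≥ 0`) with
`J₁` starting at `A`, `Jₖ` ending at `B`. -/
inductive ProPath {D : Type u} (H : D → D → Type p) : D → D → Type (max u p)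
  | nil (A : D) : ProPath H A A
  | cons {A B C : D} (J : H A B) (P : ProPath H B C) : ProPath H A C

namespace ProPath
variable {D : Type u} {H : D → D → Type p}

@[reducible] def append {A B C : D} : ProPath H A B → ProPath H B C → ProPath H A C
  | .nil _, Q => Q
  | .cons J P, Q => .cons J (append P Q)

abbrev single {A B : D} (J : H A B) : ProPath H A B := .cons J (.nil B)

theorem append_nil {A B : D} (P : ProPath H A B) : P.append (.nil B) = P := by
  induction P with
  | nil => rfl
  | cons J P ih => simp [append, ih]

theorem append_assoc {A B C E : D} (P : ProPath H A B) (Q : ProPath H B C) (R : ProPath H C E) :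
    (P.append Q).append R = P.append (Q.append R) := by
  induction P with
  | nil => rfl
  | cons J P ih => simp [append, ih]
end ProPath

/-- Horizontally composable lists of cells `α₁, …, αₗ` from the list of proarrows `P` to the list `Q`
between the outer vertical arrows `f` and `g`: the domain `P` is the concatenation of the domains of the
`αᵢ`, and `Q` is the list of their codomains. In `cons` the equation `P₁.append P₂ = P` records the
concatenation. -/
inductive CellPath {D : Type u} [Category.{v} D] {H : D → D → Type p}
    (Cell : ∀ {A B A' B' : D}, (A ⟶ A') → (B ⟶ B') → ProPath H A B → H A' B' → Type w) :
    ∀ {A B A' B' : D}, (A ⟶ A') → (B ⟶ B') → ProPath H A B → ProPath H A' B' →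
      Type (max u v p w)
  | nil {A A' : D} (f : A ⟶ A') : CellPath @Cell f f (.nil A) (.nil A')
  | cons {A X B A' X' B' : D} {f : A ⟶ A'} {m : X ⟶ X'} {g : B ⟶ B'}
      {P₁ : ProPath H A X} {P₂ : ProPath H X B} {P : ProPath H A B}
      {K : H A' X'} {Q : ProPath H X' B'}
      (α : Cell f m P₁ K) (αs : CellPath @Cell m g P₂ Q) (h : P₁.append P₂ = P) :
      CellPath @Cell f g P (.cons K Q)

/-- The data of a virtual double category: a category of objects and vertical arrows, proarrows,
cells `Cell f g P K` with vertical boundaries `f`, `g`, horizontal domain the list `P` and horizontal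
codomain `K`, identity cells and the composite `β(α₁, …, αₗ)`. The two equations in the arguments of
`mcomp` only allow the vertical boundary of the composite to be written as any `F`, `G` equal to
`f ≫ f'`, `g ≫ g'`. -/
class VDCStruct (D : Type u) extends Category.{v} D where
  Pro : D → D → Type p
  Cell : ∀ {A B A' B' : D}, (A ⟶ A') → (B ⟶ B') → ProPath Pro A B → Pro A' B' → Type w
  idCell : ∀ {A B : D} (J : Pro A B), Cell (𝟙 A) (𝟙 B) (.single J) J
  mcomp : ∀ {A B A' B' A'' B'' : D} {f : A ⟶ A'} {g : B ⟶ B'} {f' : A' ⟶ A''} {g' : B' ⟶ B''}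
    {F : A ⟶ A''} {G : B ⟶ B''} {P : ProPath Pro A B} {Q : ProPath Pro A' B'} {K : Pro A'' B''},
    Cell f' g' Q K → CellPath @Cell f g P Q → f ≫ f' = F → g ≫ g' = G → Cell F G P K

open VDCStruct

abbrev Path (D : Type u) [VDCStruct.{w, p, v} D] (A B : D) := ProPath (Pro (D := D)) A B

abbrev Cells {D : Type u} [VDCStruct.{w, p, v} D] {A B A' B' : D} (f : A ⟶ A') (g : B ⟶ B')
   (P : Path D A B) (Q : Path D A' B') := CellPath (@Cell D _) f g P Q

namespace CellPath
variable {D : Type u} [VDCStruct.{w, p, v} D]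

/-- The list of identity cells of a list of proarrows. -/
def id : ∀ {A B : D} (P : Path D A B), Cells (𝟙 A) (𝟙 B) P P
  | _, _, .nil A => .nil (𝟙 A)
  | _, _, .cons J P => .cons (idCell J) (id P) rfl

/-- The list with one cell. -/
def single {A B A' B' : D} {f : A ⟶ A'} {g : B ⟶ B'} {P : Path D A B} {K : Pro A' B'}
    (α : Cell f g P K) : Cells f g P (.single K) :=
  .cons α (.nil g) P.append_nil

def append : ∀ {A X B A' X' B' : D} {f : A ⟶ A'} {m : X ⟶ X'} {g : B ⟶ B'}
    {P₁ : Path D A X} {P₂ : Path D X B} {P : Path D A B}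
    {Q₁ : Path D A' X'} {Q₂ : Path D X' B'} (_ : Cells f m P₁ Q₁) (_ : Cells m g P₂ Q₂)
    (_ : P₁.append P₂ = P), Cells f g P (Q₁.append Q₂)
  | _, _, _, _, _, _, _, _, _, _, _, _, _, _, .nil _, βs, h => h ▸ βs
  | _, _, _, _, _, _, _, _, _, _, _, _, _, _, .cons α αs hα, βs, h =>
    .cons α (append αs βs rfl) (by rw [← h, ← hα, ProPath.append_assoc])

/-- A decomposition of a list of cells with codomain `Q₁ ++ Q₂`. -/
structure Split {A B A' X' B' : D} (f : A ⟶ A') (g : B ⟶ B') (P : Path D A B)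
    (Q₁ : Path D A' X') (Q₂ : Path D X' B') where
  {X : D}
  {m : X ⟶ X'}
  {P₁ : Path D A X}
  {P₂ : Path D X B}
  fst : Cells f m P₁ Q₁
  snd : Cells m g P₂ Q₂
  eq : P₁.append P₂ = P

def Split.cons {A B C A' X' C' B' : D} {f : A ⟶ A'} {m : B ⟶ C'} {g : C ⟶ B'}
    {P₁ : Path D A B} {P₂ : Path D B C} {P : Path D A C} {K : Pro A' C'}
    {Q₁ : Path D C' X'} {Q₂ : Path D X' B'} (α : Cell f m P₁ K) (s : Split m g P₂ Q₁ Q₂)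
    (h : P₁.append P₂ = P) : Split f g P (.cons K Q₁) Q₂ :=
  ⟨.cons α s.fst rfl, s.snd, by rw [ProPath.append_assoc, s.eq, h]⟩

def split {A' X' B' : D} : ∀ {A B : D} {f : A ⟶ A'} {g : B ⟶ B'} {P : Path D A B}
    (Q₁ : Path D A' X') (Q₂ : Path D X' B'), Cells f g P (Q₁.append Q₂) → Split f g P Q₁ Q₂
  | _, _, f, _, _, .nil _, _, γ => ⟨.nil f, γ, rfl⟩
  | _, _, _, _, _, .cons K Q₁, Q₂, γ =>
    match (γ : Cells _ _ _ (.cons K (Q₁.append Q₂))) with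
    | .cons α γ' h => (split Q₁ Q₂ γ').cons α h

/-- Componentwise composite of lists of cells: the cells of the upper list are distributed over the
cells of the lower list. -/
def comp : ∀ {A B A' B' A'' B'' : D} {f : A ⟶ A'} {g : B ⟶ B'} {f' : A' ⟶ A''} {g' : B' ⟶ B''}
    {F : A ⟶ A''} {G : B ⟶ B''} {P : Path D A B} {Q : Path D A' B'} {R : Path D A'' B''},
    Cells f' g' Q R → Cells f g P Q → f ≫ f' = F → g ≫ g' = G → Cells F G P R
  | _, _, _, _, _, _, _, _, _, _, _, _, _, _, _, .nil f', .nil f, hf, hg =>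
    hf ▸ hg ▸ .nil (f ≫ f')
  | _, _, _, _, _, _, _, _, _, _, _, _, _, _, _, .cons (P₁ := Q₁) (P₂ := Q₂) α αs h, γ, hf, hg =>
    match split Q₁ Q₂ (h ▸ γ) with
    | ⟨γ₁, γ₂, e⟩ => .cons (mcomp α γ₁ hf rfl) (comp αs γ₂ rfl hg) e

theorem exists_append {A' X' B' : D} (Q₁ : Path D A' X') (Q₂ : Path D X' B') :
    ∀ {A B : D} {f : A ⟶ A'} {g : B ⟶ B'} {P : Path D A B} (γ : Cells f g P (Q₁.append Q₂)),
    ∃ (X : D) (m : X ⟶ X') (P₁ : Path D A X) (P₂ : Path D X B) (γ₁ : Cells f m P₁ Q₁)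
      (γ₂ : Cells m g P₂ Q₂) (h : P₁.append P₂ = P), γ = append γ₁ γ₂ h := by
  induction Q₁ with
  | nil => intro A B f g P γ; exact ⟨A, f, .nil A, P, .nil f, γ, rfl, rfl⟩
  | cons K Q₁ ih =>
    intro A B f g P γ
    change Cells f g P (.cons K (Q₁.append Q₂)) at γ
    cases γ with
    | cons α γ h =>
      subst h
      obtain ⟨X, m, P₁, P₂, γ₁, γ₂, rfl, rfl⟩ := ih Q₂ γ
      exact ⟨X, m, _, P₂, .cons α γ₁ rfl, γ₂, ProPath.append_assoc _ _ _, rfl⟩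

theorem split_append {A X B A' X' B' : D} {f : A ⟶ A'} {m : X ⟶ X'} {g : B ⟶ B'}
    {P₁ : Path D A X} {P₂ : Path D X B} {P : Path D A B}
    {Q₁ : Path D A' X'} {Q₂ : Path D X' B'} (α : Cells f m P₁ Q₁) (β : Cells m g P₂ Q₂)
    (h : P₁.append P₂ = P) : split Q₁ Q₂ (append α β h) = ⟨α, β, h⟩ := by
  induction α with
  | nil => subst h; rfl
  | cons α αs hα ih =>
    subst hα h
    simp only [append, split]
    rw [ih]
    rfl

theorem cons_heq {A X B A' X' B' : D} {f : A ⟶ A'} {m : X ⟶ X'} {g : B ⟶ B'}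
    {P₁ : Path D A X} {P₂ P₂' : Path D X B} {P P' : Path D A B}
    {K : Pro A' X'} {Q Q' : Path D X' B'} (α : Cell f m P₁ K) {αs : Cells m g P₂ Q}
    {αs' : Cells m g P₂' Q'} (hP : P₂ = P₂') (hQ : Q = Q') (hα : HEq αs αs')
    (h : P₁.append P₂ = P) (h' : P₁.append P₂' = P') :
    HEq (CellPath.cons α αs h) (CellPath.cons α αs' h') := by
  subst hP hQ h h'; cases hα; rfl

theorem append_append {A X Y B A' X' Y' B' : D} {f : A ⟶ A'} {m : X ⟶ X'} {n : Y ⟶ Y'}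
    {g : B ⟶ B'} {P₁ : Path D A X} {P₂ : Path D X Y} {P₃ : Path D Y B} {P₁₂ : Path D A Y}
    {P₂₃ : Path D X B}
    {P P' : Path D A B} {Q₁ : Path D A' X'} {Q₂ : Path D X' Y'} {Q₃ : Path D Y' B'}
    (α : Cells f m P₁ Q₁) (β : Cells m n P₂ Q₂) (γ : Cells n g P₃ Q₃)
    (h : P₁.append P₂ = P₁₂) (h' : P₁₂.append P₃ = P) (k : P₂.append P₃ = P₂₃)
    (k' : P₁.append P₂₃ = P') :
    HEq (append (append α β h) γ h') (append α (append β γ k) k') := by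
  induction α with
  | nil => subst h k; subst h'; subst k'; rfl
  | cons α αs hα ih =>
    subst hα h h' k k'
    simp only [append]
    exact cons_heq _ (ProPath.append_assoc _ _ _) (ProPath.append_assoc _ _ _)
      (ih β rfl rfl rfl rfl) _ _

theorem append_nil {A B A' B' : D} {f : A ⟶ A'} {g : B ⟶ B'}
    {P : Path D A B} {Q : Path D A' B'} (α : Cells f g P Q) :
    HEq (append α (.nil g) P.append_nil) α := by
  induction α with
  | nil => rfl
  | cons α αs hα ih =>
    subst hα
    simp only [append]
    exact cons_heq _ (ProPath.append_nil _) (ProPath.append_nil _)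
      (HEq.trans (by congr!) ih) _ _

theorem cons_congr {A X B A' X' B' : D} {f : A ⟶ A'} {m m' : X ⟶ X'} {g : B ⟶ B'}
    {P₁ : Path D A X} {P₂ : Path D X B} {P : Path D A B}
    {K : Pro A' X'} {Q : Path D X' B'} {α : Cell f m P₁ K} {α' : Cell f m' P₁ K}
    {αs : Cells m g P₂ Q} {αs' : Cells m' g P₂ Q} (hm : m = m') (hα : HEq α α')
    (hαs : HEq αs αs') (h : P₁.append P₂ = P) :
    CellPath.cons α αs h = CellPath.cons α' αs' h := by
  subst hm; cases hα; cases hαs; rfl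

theorem comp_nil {A B C : D} (f' : B ⟶ C) (f : A ⟶ B) {F : A ⟶ C} (h h' : f ≫ f' = F) :
    comp (nil f') (nil f) h h' = nil F := by
  subst h; rfl

theorem mcomp_congr {A B A' B' A'' B'' : D} {f : A ⟶ A'} {g : B ⟶ B'} {f' : A' ⟶ A''}
    {g' : B' ⟶ B''} {F F' : A ⟶ A''} {G G' : B ⟶ B''} {P : Path D A B} {Q : Path D A' B'}
    {K : Pro A'' B''} (α : Cell f' g' Q K) (β : Cells f g P Q) (hf : f ≫ f' = F)
    (hf' : f ≫ f' = F') (hg : g ≫ g' = G) (hg' : g ≫ g' = G') :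
    HEq (mcomp α β hf hg) (mcomp α β hf' hg') := by
  subst hf hf' hg hg'; rfl

theorem comp_congr {A B A' B' A'' B'' : D} {f : A ⟶ A'} {g : B ⟶ B'} {f' : A' ⟶ A''}
    {g' : B' ⟶ B''} {F F' : A ⟶ A''} {G G' : B ⟶ B''} {P : Path D A B} {Q : Path D A' B'}
    {K : Path D A'' B''} (α : Cells f' g' Q K) (β : Cells f g P Q) (hf : f ≫ f' = F)
    (hf' : f ≫ f' = F') (hg : g ≫ g' = G) (hg' : g ≫ g' = G') :
    HEq (comp α β hf hg) (comp α β hf' hg') := by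
  subst hf hf' hg hg'; rfl

theorem comp_cons {A X B A' X' B' A'' X'' B'' : D} {f : A ⟶ A'} {m : X ⟶ X'} {g : B ⟶ B'}
    {f' : A' ⟶ A''} {m' : X' ⟶ X''} {g' : B' ⟶ B''} {F : A ⟶ A''} {G : B ⟶ B''}
    {P₁ : Path D A X} {P₂ : Path D X B} {P : Path D A B}
    {Q₁ : Path D A' X'} {Q₂ : Path D X' B'} {Q : Path D A' B'}
    {K : Pro A'' X''} {R : Path D X'' B''}
    (α : Cell f' m' Q₁ K) (αs : Cells m' g' Q₂ R) (hQ : Q₁.append Q₂ = Q)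
    (β : Cells f m P₁ Q₁) (βs : Cells m g P₂ Q₂) (h : P₁.append P₂ = P) (γ : Cells f g P Q)
    (hγ : HEq γ (append β βs h))
    (hf : f ≫ f' = F) (hg : g ≫ g' = G) :
    comp (.cons α αs hQ) γ hf hg =
      .cons (mcomp α β hf rfl) (comp αs βs rfl hg) h := by
  subst hQ
  cases hγ
  simp only [comp]
  rw [split_append]

theorem comp_append {A X B A' X' B' A'' X'' B'' : D} {f : A ⟶ A'} {m : X ⟶ X'} {g : B ⟶ B'}
    {f' : A' ⟶ A''} {m' : X' ⟶ X''} {g' : B' ⟶ B''} {F : A ⟶ A''} {M : X ⟶ X''} {G : B ⟶ B''}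
    {P₁ : Path D A X} {P₂ : Path D X B} {P : Path D A B}
    {Q₁ : Path D A' X'} {Q₂ : Path D X' B'} {Q : Path D A' B'}
    {R₁ : Path D A'' X''} {R₂ : Path D X'' B''}
    (α : Cells f' m' Q₁ R₁) (αs : Cells m' g' Q₂ R₂) (hQ : Q₁.append Q₂ = Q)
    (β : Cells f m P₁ Q₁) (βs : Cells m g P₂ Q₂) (h : P₁.append P₂ = P) (γ : Cells f g P Q)
    (hγ : HEq γ (append β βs h))
    (hf : f ≫ f' = F) (hm : m ≫ m' = M) (hg : g ≫ g' = G) :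
    comp (append α αs hQ) γ hf hg = append (comp α β hf hm) (comp αs βs hm hg) h := by
  subst hQ
  cases hγ
  subst hf hm hg
  induction α generalizing P P₁ A X with
  | nil =>
    cases β
    subst h
    rfl
  | cons α α' hα ih =>
    subst hα h
    obtain ⟨Y, n, P₁₁, P₁₂, β₁, β₂, rfl, rfl⟩ := exists_append _ _ β
    rw [comp_cons α α' rfl β₁ β₂ rfl _ HEq.rfl]
    refine (comp_cons α (append α' αs rfl) _ β₁ (append β₂ βs rfl)
      (ProPath.append_assoc _ _ _).symm _ (append_append _ _ _ _ _ _ _) _ _).trans ?_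
    rw [ih]
    rfl

end CellPath

/-- Virtual double categories: the identity and associativity laws
`id_J(α) = α`, `β(id, …, id) = β`, `β(α₁, …)(γ₁₁, …) = β(α₁(γ₁₁, …), …)`. -/
class VirtualDoubleCategory (D : Type u) extends VDCStruct.{w, p, v} D where
  idCell_mcomp : ∀ {A B A' B' : D} {f : A ⟶ A'} {g : B ⟶ B'} {P : Path D A B} {K : Pro A' B'}
    (α : Cell f g P K), mcomp (idCell K) (.single α) (Category.comp_id f) (Category.comp_id g) = α
  mcomp_id : ∀ {A B A' B' : D} {f : A ⟶ A'} {g : B ⟶ B'} {P : Path D A B} {K : Pro A' B'}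
    (α : Cell f g P K), mcomp α (.id P) (Category.id_comp f) (Category.id_comp g) = α
  mcomp_assoc : ∀ {A B A' B' A'' B'' A₃ B₃ : D} {f : A ⟶ A'} {g : B ⟶ B'}
    {f' : A' ⟶ A''} {g' : B' ⟶ B''} {f'' : A'' ⟶ A₃} {g'' : B'' ⟶ B₃}
    {F : A ⟶ A''} {G : B ⟶ B''} {F' : A' ⟶ A₃} {G' : B' ⟶ B₃} {F'' : A ⟶ A₃} {G'' : B ⟶ B₃}
    {P : Path D A B} {Q : Path D A' B'} {R : Path D A'' B''} {K : Pro A₃ B₃}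
    (β : Cell f'' g'' R K) (α : Cells f' g' Q R) (γ : Cells f g P Q)
    (hF : f ≫ f' = F) (hG : g ≫ g' = G) (hF' : f' ≫ f'' = F') (hG' : g' ≫ g'' = G')
    (h₁ : f ≫ F' = F'') (h₂ : g ≫ G' = G'') (h₃ : F ≫ f'' = F'') (h₄ : G ≫ g'' = G''),
    mcomp (mcomp β α hF' hG') γ h₁ h₂ = mcomp β (α.comp γ hF hG) h₃ h₄

namespace CellPath
variable {D : Type u} [VirtualDoubleCategory.{w, p, v} D]
open VirtualDoubleCategory

theorem comp_assoc {A B A' B' A'' B'' A₃ B₃ : D} {f : A ⟶ A'} {g : B ⟶ B'}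
    {f' : A' ⟶ A''} {g' : B' ⟶ B''} {f'' : A'' ⟶ A₃} {g'' : B'' ⟶ B₃}
    {F : A ⟶ A''} {G : B ⟶ B''} {F' : A' ⟶ A₃} {G' : B' ⟶ B₃} {F'' : A ⟶ A₃} {G'' : B ⟶ B₃}
    {P : Path D A B} {Q : Path D A' B'} {R : Path D A'' B''} {K : Path D A₃ B₃}
    (β : Cells f'' g'' R K) (α : Cells f' g' Q R) (γ : Cells f g P Q)
    (hF : f ≫ f' = F) (hG : g ≫ g' = G) (hF' : f' ≫ f'' = F') (hG' : g' ≫ g'' = G')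
    (h₁ : f ≫ F' = F'') (h₂ : g ≫ G' = G'') (h₃ : F ≫ f'' = F'') (h₄ : G ≫ g'' = G'') :
    comp (comp β α hF' hG') γ h₁ h₂ = comp β (α.comp γ hF hG) h₃ h₄ := by
  induction β generalizing A A' with
  | nil =>
    cases α; cases γ; subst hF hF' h₁; cases h₂; cases hG; cases hG'
    simp only [comp_nil]
  | cons β βs h ih =>
    subst h
    obtain ⟨Y, n, P₁, P₂, α₁, α₂, rfl, rfl⟩ := exists_append _ _ α
    obtain ⟨Z, k, P₁, P₂, γ₁, γ₂, rfl, rfl⟩ := exists_append _ _ γ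
    rw [comp_cons _ _ rfl α₁ α₂ rfl _ HEq.rfl, comp_cons _ _ _ γ₁ γ₂ _ _ HEq.rfl,
      comp_append α₁ α₂ _ γ₁ γ₂ _ _ HEq.rfl hF rfl hG,
      comp_cons _ _ rfl _ _ _ _ HEq.rfl]
    exact cons_congr (Category.assoc _ _ _).symm
      ((heq_of_eq (mcomp_assoc β α₁ γ₁ hF rfl _ _ _ _ h₃ (Category.assoc _ _ _))).trans
        (mcomp_congr _ _ _ _ _ _))
      ((heq_of_eq (ih α₂ γ₂ rfl hG rfl hG' rfl h₂ (Category.assoc _ _ _) h₄)).trans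
        (comp_congr _ _ _ _ _ _)) _

theorem id_append {A X B : D} (P : Path D A X) (Q : Path D X B) :
    id (P.append Q) = append (id P) (id Q) rfl := by
  induction P with
  | nil => rfl
  | cons J P ih =>
    change CellPath.cons (idCell J) (id (P.append Q)) rfl = _
    rw [ih]
    rfl

theorem comp_id {A B A' B' : D} {f : A ⟶ A'} {g : B ⟶ B'} {P : Path D A B} {Q : Path D A' B'}
    (α : Cells f g P Q) : comp α (.id P) (Category.id_comp f) (Category.id_comp g) = α := by
  induction α with
  | nil f =>
    exact comp_nil _ _ _ _
  | cons α αs h ih =>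
    subst h
    rw [id_append]
    refine (comp_cons _ _ _ _ _ _ _ HEq.rfl _ _).trans ?_
    exact cons_congr (Category.id_comp _)
      ((mcomp_congr _ _ _ _ _ _).trans (heq_of_eq (mcomp_id α)))
      ((comp_congr _ _ _ _ _ _).trans (heq_of_eq ih)) _

theorem id_comp {A B A' B' : D} {f : A ⟶ A'} {g : B ⟶ B'} {P : Path D A B} {Q : Path D A' B'}
    (α : Cells f g P Q) : comp (.id Q) α (Category.comp_id f) (Category.comp_id g) = α := by
  induction α with
  | nil f =>
    exact comp_nil _ _ _ _
  | cons α αs h ih =>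
    refine (comp_cons _ _ rfl (single α) αs h _ HEq.rfl _ _).trans ?_
    exact cons_congr (Category.comp_id _)
      ((mcomp_congr _ _ _ _ _ _).trans (heq_of_eq (idCell_mcomp α)))
      ((comp_congr _ _ _ _ _ _).trans (heq_of_eq ih)) _
end CellPath
end VDC

namespace VDC
open VDCStruct VirtualDoubleCategory

/-- A category enriched in a virtual double category `E`: objects with an extent in `E`, hom proarrows,
identities (cells with empty horizontal domain) and composition cells. -/
structure EnrichedCat (E : Type u) [VirtualDoubleCategory.{w, p, v} E] where
  obj : Type t
  ext : obj → E
  hom : ∀ a b : obj, Pro (ext a) (ext b)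
  ident : ∀ a : obj, Cell (𝟙 (ext a)) (𝟙 (ext a)) (.nil (ext a)) (hom a a)
  compos : ∀ a b c : obj,
    Cell (𝟙 (ext a)) (𝟙 (ext c)) (.cons (hom a b) (.single (hom b c))) (hom a c)
  ident_compos : ∀ a b : obj,
    mcomp (compos a a b) (.cons (ident a) (.single (idCell (hom a b))) rfl)
      (Category.id_comp _) (Category.id_comp _) = idCell (hom a b)
  compos_ident : ∀ a b : obj,
    mcomp (compos a b b) (.cons (idCell (hom a b)) (.single (ident b)) rfl)
      (Category.id_comp _) (Category.id_comp _) = idCell (hom a b)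
  assoc : ∀ a b c d : obj,
    mcomp (compos a c d) (.cons (compos a b c) (.single (idCell (hom c d))) rfl)
      (Category.id_comp _) (Category.id_comp _) =
    mcomp (compos a b d) (.cons (idCell (hom a b)) (.single (compos b c d)) rfl)
      (Category.id_comp _) (Category.id_comp _)

namespace CellPath
variable {D : Type u} [VirtualDoubleCategory.{w, p, v} D]

theorem single_comp {A B A' B' A'' B'' : D} {f : A ⟶ A'} {g : B ⟶ B'} {f' : A' ⟶ A''}
    {g' : B' ⟶ B''} {F : A ⟶ A''} {G : B ⟶ B''} {P : Path D A B} {Q : Path D A' B'}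
    {K : Pro A'' B''} (α : Cell f' g' Q K) (β : Cells f g P Q) (hf : f ≫ f' = F)
    (hg : g ≫ g' = G) : comp (single α) β hf hg = single (mcomp α β hf hg) := by
  subst hg
  exact comp_cons α (.nil g') Q.append_nil β (.nil g) P.append_nil β (append_nil β).symm hf rfl

theorem cons_comp_cons {A X B A' X' B' A'' X'' B'' : D} {f : A ⟶ A'} {m : X ⟶ X'} {g : B ⟶ B'}
    {f' : A' ⟶ A''} {m' : X' ⟶ X''} {g' : B' ⟶ B''} {F : A ⟶ A''} {M : X ⟶ X''} {G : B ⟶ B''}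
    {P₁ : Path D A X} {P₂ : Path D X B} {P : Path D A B}
    {J : Pro A' X'} {Q : Path D X' B'} {K : Pro A'' X''} {R : Path D X'' B''}
    (α : Cell f' m' (.single J) K) (αs : Cells m' g' Q R)
    (β : Cell f m P₁ J) (βs : Cells m g P₂ Q) (h : P₁.append P₂ = P)
    (hf : f ≫ f' = F) (hm : m ≫ m' = M) (hg : g ≫ g' = G) :
    comp (.cons α αs rfl) (.cons β βs h) hf hg =
      .cons (mcomp α (.single β) hf hm) (comp αs βs hm hg) h := by
  subst hm
  exact comp_cons α αs rfl (.single β) βs h _ HEq.rfl hf hg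

theorem single_comp_single {A B A' B' A'' B'' : D} {f : A ⟶ A'} {g : B ⟶ B'} {f' : A' ⟶ A''}
    {g' : B' ⟶ B''} {F : A ⟶ A''} {G : B ⟶ B''} {P : Path D A B} {J : Pro A' B'}
    {K : Pro A'' B''} (α : Cell f' g' (.single J) K) (β : Cell f g P J) (hf : f ≫ f' = F)
    (hg : g ≫ g' = G) : comp (single α) (single β) hf hg = single (mcomp α (single β) hf hg) :=
  single_comp _ _ _ _

end CellPath

variable {E : Type u} [VirtualDoubleCategory.{w, p, v} E]

/-- A functor of `E`-categories: it may change extents, along vertical arrows of `E`. -/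
structure EnrichedFunctor (C D : EnrichedCat.{t} E) where
  obj : C.obj → D.obj
  arr : ∀ c : C.obj, C.ext c ⟶ D.ext (obj c)
  hom : ∀ a b : C.obj, Cell (arr a) (arr b) (.single (C.hom a b)) (D.hom (obj a) (obj b))
  map_ident : ∀ a : C.obj,
    mcomp (hom a a) (.single (C.ident a)) (Category.id_comp _) (Category.id_comp _) =
      mcomp (D.ident (obj a)) (.nil (arr a)) (Category.comp_id _) (Category.comp_id _)
  map_compos : ∀ a b c : C.obj,
    mcomp (hom a c) (.single (C.compos a b c)) (Category.id_comp _) (Category.id_comp _) =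
      mcomp (D.compos (obj a) (obj b) (obj c)) (.cons (hom a b) (.single (hom b c)) rfl)
        (Category.comp_id _) (Category.comp_id _)

/-- A profunctor `C ⇸ D` of `E`-categories: proarrows with commuting unital associative actions of
the homs of `C` on the left and of the homs of `D` on the right. -/
structure Profunctor (C D : EnrichedCat.{t} E) where
  pro : ∀ (c : C.obj) (d : D.obj), Pro (C.ext c) (D.ext d)
  lact : ∀ (a b : C.obj) (d : D.obj),
    Cell (𝟙 (C.ext a)) (𝟙 (D.ext d)) (.cons (C.hom a b) (.single (pro b d))) (pro a d)
  ract : ∀ (c : C.obj) (a b : D.obj),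
    Cell (𝟙 (C.ext c)) (𝟙 (D.ext b)) (.cons (pro c a) (.single (D.hom a b))) (pro c b)
  ident_lact : ∀ (c : C.obj) (d : D.obj),
    mcomp (lact c c d) (.cons (C.ident c) (.single (idCell (pro c d))) rfl)
      (Category.id_comp _) (Category.id_comp _) = idCell (pro c d)
  ract_ident : ∀ (c : C.obj) (d : D.obj),
    mcomp (ract c d d) (.cons (idCell (pro c d)) (.single (D.ident d)) rfl)
      (Category.id_comp _) (Category.id_comp _) = idCell (pro c d)
  compos_lact : ∀ (a b c : C.obj) (d : D.obj),
    mcomp (lact a c d) (.cons (C.compos a b c) (.single (idCell (pro c d))) rfl)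
      (Category.id_comp _) (Category.id_comp _) =
    mcomp (lact a b d) (.cons (idCell (C.hom a b)) (.single (lact b c d)) rfl)
      (Category.id_comp _) (Category.id_comp _)
  ract_compos : ∀ (c : C.obj) (d e f : D.obj),
    mcomp (ract c e f) (.cons (ract c d e) (.single (idCell (D.hom e f))) rfl)
      (Category.id_comp _) (Category.id_comp _) =
    mcomp (ract c d f) (.cons (idCell (pro c d)) (.single (D.compos d e f)) rfl)
      (Category.id_comp _) (Category.id_comp _)
  lact_ract : ∀ (a b : C.obj) (d e : D.obj),
    mcomp (ract a d e) (.cons (lact a b d) (.single (idCell (D.hom d e))) rfl)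
      (Category.id_comp _) (Category.id_comp _) =
    mcomp (lact a b e) (.cons (idCell (C.hom a b)) (.single (ract b d e)) rfl)
      (Category.id_comp _) (Category.id_comp _)

namespace EnrichedFunctor

theorem ext_heq {C D : EnrichedCat.{t} E} {F G : EnrichedFunctor C D} (ho : F.obj = G.obj)
    (ha : ∀ c, HEq (F.arr c) (G.arr c)) (hh : ∀ a b, HEq (F.hom a b) (G.hom a b)) : F = G := by
  obtain ⟨o, a, h, _, _⟩ := F
  obtain ⟨o', a', h', _, _⟩ := G
  obtain rfl : o = o' := ho
  obtain rfl : a = a' := funext fun c => eq_of_heq (ha c)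
  obtain rfl : h = h' := by funext x y; exact eq_of_heq (hh x y)
  rfl

@[reducible] def id (C : EnrichedCat.{t} E) : EnrichedFunctor C C where
  obj c := c
  arr c := 𝟙 (C.ext c)
  hom a b := idCell (C.hom a b)
  map_ident a := (idCell_mcomp _).trans (mcomp_id _).symm
  map_compos a b c := (idCell_mcomp _).trans (mcomp_id _).symm

@[reducible] def comp {C D H : EnrichedCat.{t} E} (F : EnrichedFunctor C D) (G : EnrichedFunctor D H) :
    EnrichedFunctor C H where
  obj c := G.obj (F.obj c)
  arr c := F.arr c ≫ G.arr (F.obj c)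
  hom a b := mcomp (G.hom (F.obj a) (F.obj b)) (.single (F.hom a b)) rfl rfl
  map_ident a := by
    have h₁ := mcomp_assoc (G.hom (F.obj a) (F.obj a)) (.single (F.hom a a)) (.single (C.ident a))
      (Category.id_comp _) (Category.id_comp _) rfl rfl (Category.id_comp _) (Category.id_comp _)
      rfl rfl
    rw [CellPath.single_comp, F.map_ident, ← CellPath.single_comp, ← mcomp_assoc (hF' :=
      Category.id_comp _) (hG' := Category.id_comp _) (h₁ := rfl) (h₂ := rfl), G.map_ident,
      mcomp_assoc (hF := rfl) (hG := rfl) (h₃ := Category.comp_id _) (h₄ := Category.comp_id _),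
      CellPath.comp_nil] at h₁
    exact h₁
  map_compos a b c := by
    have h₁ := mcomp_assoc (G.hom (F.obj a) (F.obj c)) (.single (F.hom a c))
      (.single (C.compos a b c))
      (Category.id_comp _) (Category.id_comp _) rfl rfl (Category.id_comp _) (Category.id_comp _)
      rfl rfl
    rw [CellPath.single_comp, F.map_compos, ← CellPath.single_comp, ← mcomp_assoc (hF' :=
      Category.id_comp _) (hG' := Category.id_comp _) (h₁ := rfl) (h₂ := rfl), G.map_compos,
      mcomp_assoc (hF := rfl) (hG := rfl) (h₃ := Category.comp_id _) (h₄ := Category.comp_id _),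
      CellPath.cons_comp_cons (hm := rfl), CellPath.single_comp] at h₁
    exact h₁

end EnrichedFunctor

instance : Category (EnrichedCat.{t} E) where
  Hom C D := EnrichedFunctor C D
  id C := EnrichedFunctor.id C
  comp F G := EnrichedFunctor.comp F G
  id_comp F := EnrichedFunctor.ext_heq rfl (fun _ => heq_of_eq (Category.id_comp _))
    fun _ _ => (CellPath.mcomp_congr _ _ _ _ _ _).trans (heq_of_eq (mcomp_id _))
  comp_id F := EnrichedFunctor.ext_heq rfl (fun _ => heq_of_eq (Category.comp_id _))
    fun _ _ => (CellPath.mcomp_congr _ _ _ _ _ _).trans (heq_of_eq (idCell_mcomp _))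
  assoc F G H := EnrichedFunctor.ext_heq rfl (fun _ => heq_of_eq (Category.assoc _ _ _))
    fun a b => by
      refine HEq.trans ?_ (heq_of_eq (mcomp_assoc (H.hom _ _) (.single (G.hom _ _))
        (.single (F.hom a b)) rfl rfl rfl rfl rfl rfl (Category.assoc _ _ _)
        (Category.assoc _ _ _)).symm)
      rw [CellPath.single_comp]
      exact CellPath.mcomp_congr _ _ _ _ _ _

end VDC

namespace VDC
open VDCStruct VirtualDoubleCategory
variable {E : Type u} [VirtualDoubleCategory.{w, p, v} E]

abbrev ProfPath (C D : EnrichedCat.{t} E) := ProPath (Profunctor (E := E)) C D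

/-- For a list of profunctors `J₁, …, Jₖ` from `C = C₀` to `D = Cₖ`, the tuples of objects
`c₀ : C₀, …, cₖ : Cₖ` with `c₀ = c` and `cₖ = d`. -/
inductive Pts : ∀ {C D : EnrichedCat.{t} E}, ProfPath C D → C.obj → D.obj →
    Type (max (t + 1) (u + 1) (v + 1) (p + 1) (w + 1))
  | nil {C : EnrichedCat.{t} E} (c : C.obj) : Pts (.nil C) c c
  | cons {C D H : EnrichedCat.{t} E} {J : Profunctor C D} {P : ProfPath D H}
      (c : C.obj) {d : D.obj} {h : H.obj} (e : Pts P d h) : Pts (.cons J P) c h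

/-- Tuples `c₀, …, cᵢ, a, cᵢ₊₁', …` of objects along a list of profunctors in which, at one position
`i`, two objects `cᵢ`, `a` of `Cᵢ` are given instead of one. Such a tuple stands for the list of
proarrows `J₁(c₀, c₁), …, Jᵢ(cᵢ₋₁, cᵢ), Cᵢ(cᵢ, a), Jᵢ₊₁(a, cᵢ₊₁), …`. -/
inductive Ins : ∀ {C D : EnrichedCat.{t} E}, ProfPath C D → C.obj → D.obj →
    Type (max (t + 1) (u + 1) (v + 1) (p + 1) (w + 1))
  | here {C D : EnrichedCat.{t} E} {P : ProfPath C D} (c : C.obj) {a : C.obj} {d : D.obj}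
      (e : Pts P a d) : Ins P c d
  | there {C D H : EnrichedCat.{t} E} {J : Profunctor C D} {P : ProfPath D H}
      (c : C.obj) {d : D.obj} {h : H.obj} (s : Ins P d h) : Ins (.cons J P) c h

/-- What remains of an `Ins` after its hom has been absorbed: a tuple of objects, possibly with a hom
left over at the beginning (`head`) or at the end (`tail`). -/
inductive Word {C D : EnrichedCat.{t} E} (P : ProfPath C D) (c : C.obj) (d : D.obj) :
    Type (max (t + 1) (u + 1) (v + 1) (p + 1) (w + 1))
  | plain (e : Pts P c d) : Word P c d
  | head {a : C.obj} (e : Pts P a d) : Word P c d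
  | tail {b : D.obj} (e : Pts P c b) : Word P c d

/-- The list `J₁(c₀, c₁), …, Jₖ(cₖ₋₁, cₖ)` of proarrows of `E`. -/
@[reducible] def Pts.eval : ∀ {C D : EnrichedCat.{t} E} {P : ProfPath C D} {c : C.obj} {d : D.obj},
    Pts P c d → Path E (C.ext c) (D.ext d)
  | _, _, _, _, _, .nil (C := C) c => .nil (C.ext c)
  | _, _, _, _, _, .cons (J := J) c (d := d) e => .cons (J.pro c d) e.eval

/-- The list `J₁(c₀, c₁), …, Jᵢ(cᵢ₋₁, cᵢ), Cᵢ(cᵢ, a), Jᵢ₊₁(a, cᵢ₊₁), …` of proarrows of `E`. -/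
@[reducible] def Ins.eval : ∀ {C D : EnrichedCat.{t} E} {P : ProfPath C D} {c : C.obj} {d : D.obj},
    Ins P c d → Path E (C.ext c) (D.ext d)
  | _, _, _, _, _, .here (C := C) c (a := a) e => .cons (C.hom c a) e.eval
  | _, _, _, _, _, .there (J := J) c (d := d) s => .cons (J.pro c d) s.eval

@[reducible] def Word.eval {C D : EnrichedCat.{t} E} {P : ProfPath C D} {c : C.obj} {d : D.obj} :
    Word P c d → Path E (C.ext c) (D.ext d)
  | .plain e => e.eval
  | .head (a := a) e => .cons (C.hom c a) e.eval
  | .tail (b := b) e => e.eval.append (.single (D.hom b d))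

/-- A word together with a list of cells into the proarrows it stands for. -/
structure Gen {C D : EnrichedCat.{t} E} (P : ProfPath C D) (c : C.obj) (d : D.obj)
    {X Y : E} (f : X ⟶ C.ext c) (g : Y ⟶ D.ext d) (R : Path E X Y) where
  word : Word P c d
  cells : Cells f g R word.eval

@[reducible] def Word.cons {C D H : EnrichedCat.{t} E} (J : Profunctor C D) {P : ProfPath D H} (c : C.obj)
    {d : D.obj} {h : H.obj} : ∀ ω : Word P d h,
      Gen (.cons J P) c h (𝟙 (C.ext c)) (𝟙 (H.ext h)) (.cons (J.pro c d) ω.eval)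
  | .plain e => ⟨.plain (.cons c e), .id _⟩
  | .head (a := a) e => ⟨.plain (.cons c e), .cons (J.ract c d a) (.id e.eval) rfl⟩
  | .tail e => ⟨.tail (.cons c e), .id _⟩

@[reducible] def Gen.cons {C D H : EnrichedCat.{t} E} (J : Profunctor C D) {P : ProfPath D H} (c : C.obj)
    {d : D.obj} {h : H.obj} {X Z Y : E} {f : X ⟶ C.ext c} {m : Z ⟶ D.ext d} {g : Y ⟶ H.ext h}
    {R₁ : Path E X Z} {R₂ : Path E Z Y} {R : Path E X Y} (α : Cell f m R₁ (J.pro c d))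
    (x : Gen P d h m g R₂) (hR : R₁.append R₂ = R) : Gen (.cons J P) c h f g R :=
  ⟨(x.word.cons J c).word, (x.word.cons J c).cells.comp (.cons α x.cells hR)
    (Category.comp_id _) (Category.comp_id _)⟩

/-- Let the inserted hom `Cᵢ(cᵢ, a)` act on the proarrow `Jᵢ(cᵢ₋₁, cᵢ)` to its left. If there is
none (`i = 0`), the hom is left over at the beginning. -/
@[reducible] def Ins.absorbLeft : ∀ {C D : EnrichedCat.{t} E} {P : ProfPath C D} {c : C.obj} {d : D.obj}
    (s : Ins P c d), Gen P c d (𝟙 (C.ext c)) (𝟙 (D.ext d)) s.eval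
  | _, _, _, _, _, .here _ e => ⟨.head e, .id _⟩
  | _, _, _, _, _, .there (J := J) c (d := d) s => s.absorbLeft.cons J c (idCell (J.pro c d)) rfl

/-- Let the inserted hom `Cᵢ(cᵢ, a)` act on the proarrow `Jᵢ₊₁(a, cᵢ₊₁)` to its right. If there is
none (`i = k`), the hom is left over at the end. -/
@[reducible] def Ins.absorbRight : ∀ {C D : EnrichedCat.{t} E} {P : ProfPath C D} {c : C.obj} {d : D.obj}
    (s : Ins P c d), Gen P c d (𝟙 (C.ext c)) (𝟙 (D.ext d)) s.eval
  | _, _, _, _, _, .here c (.nil _) => ⟨.tail (.nil c), .id _⟩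
  | _, _, _, _, _, .here c (a := a) (.cons (J := J) _ (d := d) e) =>
    ⟨.plain (.cons c e), .cons (J.lact c a d) (.id e.eval) rfl⟩
  | _, _, _, _, _, .there (J := J) c (d := d) s => s.absorbRight.cons J c (idCell (J.pro c d)) rfl

abbrev fobj {C D : EnrichedCat.{t} E} (F : C ⟶ D) (c : C.obj) : D.obj := EnrichedFunctor.obj F c
abbrev farr {C D : EnrichedCat.{t} E} (F : C ⟶ D) (c : C.obj) : C.ext c ⟶ D.ext (fobj F c) :=
  EnrichedFunctor.arr F c
abbrev fhom {C D : EnrichedCat.{t} E} (F : C ⟶ D) (a b : C.obj) :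
    Cell (farr F a) (farr F b) (.single (C.hom a b)) (D.hom (fobj F a) (fobj F b)) :=
  EnrichedFunctor.hom F a b

/-- Families of cells `J₁(c₀, c₁), …, Jₖ(cₖ₋₁, cₖ) → K(F c₀, G cₖ)` with vertical boundaries the
components of `F` at `c₀` and of `G` at `cₖ`. -/
abbrev Comps {C D C' D' : EnrichedCat.{t} E} (F : C ⟶ C') (G : D ⟶ D') (P : ProfPath C D)
    (K : Profunctor C' D') :=
  ∀ {c : C.obj} {d : D.obj} (e : Pts P c d),
    Cell (farr F c) (farr G d) e.eval (K.pro (fobj F c) (fobj G d))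

/-- Apply the family `α` to a tuple. A hom left over at the beginning (end) is sent by `F` (by `G`) to
a hom of `C'` (of `D'`), which then acts on `K`. -/
@[reducible] def Word.app {C D C' D' : EnrichedCat.{t} E} {F : C ⟶ C'} {G : D ⟶ D'} {P : ProfPath C D}
    {K : Profunctor C' D'} (α : Comps F G P K) {c : C.obj} {d : D.obj} :
    ∀ ω : Word P c d, Cell (farr F c) (farr G d) ω.eval (K.pro (fobj F c) (fobj G d))
  | .plain e => α e
  | .head (a := a) e =>
    mcomp (K.lact (fobj F c) (fobj F a) (fobj G d)) (.cons (fhom F c a) (.single (α e)) rfl)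
      (Category.comp_id _) (Category.comp_id _)
  | .tail (b := b) e =>
    mcomp (K.ract (fobj F c) (fobj G b) (fobj G d)) (.cons (α e) (.single (fhom G b d)) rfl)
      (Category.comp_id _) (Category.comp_id _)

/-- Cells of profunctors: families of cells of `E` indexed by tuples of objects, such that for every
inserted hom `Cᵢ(cᵢ, a)` acting to the left and acting to the right agree. For `0 < i < k` this says
that `α` equalizes the two actions on neighbouring profunctors; for `i = 0` or `i = k` it says that `α`
commutes with the outer action, through `F` or `G`; for `k = 0` it is naturality. -/
structure ProfCell {C D C' D' : EnrichedCat.{t} E} (F : C ⟶ C') (G : D ⟶ D') (P : ProfPath C D)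
    (K : Profunctor C' D') where
  app : Comps F G P K
  equivariant : ∀ {c : C.obj} {d : D.obj} (s : Ins P c d),
    mcomp (s.absorbLeft.word.app app) s.absorbLeft.cells
      (Category.id_comp _) (Category.id_comp _) =
    mcomp (s.absorbRight.word.app app) s.absorbRight.cells
      (Category.id_comp _) (Category.id_comp _)

/-- A decomposition of a tuple along a concatenation of lists of profunctors. -/
structure PtsSplit {C D H : EnrichedCat.{t} E} (P : ProfPath C D) (Q : ProfPath D H) (c : C.obj)
    (h : H.obj) (R : Path E (C.ext c) (H.ext h)) where
  {d : D.obj}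
  fst : Pts P c d
  snd : Pts Q d h
  eq : fst.eval.append snd.eval = R

def PtsSplit.cons {C C' D H : EnrichedCat.{t} E} {P : ProfPath C' D} {Q : ProfPath D H}
    (J : Profunctor C C') (c : C.obj)
    {c' : C'.obj} {h : H.obj} {R : Path E (C'.ext c') (H.ext h)} (s : PtsSplit P Q c' h R) :
    PtsSplit (.cons J P) Q c h (.cons (J.pro c c') R) :=
  ⟨.cons c s.fst, s.snd, congrArg (ProPath.cons (J.pro c c')) s.eq⟩

@[reducible] def Pts.split : ∀ {C D H : EnrichedCat.{t} E} (P : ProfPath C D) (Q : ProfPath D H) {c : C.obj}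
    {h : H.obj} (e : Pts (P.append Q) c h), PtsSplit P Q c h e.eval
  | _, _, _, .nil _, _, c, _, e => ⟨.nil c, e, rfl⟩
  | _, _, _, .cons J P, Q, _, _, e =>
    match (e : Pts (.cons J (P.append Q)) _ _) with
    | .cons c e => (Pts.split P Q e).cons J c

@[reducible] def Pts.splitOf {C D H : EnrichedCat.{t} E} {P : ProfPath C D} {Q : ProfPath D H}
    {R : ProfPath C H} (hR : P.append Q = R) {c : C.obj}
    {h : H.obj} (e : Pts R c h) : PtsSplit P Q c h e.eval :=
  match R, hR, e with
  | _, rfl, e => e.split P Q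

abbrev ProfCells {C D C' D' : EnrichedCat.{t} E} (F : C ⟶ C') (G : D ⟶ D') (P : ProfPath C D)
    (Q : ProfPath C' D') := CellPath (@ProfCell E _) F G P Q

/-- A tuple of objects along `P` with a list of cells into the proarrows it stands for. -/
structure Image {C D : EnrichedCat.{t} E} (P : ProfPath C D) (c : C.obj) (d : D.obj)
    {X Y : E} (f : X ⟶ C.ext c) (g : Y ⟶ D.ext d) (R : Path E X Y) where
  pts : Pts P c d
  cells : Cells f g R pts.eval

@[reducible] def PtsSplit.image {C X D C' X' D' : EnrichedCat.{t} E} {F : C ⟶ C'} {M : X ⟶ X'} {G : D ⟶ D'}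
    {P₁ : ProfPath C X} {P₂ : ProfPath X D} {K : Profunctor C' X'} {Q : ProfPath X' D'}
    (α : ProfCell F M P₁ K) {c : C.obj} {d : D.obj} {R : Path E (C.ext c) (D.ext d)}
    (s : PtsSplit P₁ P₂ c d R)
    (im : ∀ {x : X.obj} (e : Pts P₂ x d),
      Image Q (fobj M x) (fobj G d) (farr M x) (farr G d) e.eval) :
    Image (.cons K Q) (fobj F c) (fobj G d) (farr F c) (farr G d) R :=
  ⟨.cons (fobj F c) (im s.snd).pts, .cons (α.app s.fst) (im s.snd).cells s.eq⟩

/-- Evaluate a list of cells of profunctors at a tuple of objects: the tuple of the images of the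
objects at the ends of the blocks, and the list of the components at the blocks. -/
def image : ∀ {C D C' D' : EnrichedCat.{t} E} {F : C ⟶ C'} {G : D ⟶ D'} {P : ProfPath C D}
    {Q : ProfPath C' D'} (_ : ProfCells F G P Q) {c : C.obj} {d : D.obj} (e : Pts P c d),
    Image Q (fobj F c) (fobj G d) (farr F c) (farr G d) e.eval
  | _, _, _, _, _, _, _, _, .nil F, _, _, .nil c => ⟨.nil (fobj F c), .nil (farr F c)⟩
  | _, _, _, _, _, _, _, _, .cons α αs h, _, _, e =>
    (e.splitOf h).image α (fun e₂ => image αs e₂)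

end VDC

namespace VDC
open VDCStruct VirtualDoubleCategory
variable {E : Type u} [VirtualDoubleCategory.{w, p, v} E]

@[reducible] def Pts.append : ∀ {C D H : EnrichedCat.{t} E} {P : ProfPath C D} {Q : ProfPath D H} {c : C.obj}
    {d : D.obj} {h : H.obj} (_ : Pts P c d) (_ : Pts Q d h), Pts (P.append Q) c h
  | _, _, _, _, _, _, _, _, .nil _, e' => e'
  | _, _, _, _, _, _, _, _, .cons c e, e' => .cons c (e.append e')

theorem Pts.eval_append {C D H : EnrichedCat.{t} E} {P : ProfPath C D} {Q : ProfPath D H}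
    {c : C.obj} {d : D.obj} {h : H.obj} (e : Pts P c d) (e' : Pts Q d h) :
    e.eval.append e'.eval = (e.append e').eval := by
  induction e with
  | nil => rfl
  | cons c e ih => exact congrArg _ (ih e')

theorem Pts.exists_append {C D H : EnrichedCat.{t} E} {P : ProfPath C D} {Q : ProfPath D H}
    {c : C.obj} {h : H.obj} (e : Pts (P.append Q) c h) :
    ∃ (d : D.obj) (e₁ : Pts P c d) (e₂ : Pts Q d h), e = e₁.append e₂ := by
  induction P with
  | nil => exact ⟨c, .nil c, e, rfl⟩
  | cons J P ih =>
    change Pts (.cons J (P.append Q)) c h at e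
    cases e with
    | cons c e =>
      obtain ⟨d, e₁, e₂, rfl⟩ := ih e
      exact ⟨d, .cons c e₁, e₂, rfl⟩

theorem Pts.split_append {C D H : EnrichedCat.{t} E} {P : ProfPath C D} {Q : ProfPath D H}
    {c : C.obj} {d : D.obj} {h : H.obj} (e : Pts P c d) (e' : Pts Q d h) :
    (e.append e').split P Q = ⟨e, e', e.eval_append e'⟩ := by
  induction e with
  | nil => rfl
  | cons c e ih =>
    change PtsSplit.cons _ c ((e.append e').split _ Q) = _
    rw [ih]
    rfl

theorem Pts.append_append {C D H I : EnrichedCat.{t} E} {P : ProfPath C D} {Q : ProfPath D H}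
    {R : ProfPath H I} {c : C.obj} {d : D.obj} {h : H.obj} {i : I.obj} (e : Pts P c d)
    (e' : Pts Q d h) (e'' : Pts R h i) :
    HEq ((e.append e').append e'') (e.append (e'.append e'')) := by
  induction e with
  | nil => rfl
  | cons c e ih =>
    have := ih e'
    simp only [Pts.append]
    congr! 1
    exact ProPath.append_assoc _ _ _

theorem Pts.append_nil {C D : EnrichedCat.{t} E} {P : ProfPath C D} {c : C.obj} {d : D.obj}
    (e : Pts P c d) : HEq (e.append (.nil d)) e := by
  induction e with
  | nil => rfl
  | cons c e ih =>
    simp only [Pts.append]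
    congr! 1
    exact ProPath.append_nil _

section image
variable {C X D C' X' D' : EnrichedCat.{t} E} {F : C ⟶ C'} {M : X ⟶ X'} {G : D ⟶ D'}
  {P₁ : ProfPath C X} {P₂ : ProfPath X D}

theorem image_cons {P : ProfPath C D} {K : Profunctor C' X'} {Q : ProfPath X' D'}
    (α : ProfCell F M P₁ K) (αs : ProfCells M G P₂ Q) (h : P₁.append P₂ = P)
    {c : C.obj} {x : X.obj} {d : D.obj} (e₁ : Pts P₁ c x) (e₂ : Pts P₂ x d) (e : Pts P c d)
    (he : HEq e (e₁.append e₂)) (hr : e₁.eval.append e₂.eval = e.eval) :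
    image (.cons α αs h) e =
      ⟨.cons (fobj F c) (image αs e₂).pts, .cons (α.app e₁) (image αs e₂).cells hr⟩ := by
  subst h; cases he
  simp only [image, Pts.splitOf]
  rw [Pts.split_append]

theorem image_single {P : ProfPath C D} {K : Profunctor C' D'} (α : ProfCell F G P K)
    {c : C.obj} {d : D.obj} (e : Pts P c d) :
    image (.cons α (.nil G) P.append_nil) e =
      ⟨.cons (fobj F c) (.nil _), .single (α.app e)⟩ :=
  image_cons α (.nil G) P.append_nil e (.nil d) e e.append_nil.symm (ProPath.append_nil _)
end image

section words
variable {C X D C' X' D' : EnrichedCat.{t} E} {F : C ⟶ C'} {M : X ⟶ X'} {G : D ⟶ D'}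
  {P₁ : ProfPath C X} {P₂ : ProfPath X D}

@[reducible] def Ins.insLeft : ∀ {C X D : EnrichedCat.{t} E} {P : ProfPath C X} {Q : ProfPath X D} {c : C.obj}
    {x : X.obj} {d : D.obj} (_ : Ins P c x) (_ : Pts Q x d), Ins (P.append Q) c d
  | _, _, _, _, _, _, _, _, .here c e, e' => .here c (e.append e')
  | _, _, _, _, _, _, _, _, .there c s, e' => .there c (s.insLeft e')

@[reducible] def Ins.insRight : ∀ {C X D : EnrichedCat.{t} E} {P : ProfPath C X} {Q : ProfPath X D} {c : C.obj}
    {x : X.obj} {d : D.obj} (_ : Pts P c x) (_ : Ins Q x d), Ins (P.append Q) c d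
  | _, _, _, _, _, _, _, _, .nil _, s => s
  | _, _, _, _, _, _, _, _, .cons c e, s => .there c (Ins.insRight e s)

theorem Ins.eval_insLeft {c : C.obj} {x : X.obj} {d : D.obj} (s : Ins P₁ c x) (e : Pts P₂ x d) :
    s.eval.append e.eval = (s.insLeft e).eval := by
  induction s with
  | here c e' => exact congrArg _ (e'.eval_append e)
  | there c s ih => exact congrArg _ (ih e)

theorem Ins.eval_insRight {c : C.obj} {x : X.obj} {d : D.obj} (e : Pts P₁ c x) (s : Ins P₂ x d) :
    e.eval.append s.eval = (Ins.insRight e s).eval := by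
  induction e with
  | nil c => rfl
  | cons c e ih => exact congrArg _ (ih s)

end words
end VDC

namespace VDC
open VDCStruct VirtualDoubleCategory
variable {E : Type u} [VirtualDoubleCategory.{w, p, v} E]

section
variable {C D C' D' C'' D'' : EnrichedCat.{t} E} {F : C ⟶ C'} {G : D ⟶ D'}
  {F' : C' ⟶ C''} {G' : D' ⟶ D''} {P : ProfPath C D} {Q : ProfPath C' D'} {K : Profunctor C'' D''}

/-- The components of the composite of cells of profunctors are the composites of the components. -/
def compApp (β : ProfCell F' G' Q K) (αs : ProfCells F G P Q) : Comps (F ≫ F') (G ≫ G') P K :=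
  fun e => mcomp (β.app (image αs e).pts) (image αs e).cells rfl rfl

@[reducible] def Word.image (αs : ProfCells F G P Q) {c : C.obj} {d : D.obj} :
    ∀ ω : Word P c d, Gen Q (fobj F c) (fobj G d) (farr F c) (farr G d) ω.eval
  | .plain e => ⟨.plain (VDC.image αs e).pts, (VDC.image αs e).cells⟩
  | .head (a := a) e => ⟨.head (VDC.image αs e).pts, .cons (fhom F c a) (VDC.image αs e).cells rfl⟩
  | .tail (b := b) e =>
    ⟨.tail (VDC.image αs e).pts, (VDC.image αs e).cells.append (.single (fhom G b d)) rfl⟩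

theorem Word.app_compApp (β : ProfCell F' G' Q K) (αs : ProfCells F G P Q) {c : C.obj} {d : D.obj}
    (ω : Word P c d) :
    ω.app (compApp β αs) = mcomp ((ω.image αs).word.app β.app) (ω.image αs).cells rfl rfl := by
  cases ω with
  | plain e => rfl
  | head e =>
    refine Eq.trans ?_ (mcomp_assoc _ _ _ rfl rfl (Category.comp_id _) (Category.comp_id _)
      rfl rfl (Category.comp_id _) (Category.comp_id _)).symm
    dsimp only [Word.image]
    rw [CellPath.cons_comp_cons (hm := rfl), CellPath.single_comp]
    rfl
  | tail e =>
    refine Eq.trans ?_ (mcomp_assoc _ _ _ rfl rfl (Category.comp_id _) (Category.comp_id _)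
      rfl rfl (Category.comp_id _) (Category.comp_id _)).symm
    dsimp only [Word.image]
    rw [CellPath.comp_cons (hγ := HEq.rfl), CellPath.single_comp]
    rfl

inductive Gen.Rel : ∀ {C D : EnrichedCat.{t} E} {P : ProfPath C D} {c : C.obj} {d : D.obj}
    {X Y : E} {f : X ⟶ C.ext c} {g : Y ⟶ D.ext d} {R : Path E X Y},
    Gen P c d f g R → Gen P c d f g R → Prop
  | absorb {C D : EnrichedCat.{t} E} {P : ProfPath C D} {c : C.obj} {d : D.obj}
    {X Y : E} {f : X ⟶ C.ext c} {g : Y ⟶ D.ext d} {R : Path E X Y} (s : Ins P c d)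
    (γ : Cells f g R s.eval) :
    Gen.Rel ⟨s.absorbLeft.word, s.absorbLeft.cells.comp γ (Category.comp_id _) (Category.comp_id _)⟩
      ⟨s.absorbRight.word, s.absorbRight.cells.comp γ (Category.comp_id _) (Category.comp_id _)⟩
  | refl {C D : EnrichedCat.{t} E} {P : ProfPath C D} {c : C.obj} {d : D.obj}
    {X Y : E} {f : X ⟶ C.ext c} {g : Y ⟶ D.ext d} {R : Path E X Y} (x : Gen P c d f g R) :
    Gen.Rel x x
  | trans {C D : EnrichedCat.{t} E} {P : ProfPath C D} {c : C.obj} {d : D.obj}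
    {X Y : E} {f : X ⟶ C.ext c} {g : Y ⟶ D.ext d} {R : Path E X Y} {x y z : Gen P c d f g R}
    (h : Gen.Rel x y) (h' : Gen.Rel y z) : Gen.Rel x z

theorem Gen.Rel.mcomp_eq {c : C.obj} {d : D.obj} {K : Profunctor C' D'}
    {X Y : E} {f : X ⟶ C.ext c} {g : Y ⟶ D.ext d} {R : Path E X Y} {x y : Gen P c d f g R}
    (h : Gen.Rel x y) (β : ProfCell F G P K) :
    mcomp (x.word.app β.app) x.cells rfl rfl = mcomp (y.word.app β.app) y.cells rfl rfl := by
  induction h with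
  | absorb s γ =>
    have := congrArg (fun z => mcomp z γ rfl rfl) (β.equivariant s)
    rw [mcomp_assoc (hF := Category.comp_id _) (hG := Category.comp_id _) (h₃ := rfl) (h₄ := rfl),
      mcomp_assoc (hF := Category.comp_id _) (hG := Category.comp_id _) (h₃ := rfl) (h₄ := rfl)]
      at this
    exact this
  | refl => rfl
  | trans _ _ ih ih' => exact ih.trans ih'

theorem Gen.Rel.cons {C D H : EnrichedCat.{t} E} (J : Profunctor C D) {P : ProfPath D H} (c : C.obj)
    {d : D.obj} {h : H.obj} {X Z Y : E} {f : X ⟶ C.ext c} {m : Z ⟶ D.ext d} {g : Y ⟶ H.ext h}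
    {R₁ : Path E X Z} {R₂ : Path E Z Y} {R : Path E X Y} (α : Cell f m R₁ (J.pro c d))
    {x y : Gen P d h m g R₂} (hxy : Gen.Rel x y) (hR : R₁.append R₂ = R) :
    Gen.Rel (x.cons J c α hR) (y.cons J c α hR) := by
  induction hxy with
  | absorb s γ =>
    have := Gen.Rel.absorb (.there (J := J) c s) (.cons α γ hR)
    simp only [Ins.absorbLeft, Ins.absorbRight, Gen.cons] at this ⊢
    rw [CellPath.comp_assoc (hF := Category.comp_id _) (hG := Category.comp_id _)
        (h₃ := Category.comp_id _) (h₄ := Category.comp_id _),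
      CellPath.comp_assoc (hF := Category.comp_id _) (hG := Category.comp_id _)
        (h₃ := Category.comp_id _) (h₄ := Category.comp_id _)] at this
    rw [CellPath.cons_comp_cons (hm := Category.comp_id _), CellPath.cons_comp_cons (hm := Category.comp_id _), idCell_mcomp] at this
    exact this
  | refl => exact .refl _
  | trans _ _ ih ih' => exact ih.trans ih'

end

theorem Gen.cons_plain {C D H : EnrichedCat.{t} E} (J : Profunctor C D) {P : ProfPath D H}
    (c : C.obj) {d : D.obj} {h : H.obj} {X Z Y : E} {f : X ⟶ C.ext c} {m : Z ⟶ D.ext d}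
    {g : Y ⟶ H.ext h} {R₁ : Path E X Z} {R₂ : Path E Z Y} {R : Path E X Y}
    (α : Cell f m R₁ (J.pro c d)) (e : Pts P d h) (φ : Cells m g R₂ e.eval)
    (hR : R₁.append R₂ = R) :
    Gen.cons J c α ⟨.plain e, φ⟩ hR = ⟨.plain (.cons c e), .cons α φ hR⟩ := by
  simp only [Gen.cons, Word.cons]
  rw [CellPath.id_comp]

theorem Gen.cons_tail {C D H : EnrichedCat.{t} E} (J : Profunctor C D) {P : ProfPath D H}
    (c : C.obj) {d : D.obj} {b h : H.obj} {X Z Y : E} {f : X ⟶ C.ext c} {m : Z ⟶ D.ext d}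
    {g : Y ⟶ H.ext h} {R₁ : Path E X Z} {R₂ : Path E Z Y} {R : Path E X Y}
    (α : Cell f m R₁ (J.pro c d)) (e : Pts P d b)
    (φ : Cells m g R₂ (e.eval.append (.single (H.hom b h)))) (hR : R₁.append R₂ = R) :
    Gen.cons J c α ⟨.tail e, φ⟩ hR = ⟨.tail (.cons c e), .cons α φ hR⟩ := by
  simp only [Gen.cons, Word.cons]
  rw [CellPath.id_comp]

theorem CellPath.id_append_heq {A X B : E} (P : Path E A X) (Q : Path E X B) {R R' : Path E A B}
    (h : P.append Q = R) (h' : P.append Q = R') :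
    HEq (id R) (append (id P) (id Q) h') := by
  subst h h'; exact heq_of_eq (id_append P Q)

theorem CellPath.id_heq {A B : E} {P Q : Path E A B} (h : P = Q) : HEq (id P) (id Q) := by
  subst h; rfl

section ins
variable {C X D : EnrichedCat.{t} E} {P : ProfPath C X} {Q : ProfPath X D}

theorem Ins.absorbLeft_insLeft {c : C.obj} {x : X.obj} {d : D.obj} (s : Ins P c x)
    (e₂ : Pts Q x d) :
    (∃ (a : C.obj) (e₁ : Pts P a x), s = .here c e₁) ∨
    ∃ (e₁ : Pts P c x) (φ : Cells (𝟙 (C.ext c)) (𝟙 (X.ext x)) s.eval e₁.eval)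
      (ψ : Cells (𝟙 (C.ext c)) (𝟙 (D.ext d)) (s.insLeft e₂).eval (e₁.append e₂).eval),
      s.absorbLeft = ⟨.plain e₁, φ⟩ ∧ (s.insLeft e₂).absorbLeft = ⟨.plain (e₁.append e₂), ψ⟩ ∧
      HEq ψ (φ.append (.id e₂.eval) (s.eval_insLeft e₂)) := by
  induction s with
  | here c e => exact .inl ⟨_, e, rfl⟩
  | there c s ih =>
    right
    rename_i J P a x
    rcases ih e₂ with ⟨b, e₁, rfl⟩ | ⟨e₁, φ, ψ, h₁, h₂, h₃⟩
    · refine ⟨.cons c e₁, .cons (J.ract c a b) (.id e₁.eval) rfl,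
        .cons (J.ract c a b) (.id (e₁.append e₂).eval) rfl, ?_, ?_, ?_⟩
      · simp only [Ins.absorbLeft, Gen.cons, Word.cons]
        congr 1
        exact CellPath.comp_id _
      · simp only [Ins.absorbLeft, Gen.cons, Word.cons, Ins.insLeft]
        congr 1
        exact CellPath.comp_id _
      · exact CellPath.cons_heq _ (e₁.eval_append e₂).symm (e₁.eval_append e₂).symm
          (CellPath.id_append_heq _ _ (e₁.eval_append e₂) rfl) _ _
    · refine ⟨.cons c e₁, .cons (idCell _) φ rfl, .cons (idCell _) ψ rfl, ?_, ?_, ?_⟩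
      · simp only [Ins.absorbLeft]
        rw [h₁, Gen.cons_plain]
      · change Gen.cons J c (idCell _) (s.insLeft e₂).absorbLeft rfl = _
        rw [h₂, Gen.cons_plain]
      · refine CellPath.cons_heq _ (s.eval_insLeft e₂).symm (e₁.eval_append e₂).symm ?_ _ _
        refine h₃.trans ?_
        congr! 1

theorem Ins.absorbRight_insLeft {c : C.obj} {x : X.obj} {d : D.obj} (s : Ins P c x)
    (e₂ : Pts Q x d) :
    (∃ (b : X.obj) (e₁ : Pts P c b) (φ : Cells (𝟙 (C.ext c)) (𝟙 (X.ext x)) s.eval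
      (e₁.eval.append (.single (X.hom b x)))), s.absorbRight = ⟨.tail e₁, φ⟩ ∧
      HEq φ (CellPath.id s.eval) ∧ s.eval = e₁.eval.append (.single (X.hom b x)) ∧
      s.insLeft e₂ = Ins.insRight e₁ (.here b e₂)) ∨
    ∃ (e₁ : Pts P c x) (φ : Cells (𝟙 (C.ext c)) (𝟙 (X.ext x)) s.eval e₁.eval)
      (ψ : Cells (𝟙 (C.ext c)) (𝟙 (D.ext d)) (s.insLeft e₂).eval (e₁.append e₂).eval),
      s.absorbRight = ⟨.plain e₁, φ⟩ ∧ (s.insLeft e₂).absorbRight = ⟨.plain (e₁.append e₂), ψ⟩ ∧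
      HEq ψ (φ.append (.id e₂.eval) (s.eval_insLeft e₂)) := by
  induction s with
  | here c e =>
    cases e with
    | nil a => exact .inl ⟨c, .nil c, .id _, rfl, HEq.rfl, rfl, rfl⟩
    | cons a e =>
      refine .inr ⟨.cons c e, .cons (Profunctor.lact _ c _ _) (.id e.eval) rfl,
        .cons (Profunctor.lact _ c _ _) (.id (e.append e₂).eval) rfl, rfl, rfl, ?_⟩
      exact CellPath.cons_heq _ (e.eval_append e₂).symm (e.eval_append e₂).symm
          (CellPath.id_append_heq _ _ (e.eval_append e₂) rfl) _ _
  | there c s ih =>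
    rename_i J P a x
    rcases ih e₂ with ⟨b, e₁, φ, h₁, h₂, h₃, h₄⟩ | ⟨e₁, φ, ψ, h₁, h₂, h₃⟩
    · left
      refine ⟨b, .cons c e₁, .cons (idCell _) φ rfl, ?_, ?_, congrArg _ h₃, congrArg (Ins.there c) h₄⟩
      · simp only [Ins.absorbRight]
        rw [h₁, Gen.cons_tail]
      · exact CellPath.cons_heq _ rfl h₃.symm h₂ _ _
    · right
      refine ⟨.cons c e₁, .cons (idCell _) φ rfl, .cons (idCell _) ψ rfl, ?_, ?_, ?_⟩
      · simp only [Ins.absorbRight]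
        rw [h₁, Gen.cons_plain]
      · change Gen.cons J c (idCell _) (s.insLeft e₂).absorbRight rfl = _
        rw [h₂, Gen.cons_plain]
      · refine CellPath.cons_heq _ (s.eval_insLeft e₂).symm (e₁.eval_append e₂).symm ?_ _ _
        refine h₃.trans ?_
        congr! 1

inductive Gen.Pre {c : C.obj} {x : X.obj} {d : D.obj} (e₁ : Pts P c x) {S : Path E (X.ext x) (D.ext d)}
    {S' : Path E (C.ext c) (D.ext d)} (hS : e₁.eval.append S = S') :
    Gen Q x d (𝟙 (X.ext x)) (𝟙 (D.ext d)) S →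
    Gen (P.append Q) c d (𝟙 (C.ext c)) (𝟙 (D.ext d)) S' → Prop
  | plain (e₂ : Pts Q x d) (φ : Cells (𝟙 (X.ext x)) (𝟙 (D.ext d)) S e₂.eval)
      (ψ : Cells (𝟙 (C.ext c)) (𝟙 (D.ext d)) S' (e₁.append e₂).eval)
      (hψ : HEq ψ ((CellPath.id e₁.eval).append φ hS)) :
      Gen.Pre e₁ hS ⟨.plain e₂, φ⟩ ⟨.plain (e₁.append e₂), ψ⟩
  | tail {b : D.obj} (e₂ : Pts Q x b)
      (φ : Cells (𝟙 (X.ext x)) (𝟙 (D.ext d)) S (e₂.eval.append (.single (D.hom b d))))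
      (ψ : Cells (𝟙 (C.ext c)) (𝟙 (D.ext d)) S' ((e₁.append e₂).eval.append (.single (D.hom b d))))
      (hψ : HEq ψ ((CellPath.id e₁.eval).append φ hS)) :
      Gen.Pre e₁ hS ⟨.tail e₂, φ⟩ ⟨.tail (e₁.append e₂), ψ⟩

end ins

end VDC

namespace VDC
open VDCStruct VirtualDoubleCategory
variable {E : Type u} [VirtualDoubleCategory.{w, p, v} E]

section ins
variable {C X D : EnrichedCat.{t} E} {P : ProfPath C X} {Q : ProfPath X D}

theorem Gen.Pre.cons {C₀ : EnrichedCat.{t} E} (J : Profunctor C₀ C) (c₀ : C₀.obj)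
    {c : C.obj} {x : X.obj} {d : D.obj} {e₁ : Pts P c x}
    {S : Path E (X.ext x) (D.ext d)} {S' : Path E (C.ext c) (D.ext d)}
    {hS : e₁.eval.append S = S'} {y : Gen Q x d (𝟙 (X.ext x)) (𝟙 (D.ext d)) S}
    {y' : Gen (P.append Q) c d (𝟙 (C.ext c)) (𝟙 (D.ext d)) S'} (h : Gen.Pre e₁ hS y y') :
    Gen.Pre (.cons (J := J) c₀ e₁) (congrArg (ProPath.cons (J.pro c₀ c)) hS) y
      (y'.cons J c₀ (idCell (J.pro c₀ c)) rfl) := by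
  subst hS
  cases h with
  | plain e₂ φ ψ hψ =>
    rw [Gen.cons_plain]
    exact .plain (e₁ := .cons (J := J) c₀ e₁) e₂ φ _
      (CellPath.cons_heq _ rfl (e₁.eval_append e₂).symm hψ _ _)
  | tail e₂ φ ψ hψ =>
    rw [Gen.cons_tail]
    refine .tail (e₁ := .cons (J := J) c₀ e₁) e₂ φ _
      (CellPath.cons_heq _ rfl ?_ hψ _ _)
    rw [← e₁.eval_append e₂, ProPath.append_assoc]

theorem Ins.absorbLeft_insRight {c : C.obj} {x : X.obj} {d : D.obj} (e₁ : Pts P c x)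
    (s : Ins Q x d) (e : Pts Q x d) (φ : Cells (𝟙 (X.ext x)) (𝟙 (D.ext d)) s.eval e.eval)
    (h : s.absorbLeft = ⟨.plain e, φ⟩) :
    Gen.Pre e₁ (s.eval_insRight e₁) s.absorbLeft (Ins.insRight e₁ s).absorbLeft := by
  induction e₁ with
  | nil c => rw [h]; exact .plain (e₁ := .nil c) e φ φ HEq.rfl
  | cons c e₁ ih => exact (ih s e φ h).cons _ c

theorem Ins.absorbRight_word {c : C.obj} {x : X.obj} (s : Ins P c x) :
    (∃ e φ, s.absorbRight = ⟨.plain e, φ⟩) ∨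
      ∃ (b : X.obj) (e : Pts P c b) (φ : _), s.absorbRight = ⟨.tail e, φ⟩ := by
  induction s with
  | here c e =>
    cases e with
    | nil c => exact .inr ⟨_, _, _, rfl⟩
    | cons => exact .inl ⟨_, _, rfl⟩
  | there c s ih =>
    simp only [Ins.absorbRight]
    rcases ih with ⟨e, φ, h⟩ | ⟨b, e, φ, h⟩
    · rw [h, Gen.cons_plain]; exact .inl ⟨_, _, rfl⟩
    · rw [h, Gen.cons_tail]; exact .inr ⟨_, _, _, rfl⟩

theorem Ins.absorbRight_insRight {c : C.obj} {x : X.obj} {d : D.obj} (e₁ : Pts P c x)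
    (s : Ins Q x d) :
    Gen.Pre e₁ (s.eval_insRight e₁) s.absorbRight (Ins.insRight e₁ s).absorbRight := by
  induction e₁ with
  | nil c =>
    rcases s.absorbRight_word with ⟨e, φ, h⟩ | ⟨b, e, φ, h⟩
    · simp only [Ins.insRight]; rw [h]; exact .plain (e₁ := .nil c) e φ φ HEq.rfl
    · simp only [Ins.insRight]; rw [h]; exact .tail (e₁ := .nil c) e φ φ HEq.rfl
  | cons c e₁ ih => exact (ih s).cons _ c

theorem Ins.exists_ins {c : C.obj} {d : D.obj} (s : Ins (P.append Q) c d) :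
    (∃ (x : X.obj) (s₁ : Ins P c x) (e : Pts Q x d), s = s₁.insLeft e) ∨
    ∃ (x : X.obj) (e : Pts P c x) (s₁ : Ins Q x d) (e' : Pts Q x d)
      (φ : Cells (𝟙 (X.ext x)) (𝟙 (D.ext d)) s₁.eval e'.eval),
      s₁.absorbLeft = ⟨.plain e', φ⟩ ∧ s = Ins.insRight e s₁ := by
  induction P with
  | nil =>
    cases s with
    | here c e => exact .inl ⟨_, .here c (.nil _), e, rfl⟩
    | there c s =>
      rcases s.absorbLeft_insLeft (.nil d) with ⟨a, e, rfl⟩ | ⟨e, φ, _, h, -⟩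
      · refine .inr ⟨c, .nil c, .there c (.here _ e), .cons c e,
          (Ins.absorbLeft (.there c (.here _ e))).cells, rfl, rfl⟩
      · refine .inr ⟨c, .nil c, .there c s, .cons c e, .cons (idCell _) φ rfl, ?_, rfl⟩
        · simp only [Ins.absorbLeft]
          rw [h, Gen.cons_plain]
  | cons J P ih =>
    change Ins (.cons J (P.append Q)) c d at s
    cases s with
    | here c e =>
      obtain ⟨x, e₁, e₂, rfl⟩ := Pts.exists_append (P := .cons J P) e
      exact .inl ⟨x, .here c e₁, e₂, rfl⟩
    | there c s =>
      rcases ih s with ⟨x, s₁, e, rfl⟩ | ⟨x, e, s₁, e', φ, h, rfl⟩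
      · exact .inl ⟨x, .there c s₁, e, rfl⟩
      · exact .inr ⟨x, .cons c e, s₁, e', φ, h, rfl⟩
end ins

@[reducible] def Gen.map {C D C' D' : EnrichedCat.{t} E} {F : C ⟶ C'} {G : D ⟶ D'} {P : ProfPath C D}
    {Q : ProfPath C' D'} (αs : ProfCells F G P Q) {c : C.obj} {d : D.obj}
    {X Y : E} {f : X ⟶ C.ext c} {g : Y ⟶ D.ext d} {f' : X ⟶ C'.ext (fobj F c)}
    {g' : Y ⟶ D'.ext (fobj G d)} {R : Path E X Y} (y : Gen P c d f g R)
    (hf : f ≫ farr F c = f') (hg : g ≫ farr G d = g') :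
    Gen Q (fobj F c) (fobj G d) f' g' R :=
  ⟨(y.word.image αs).word, (y.word.image αs).cells.comp y.cells hf hg⟩

section main
variable {C X D C' X' D' : EnrichedCat.{t} E} {F : C ⟶ C'} {M : X ⟶ X'} {G : D ⟶ D'}
  {P₁ : ProfPath C X} {P₂ : ProfPath X D} {K : Profunctor C' X'} {Q : ProfPath X' D'}

theorem Gen.Pre.map_eq (α : ProfCell F M P₁ K) (αs : ProfCells M G P₂ Q)
    {c : C.obj} {x : X.obj} {d : D.obj} {e₁ : Pts P₁ c x}
    {S : Path E (X.ext x) (D.ext d)} {S' : Path E (C.ext c) (D.ext d)}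
    {hS : e₁.eval.append S = S'} {y : Gen P₂ x d (𝟙 (X.ext x)) (𝟙 (D.ext d)) S}
    {y' : Gen (P₁.append P₂) c d (𝟙 (C.ext c)) (𝟙 (D.ext d)) S'} (h : Gen.Pre e₁ hS y y') :
    y'.map (.cons α αs rfl) (Category.id_comp _) (Category.id_comp _) =
      (y.map αs (Category.id_comp _) (Category.id_comp _)).cons K (fobj F c) (α.app e₁) hS := by
  cases h with
  | plain e₂ φ ψ hψ =>
    simp only [Gen.map, Word.image]
    rw [image_cons α αs rfl e₁ e₂ _ HEq.rfl (e₁.eval_append e₂), Gen.cons_plain,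
      CellPath.comp_cons (hγ := hψ)]
    congr 1
    exact CellPath.cons_congr (Category.id_comp _)
      ((CellPath.mcomp_congr _ _ _ _ _ _).trans (heq_of_eq (mcomp_id _)))
      (CellPath.comp_congr _ _ _ _ _ _) _
  | tail e₂ φ ψ hψ =>
    simp only [Gen.map, Word.image]
    rw [image_cons α αs rfl e₁ e₂ _ HEq.rfl (e₁.eval_append e₂), Gen.cons_tail]
    congr 1
    refine (CellPath.comp_cons _ _ _ _ _ _ _ hψ _ _).trans ?_
    exact CellPath.cons_congr (Category.id_comp _)
      ((CellPath.mcomp_congr _ _ _ _ _ _).trans (heq_of_eq (mcomp_id _)))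
      (CellPath.comp_congr _ _ _ _ _ _) _

theorem Gen.Rel.of_eq {c : C.obj} {d : D.obj} {P : ProfPath C D}
    {X Y : E} {f : X ⟶ C.ext c} {g : Y ⟶ D.ext d} {R : Path E X Y} {x y : Gen P c d f g R}
    (h : x = y) : Gen.Rel x y := h ▸ .refl x

theorem absorbLeft_insLeft_map (α : ProfCell F M P₁ K) (αs : ProfCells M G P₂ Q)
    {c : C.obj} {x : X.obj} {d : D.obj} (s : Ins P₁ c x) (e₂ : Pts P₂ x d) :
    Gen.Rel ((s.insLeft e₂).absorbLeft.map (.cons α αs rfl) (Category.id_comp _) (Category.id_comp _))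
      ⟨.plain (.cons (fobj F c) (image αs e₂).pts),
        .cons (mcomp (s.absorbLeft.word.app α.app) s.absorbLeft.cells (Category.id_comp _)
          (Category.id_comp _)) (image αs e₂).cells (s.eval_insLeft e₂)⟩ := by
  rcases s.absorbLeft_insLeft e₂ with ⟨a, e₁, rfl⟩ | ⟨e₁, φ, ψ, h₁, h₂, h₃⟩
  · have := Gen.Rel.absorb (.here (P := .cons K Q) (fobj F c) (.cons (fobj F a) (image αs e₂).pts))
      (.cons (fhom F c a) (.cons (α.app e₁) (image αs e₂).cells (e₁.eval_append e₂)) rfl)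
    simp only [Ins.absorbLeft, Gen.map, Word.image] at this ⊢
    rw [CellPath.id_comp] at this
    rw [image_cons α αs rfl e₁ e₂ _ HEq.rfl (e₁.eval_append e₂), CellPath.comp_id]
    refine this.trans ?_
    have h : e₁.eval.append e₂.eval = (e₁.append e₂).eval := e₁.eval_append e₂
    refine Gen.Rel.of_eq (congrArg (Gen.mk _) ?_)
    refine (CellPath.comp_cons (β := .cons (fhom F c a) (.single (α.app e₁)) rfl) (m := farr M x)
      (βs := (image αs e₂).cells) (h := congrArg (ProPath.cons (C.hom c a)) h)
      (hγ := CellPath.cons_heq _ h.symm rfl (CellPath.cons_heq _ rfl rfl HEq.rfl _ _) _ _)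
      _ _ _ _ _ _).trans ?_
    exact CellPath.cons_congr (Category.comp_id _)
      ((CellPath.mcomp_congr _ _ _ _ _ _).trans (heq_of_eq (mcomp_id _).symm))
      ((CellPath.comp_congr _ _ _ _ _ _).trans (heq_of_eq (CellPath.id_comp _))) _
  · simp only [Gen.map]
    rw [h₁, h₂]
    simp only [Word.image, Word.app]
    rw [image_cons α αs rfl e₁ e₂ _ HEq.rfl (e₁.eval_append e₂), CellPath.comp_cons (hγ := h₃)]
    rw [CellPath.cons_congr (Category.id_comp _)
      (CellPath.mcomp_congr _ _ _ _ _ _)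
      ((CellPath.comp_congr _ _ _ _ _ _).trans (heq_of_eq (CellPath.comp_id _))) _]
    exact .refl _

theorem absorbRight_insLeft_map (α : ProfCell F M P₁ K) (αs : ProfCells M G P₂ Q)
    (ih : ∀ {c : X.obj} {d : D.obj} (s : Ins P₂ c d),
      Gen.Rel (s.absorbLeft.map αs (Category.id_comp _) (Category.id_comp _))
        (s.absorbRight.map αs (Category.id_comp _) (Category.id_comp _)))
    {c : C.obj} {x : X.obj} {d : D.obj} (s : Ins P₁ c x) (e₂ : Pts P₂ x d)
    (s' : Ins (P₁.append P₂) c d) (hs : s' = s.insLeft e₂) (hR : s.eval.append e₂.eval = s'.eval) :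
    Gen.Rel
      ⟨.plain (.cons (fobj F c) (image αs e₂).pts),
        .cons (mcomp (s.absorbRight.word.app α.app) s.absorbRight.cells (Category.id_comp _)
          (Category.id_comp _)) (image αs e₂).cells hR⟩
      (s'.absorbRight.map (.cons α αs rfl) (Category.id_comp _)
        (Category.id_comp _)) := by
  rcases s.absorbRight_insLeft e₂ with ⟨b, e₁, φ, h₁, h₂, h₃, h₄⟩ | ⟨e₁, φ, ψ, h₁, h₂, h₃⟩
  · have h₅ := Ins.absorbRight_insRight e₁ (.here b e₂)
    have h₆ := h₅.map_eq α αs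
    have h₇ := Gen.Rel.cons K (fobj F c) (α.app e₁) (ih (.here b e₂))
      (Ins.eval_insRight e₁ (.here b e₂))
    rw [← h₆] at h₇
    obtain rfl := hs.trans h₄
    refine Gen.Rel.trans ?_ h₇
    rw [h₁]
    clear h₁
    generalize s.eval = R at φ h₂ h₃ hR
    subst h₃
    cases h₂
    simp only [Gen.cons, Gen.map, Word.image, Word.cons, Ins.absorbLeft]
    rw [CellPath.comp_id]
    refine Gen.Rel.of_eq (congrArg (Gen.mk _) ?_)
    refine Eq.trans ?_ (CellPath.comp_cons (β := .cons (α.app e₁) (.single (fhom M b x)) rfl)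
      (m := farr M x) (βs := (image αs e₂).cells) (h := hR)
      (hγ := CellPath.cons_heq _ rfl rfl HEq.rfl _ _) _ _ _ _ _ _).symm
    exact (CellPath.cons_congr (Category.comp_id _)
      ((CellPath.mcomp_congr _ _ _ _ _ _).trans (heq_of_eq (mcomp_id _).symm))
      ((CellPath.comp_congr _ _ _ _ _ _).trans (heq_of_eq (CellPath.id_comp _))) _).symm
  · subst hs
    simp only [Gen.map]
    rw [h₁, h₂]
    simp only [Word.image, Word.app]
    rw [image_cons α αs rfl e₁ e₂ _ HEq.rfl (e₁.eval_append e₂), CellPath.comp_cons (hγ := h₃)]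
    rw [CellPath.cons_congr (Category.id_comp _)
      (CellPath.mcomp_congr _ _ _ _ _ _)
      ((CellPath.comp_congr _ _ _ _ _ _).trans (heq_of_eq (CellPath.comp_id _))) _]
    exact .refl _

theorem image_rel {C D C' D' : EnrichedCat.{t} E} {F : C ⟶ C'} {G : D ⟶ D'}
    {P : ProfPath C D} {Q : ProfPath C' D'} (αs : ProfCells F G P Q) {c : C.obj} {d : D.obj}
    (s : Ins P c d) :
    Gen.Rel (s.absorbLeft.map αs (Category.id_comp _) (Category.id_comp _))
      (s.absorbRight.map αs (Category.id_comp _) (Category.id_comp _)) := by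
  induction αs with
  | nil F =>
    cases s with
    | @here _ _ _ c a d e =>
      cases e with
      | nil =>
        have := Gen.Rel.absorb (.here (P := .nil _) (fobj F c) (.nil (fobj F d)))
          (.single (fhom F c d))
        simp only [Ins.absorbLeft, Ins.absorbRight, Gen.map] at this ⊢
        rw [CellPath.id_comp] at this
        rw [CellPath.comp_id, CellPath.comp_id]
        exact this
  | cons α αs h ih =>
    subst h
    rcases s.exists_ins with ⟨x, s, e, rfl⟩ | ⟨x, e, s, e', φ, h, rfl⟩
    · refine (absorbLeft_insLeft_map α αs s e).trans ?_
      rw [α.equivariant]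
      exact absorbRight_insLeft_map α αs ih s e _ rfl _
    · rw [(Ins.absorbLeft_insRight e s e' φ h).map_eq, (Ins.absorbRight_insRight e s).map_eq]
      exact (ih s).cons _ _ _ _

end main

theorem compApp_equivariant {C D C' D' C'' D'' : EnrichedCat.{t} E} {F : C ⟶ C'} {G : D ⟶ D'}
    {F' : C' ⟶ C''} {G' : D' ⟶ D''} {P : ProfPath C D} {Q : ProfPath C' D'}
    {K : Profunctor C'' D''} (β : ProfCell F' G' Q K) (αs : ProfCells F G P Q)
    {c : C.obj} {d : D.obj} (s : Ins P c d) :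
    mcomp (s.absorbLeft.word.app (compApp β αs)) s.absorbLeft.cells
      (Category.id_comp _) (Category.id_comp _) =
    mcomp (s.absorbRight.word.app (compApp β αs)) s.absorbRight.cells
      (Category.id_comp _) (Category.id_comp _) := by
  rw [Word.app_compApp, Word.app_compApp,
    mcomp_assoc (hF := Category.id_comp _) (hG := Category.id_comp _) (h₃ := rfl) (h₄ := rfl),
    mcomp_assoc (hF := Category.id_comp _) (hG := Category.id_comp _) (h₃ := rfl) (h₄ := rfl)]
  exact (image_rel αs s).mcomp_eq β

end VDC

namespace VDC
open VDCStruct VirtualDoubleCategory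
variable {E : Type u} [VirtualDoubleCategory.{w, p, v} E]

section
namespace ProfCell
variable {C D C' D' C'' D'' : EnrichedCat.{t} E} {F : C ⟶ C'} {G : D ⟶ D'}
  {F' : C' ⟶ C''} {G' : D' ⟶ D''} {P : ProfPath C D} {Q : ProfPath C' D'} {K : Profunctor C'' D''}

theorem ext {J : Profunctor C' D'} {α β : ProfCell F G P J}
    (h : ∀ {c : C.obj} {d : D.obj} (e : Pts P c d), α.app e = β.app e) : α = β := by
  obtain ⟨a, _⟩ := α
  obtain ⟨b, _⟩ := β
  congr 1
  funext c d e
  exact h e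

theorem ext_heq {J : Profunctor C' D'} {F₁ : C ⟶ C'} {G₁ : D ⟶ D'} {α : ProfCell F G P J}
    {β : ProfCell F₁ G₁ P J} (hF : F = F₁) (hG : G = G₁)
    (h : ∀ {c : C.obj} {d : D.obj} (e : Pts P c d), HEq (α.app e) (β.app e)) : HEq α β := by
  subst hF hG
  exact heq_of_eq (ext fun e => eq_of_heq (h e))

/-- The composite of cells of profunctors. -/
def comp {F'' : C ⟶ C''} {G'' : D ⟶ D''} (β : ProfCell F' G' Q K) (αs : ProfCells F G P Q)
    (hF : F ≫ F' = F'') (hG : G ≫ G' = G'') : ProfCell F'' G'' P K :=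
  match F'', hF, G'', hG with
  | _, rfl, _, rfl => ⟨compApp β αs, compApp_equivariant β αs⟩

theorem comp_app_heq {F'' : C ⟶ C''} {G'' : D ⟶ D''} (β : ProfCell F' G' Q K)
    (αs : ProfCells F G P Q) (hF : F ≫ F' = F'') (hG : G ≫ G' = G'') {c : C.obj} {d : D.obj}
    (e : Pts P c d) :
    HEq ((comp β αs hF hG).app e) (mcomp (β.app (image αs e).pts) (image αs e).cells rfl rfl) := by
  subst hF hG; rfl

end ProfCell
end

namespace ProfCell

def idApp {C D : EnrichedCat.{t} E} (J : Profunctor C D) : Comps (𝟙 C) (𝟙 D) (.single J) J :=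
  fun {_ _} e => match e with
  | .cons c (.nil d) => idCell (J.pro c d)

def id {C D : EnrichedCat.{t} E} (J : Profunctor C D) : ProfCell (𝟙 C) (𝟙 D) (.single J) J where
  app := idApp J
  equivariant s := by
    cases s with
    | here c e =>
      cases e with
      | cons a e =>
        cases e
        exact congrArg (fun x => mcomp x (.id _) _ _) (mcomp_id _) |>.trans
          ((mcomp_id _).trans (idCell_mcomp _).symm)
    | there c s =>
      cases s with
      | here a e =>
        cases e
        refine Eq.trans (congrArg (fun x => mcomp (idCell _) x _ _) (CellPath.comp_id _)) ?_
        refine Eq.trans (idCell_mcomp _) ?_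
        refine Eq.trans (mcomp_id _).symm ?_
        exact (congrArg₂ (fun x y => mcomp x y _ _) (mcomp_id _) (CellPath.comp_id _)).symm

end ProfCell

/-- The data of the virtual double category of `E`-categories, functors, profunctors and their cells. -/
instance : VDCStruct (EnrichedCat.{t} E) where
  Pro := Profunctor
  Cell := ProfCell
  idCell := ProfCell.id
  mcomp := ProfCell.comp

theorem ProfCell.mcomp_app_heq {C D C' D' C'' D'' : EnrichedCat.{t} E} {F : C ⟶ C'} {G : D ⟶ D'}
    {F' : C' ⟶ C''} {G' : D' ⟶ D''} {P : ProfPath C D} {Q : ProfPath C' D'}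
    {K : Profunctor C'' D''} {F'' : C ⟶ C''} {G'' : D ⟶ D''} (β : ProfCell F' G' Q K)
    (αs : ProfCells F G P Q) (hF : F ≫ F' = F'') (hG : G ≫ G' = G'') {c : C.obj} {d : D.obj}
    (e : Pts P c d) :
    HEq (ProfCell.app (mcomp β αs hF hG) e)
      (mcomp (β.app (image αs e).pts) (image αs e).cells rfl rfl) :=
  ProfCell.comp_app_heq β αs hF hG e

section
variable {C X D C' X' D' C'' D'' : EnrichedCat.{t} E} {F : C ⟶ C'} {M : X ⟶ X'} {G : D ⟶ D'}
  {P₁ : ProfPath C X} {P₂ : ProfPath X D}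

theorem image_append {P : ProfPath C D} {Q₁ : ProfPath C' X'} {Q₂ : ProfPath X' D'}
    (γ₁ : ProfCells F M P₁ Q₁) (γ₂ : ProfCells M G P₂ Q₂) (h : P₁.append P₂ = P)
    {c : C.obj} {x : X.obj} {d : D.obj} (e₁ : Pts P₁ c x) (e₂ : Pts P₂ x d) (e : Pts P c d)
    (he : HEq e (e₁.append e₂)) (hr : e₁.eval.append e₂.eval = e.eval) :
    ∃ ψ, image (CellPath.append γ₁ γ₂ h) e = ⟨(image γ₁ e₁).pts.append (image γ₂ e₂).pts, ψ⟩ ∧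
      HEq ψ (CellPath.append (image γ₁ e₁).cells (image γ₂ e₂).cells hr) := by
  induction γ₁ with
  | nil F =>
    subst h
    cases e₁
    cases he
    exact ⟨_, rfl, HEq.rfl⟩
  | cons γ γ₁ hγ ih =>
    subst hγ h
    cases he
    obtain ⟨y, e₁, e₁', rfl⟩ := e₁.exists_append
    obtain ⟨ψ, h₁, h₂⟩ := ih γ₂ rfl e₁' e₂ _ HEq.rfl (e₁'.eval_append e₂)
    have h₃ : e₁.eval.append (e₁'.append e₂).eval = ((e₁.append e₁').append e₂).eval := by
      rw [← Pts.eval_append, ← Pts.eval_append, ← Pts.eval_append, ProPath.append_assoc]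
    have h₄ := image_cons γ (CellPath.append γ₁ γ₂ rfl) (ProPath.append_assoc _ _ _).symm
      e₁ (e₁'.append e₂) ((e₁.append e₁').append e₂) (Pts.append_append _ _ _) h₃
    have h₅ := image_cons γ γ₁ rfl e₁ e₁' _ HEq.rfl (e₁.eval_append e₁')
    rw [h₅]
    refine ⟨.cons (γ.app e₁) ψ h₃, h₄.trans ?_, ?_⟩
    · rw [h₁]
    · refine CellPath.cons_heq _ (e₁'.eval_append e₂).symm (Pts.eval_append _ _).symm
        (h₂.trans ?_) _ _
      congr! 1

theorem image_comp {F' : C' ⟶ C''} {G' : D' ⟶ D''} {P : ProfPath C D} {Q : ProfPath C' D'}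
    {R : ProfPath C'' D''} (αs : ProfCells F' G' Q R) (γs : ProfCells F G P Q)
    {c : C.obj} {d : D.obj} (e : Pts P c d) :
    image (CellPath.comp αs γs rfl rfl) e =
      ⟨(image αs (image γs e).pts).pts,
        (image αs (image γs e).pts).cells.comp (image γs e).cells rfl rfl⟩ := by
  induction αs generalizing C with
  | nil F' =>
    cases γs
    cases e
    rfl
  | cons α αs h ih =>
    subst h
    obtain ⟨Y, m, P₁, P₂, γ₁, γ₂, rfl, rfl⟩ := CellPath.exists_append _ _ γs
    obtain ⟨y, e₁, e₂, rfl⟩ := e.exists_append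
    rw [CellPath.comp_cons (hγ := HEq.rfl)]
    obtain ⟨ψ, h₁, h₂⟩ := image_append γ₁ γ₂ rfl e₁ e₂ _ HEq.rfl (e₁.eval_append e₂)
    rw [h₁, image_cons _ _ rfl e₁ e₂ _ HEq.rfl (e₁.eval_append e₂),
      image_cons α αs rfl _ _ _ HEq.rfl (Pts.eval_append _ _), ih]
    congr 1
    refine Eq.trans ?_ (CellPath.comp_cons _ _ _ _ _ (e₁.eval_append e₂) _ h₂ _ _).symm
    rfl

theorem image_id {C D : EnrichedCat.{t} E} {P : ProfPath C D} {c : C.obj} {d : D.obj}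
    (e : Pts P c d) : image (CellPath.id P) e = ⟨e, .id e.eval⟩ := by
  induction e with
  | nil c => rfl
  | cons c e ih =>
    rename_i J P a h
    refine (image_cons (ProfCell.id J) (CellPath.id P) rfl (.cons c (.nil a)) e _ HEq.rfl
      rfl).trans ?_
    rw [ih]
    rfl

end

/-- `E`-categories form a virtual double category. -/
instance : VirtualDoubleCategory (EnrichedCat.{t} E) where
  idCell_mcomp {C D C' D' F G P K} α := by
    refine eq_of_heq (ProfCell.ext_heq rfl rfl ?_)
    intro c d e
    refine (ProfCell.mcomp_app_heq _ _ _ _ e).trans ?_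
    rw [CellPath.single, image_single]
    exact (CellPath.mcomp_congr _ _ _ _ _ _).trans (heq_of_eq (idCell_mcomp _))
  mcomp_id {C D C' D' F G P K} α := by
    refine eq_of_heq (ProfCell.ext_heq rfl rfl ?_)
    intro c d e
    refine (ProfCell.mcomp_app_heq _ _ _ _ e).trans ?_
    rw [image_id]
    exact (CellPath.mcomp_congr _ _ _ _ _ _).trans (heq_of_eq (mcomp_id _))
  mcomp_assoc {_ _ _ _ _ _ _ _ _ _ _ _ _ _ _ _ _ _ _ _ _ _ _ _} β α γ hF hG hF' hG'
      h₁ h₂ h₃ h₄ := by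
    subst hF hG hF' hG' h₁ h₂
    refine eq_of_heq (ProfCell.ext_heq rfl rfl ?_)
    intro c d e
    refine HEq.trans ?_ (ProfCell.mcomp_app_heq _ _ _ _ e).symm
    rw [image_comp]
    refine HEq.trans ?_ ((heq_of_eq (mcomp_assoc _ _ _ rfl rfl rfl rfl rfl rfl
      (Category.assoc _ _ _) (Category.assoc _ _ _))).trans (CellPath.mcomp_congr _ _ _ _ _ _))
    rfl

end VDC

namespace VDC
open VDCStruct VirtualDoubleCategory

theorem comp_cons_of_eq {D : Type u} [VDCStruct.{w, p, v} D] {A X B A' X' B' A'' X'' B'' : D}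
    {f : A ⟶ A'} {m : X ⟶ X'} {g : B ⟶ B'}
    {f' : A' ⟶ A''} {m' : X' ⟶ X''} {g' : B' ⟶ B''} {F : A ⟶ A''} {M : X ⟶ X''} {G : B ⟶ B''}
    {P₁ : Path D A X} {P₂ : Path D X B} {P : Path D A B}
    {Q₁ : Path D A' X'} {Q₂ : Path D X' B'} {Q : Path D A' B'}
    {K : Pro A'' X''} {R : Path D X'' B''}
    (α : Cell f' m' Q₁ K) (αs : Cells m' g' Q₂ R) (hQ : Q₁.append Q₂ = Q)
    (β : Cells f m P₁ Q₁) (βs : Cells m g P₂ Q₂) (h : P₁.append P₂ = P) (γ : Cells f g P Q)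
    (hγ : HEq γ (CellPath.append β βs h))
    (hf : f ≫ f' = F) (hm : m ≫ m' = M) (hg : g ≫ g' = G) :
    CellPath.comp (.cons α αs hQ) γ hf hg =
      .cons (mcomp α β hf hm) (CellPath.comp αs βs hm hg) h := by
  subst hm
  exact CellPath.comp_cons α αs hQ β βs h γ hγ hf hg

section
variable {D : Type u} [VirtualDoubleCategory.{w, p, v} D]

/-- The list of cells `id, …, id, μ, id, …, id`. -/
def whisker {Z X Y W : D} (R : Path D Z X) {P : Path D X Y} {J : Pro X Y}
    (μ : Cell (𝟙 X) (𝟙 Y) P J) (S : Path D Y W) :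
    Cells (𝟙 Z) (𝟙 W) (R.append (P.append S)) (R.append (.cons J S)) :=
  (CellPath.id R).append (.cons μ (.id S) rfl) rfl

/-- The cell `μ : J₁, …, Jₖ → J` exhibits `J` as the composite: every cell with horizontal domain
`R, J₁, …, Jₖ, S` factors uniquely through `id, μ, id`. -/
def IsComposite {X Y : D} {P : Path D X Y} {J : Pro X Y} (μ : Cell (𝟙 X) (𝟙 Y) P J) : Prop :=
  ∀ {Z W Y₀ Y₁ : D} (f : Z ⟶ Y₀) (g : W ⟶ Y₁) (R : Path D Z X) (S : Path D Y W) (K : Pro Y₀ Y₁)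
    (β : Cell f g (R.append (P.append S)) K),
    ∃! β' : Cell f g (R.append (.cons J S)) K,
      mcomp β' (whisker R μ S) (Category.id_comp f) (Category.id_comp g) = β

/-- Cartesian cells: every cell into `K` whose vertical boundaries factor through `f` and `g` factors
uniquely through `ρ`. -/
def IsCartesian {A B A' B' : D} {f : A ⟶ A'} {g : B ⟶ B'} {L : Pro A B} {K : Pro A' B'}
    (ρ : Cell f g (.single L) K) : Prop :=
  ∀ {X Y : D} (h : X ⟶ A) (k : Y ⟶ B) (P : Path D X Y) (γ : Cell (h ≫ f) (k ≫ g) P K),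
    ∃! γ' : Cell h k P L, mcomp ρ (.single γ') rfl rfl = γ

/-- `J` is a composite of the list `P`. -/
def CompositeOf {X Y : D} (P : Path D X Y) (J : Pro X Y) : Prop :=
  ∃ μ : Cell (𝟙 X) (𝟙 Y) P J, IsComposite μ

/-- `U` is a unit of `X`, that is, a composite of the empty list. -/
def UnitOf (X : D) (U : Pro X X) : Prop := CompositeOf (.nil X) U

/-- Isomorphism of parallel proarrows. -/
def ProIso {X Y : D} (J K : Pro X Y) : Prop :=
  ∃ (φ : Cell (𝟙 X) (𝟙 Y) (.single J) K) (ψ : Cell (𝟙 X) (𝟙 Y) (.single K) J),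
    mcomp ψ (.single φ) (Category.id_comp _) (Category.id_comp _) = idCell J ∧
    mcomp φ (.single ψ) (Category.id_comp _) (Category.id_comp _) = idCell K

/-- Equivalence in the horizontal bicategory: there are proarrows `J : A ⇸ B`, `K : B ⇸ A` whose
composites `JK` and `KJ` exist and are isomorphic to units of `A` and `B`. In the virtual double category
of `E`-categories this is Morita equivalence. -/
def HorizontallyEquivalent (A B : D) : Prop :=
  ∃ (J : Pro A B) (K : Pro B A) (L U : Pro A A) (M V : Pro B B),
    CompositeOf (.cons J (.single K)) L ∧ CompositeOf (.cons K (.single J)) M ∧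
    UnitOf A U ∧ UnitOf B V ∧ ProIso L U ∧ ProIso M V
end

/-- Virtual equipments: virtual double categories with (chosen) units and (chosen) restrictions. -/
class VirtualEquipment (E : Type u) [VirtualDoubleCategory.{w, p, v} E] where
  unit : ∀ A : E, Pro A A
  unitCell : ∀ A : E, Cell (𝟙 A) (𝟙 A) (.nil A) (unit A)
  unitCell_isComposite : ∀ A : E, IsComposite (unitCell A)
  restr : ∀ {A B A' B' : E} (f : A ⟶ A') (g : B ⟶ B') (_ : Pro A' B'), Pro A B
  restrCell : ∀ {A B A' B' : E} (f : A ⟶ A') (g : B ⟶ B') (K : Pro A' B'),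
    Cell f g (.single (restr f g K)) K
  restrCell_isCartesian : ∀ {A B A' B' : E} (f : A ⟶ A') (g : B ⟶ B') (K : Pro A' B'),
    IsCartesian (restrCell f g K)

namespace VirtualEquipment
variable {E : Type u} [VirtualDoubleCategory.{w, p, v} E] [VirtualEquipment E]

theorem exists_lift {A B A' B' X Y : E} (f : A ⟶ A') (g : B ⟶ B') (K : Pro A' B') {h : X ⟶ A}
    {k : Y ⟶ B} {F : X ⟶ A'} {G : Y ⟶ B'} {P : Path E X Y} (γ : Cell F G P K) (hF : h ≫ f = F)
    (hG : k ≫ g = G) :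
    ∃ γ' : Cell h k P (restr f g K), mcomp (restrCell f g K) (.single γ') hF hG = γ := by
  subst hF hG
  exact (restrCell_isCartesian f g K h k P γ).exists

/-- The factorization of a cell through the restriction cell. -/
noncomputable def lift {A B A' B' X Y : E} {f : A ⟶ A'} {g : B ⟶ B'} {K : Pro A' B'} {h : X ⟶ A}
    {k : Y ⟶ B} {F : X ⟶ A'} {G : Y ⟶ B'} {P : Path E X Y} (γ : Cell F G P K) (hF : h ≫ f = F)
    (hG : k ≫ g = G) : Cell h k P (restr f g K) :=
  (exists_lift f g K γ hF hG).choose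

theorem restrCell_lift {A B A' B' X Y : E} {f : A ⟶ A'} {g : B ⟶ B'} {K : Pro A' B'} {h : X ⟶ A}
    {k : Y ⟶ B} {F : X ⟶ A'} {G : Y ⟶ B'} {P : Path E X Y} (γ : Cell F G P K) (hF : h ≫ f = F)
    (hG : k ≫ g = G) : mcomp (restrCell f g K) (.single (lift γ hF hG)) hF hG = γ :=
  (exists_lift f g K γ hF hG).choose_spec

theorem restr_ext {A B A' B' X Y : E} {f : A ⟶ A'} {g : B ⟶ B'} {K : Pro A' B'} {h : X ⟶ A}
    {k : Y ⟶ B} {F : X ⟶ A'} {G : Y ⟶ B'} {P : Path E X Y} {x y : Cell h k P (restr f g K)}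
    (hF : h ≫ f = F) (hG : k ≫ g = G)
    (hxy : mcomp (restrCell f g K) (.single x) hF hG = mcomp (restrCell f g K) (.single y) hF hG) :
    x = y := by
  subst hF hG
  exact (restrCell_isCartesian f g K h k P _).unique hxy rfl

theorem exists_unitMul (A : E) :
    ∃ m : Cell (𝟙 A) (𝟙 A) (.cons (unit A) (.single (unit A))) (unit A),
      mcomp m (.cons (idCell (unit A)) (.single (unitCell A)) rfl) (Category.id_comp _)
        (Category.id_comp _) = idCell (unit A) :=
  (unitCell_isComposite A (𝟙 A) (𝟙 A) (.single (unit A)) (.nil A) (unit A)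
    (idCell (unit A))).exists

/-- The canonical cell from two copies of the unit to the unit. -/
noncomputable def unitMul (A : E) :
    Cell (𝟙 A) (𝟙 A) (.cons (unit A) (.single (unit A))) (unit A) :=
  (exists_unitMul A).choose

theorem unitMul_right (A : E) :
    mcomp (unitMul A) (.cons (idCell (unit A)) (.single (unitCell A)) rfl) (Category.id_comp _)
      (Category.id_comp _) = idCell (unit A) :=
  (exists_unitMul A).choose_spec

theorem unitMul_left (A : E) :
    mcomp (unitMul A) (.cons (unitCell A) (.single (idCell (unit A))) rfl) (Category.id_comp _)
      (Category.id_comp _) = idCell (unit A) := by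
  refine (unitCell_isComposite A (𝟙 A) (𝟙 A) (.nil A) (.nil A) (unit A)
    (unitCell A)).unique ?_ (idCell_mcomp _)
  have h₁ := unitMul_right A
  change mcomp _ (.single (unitCell A)) _ _ = _
  rw [mcomp_assoc (hF := Category.id_comp _) (hG := Category.id_comp _)
    (h₃ := Category.id_comp _) (h₄ := Category.id_comp _),
    comp_cons_of_eq (β := .nil (𝟙 A)) (βs := .single (unitCell A)) (h := rfl)
      (γ := .single (unitCell A)) (hγ := HEq.rfl)
      (hm := Category.id_comp _), CellPath.single_comp_single, idCell_mcomp,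
    show mcomp (unitCell A) (.nil (𝟙 A)) (Category.id_comp _) (Category.id_comp _) = unitCell A from
      mcomp_id _]
  have h₂ := congrArg (fun x => mcomp x (.single (unitCell A)) (Category.id_comp _)
    (Category.id_comp _)) h₁
  rw [mcomp_assoc (hF := Category.id_comp _) (hG := Category.id_comp _)
    (h₃ := Category.id_comp _) (h₄ := Category.id_comp _),
    comp_cons_of_eq (β := .single (unitCell A)) (βs := .nil (𝟙 A)) (h := rfl)
      (γ := .single (unitCell A)) (hγ := HEq.rfl)
      (hm := Category.id_comp _), CellPath.single_comp, idCell_mcomp,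
    show mcomp (unitCell A) (.nil (𝟙 A)) (Category.id_comp _) (Category.id_comp _) = unitCell A from
      mcomp_id _] at h₂
  exact h₂

theorem unitMul_assoc (A : E) :
    mcomp (unitMul A) (.cons (unitMul A) (.single (idCell (unit A))) rfl) (Category.id_comp _)
      (Category.id_comp _) =
    mcomp (unitMul A) (.cons (idCell (unit A)) (.single (unitMul A)) rfl) (Category.id_comp _)
      (Category.id_comp _) := by
  refine (unitCell_isComposite A (𝟙 A) (𝟙 A) (.cons (unit A) (.single (unit A))) (.nil A) (unit A)
    (unitMul A)).unique ?_ ?_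
  · change mcomp _ (.cons (idCell (unit A)) (.cons (idCell (unit A)) (.single (unitCell A)) rfl)
      rfl) _ _ = _
    have h₁ : mcomp (unitMul A) (CellPath.id (.cons (unit A) (.single (unit A))))
      (Category.id_comp _) (Category.id_comp _) = unitMul A := mcomp_id _
    rw [mcomp_assoc (hF := Category.id_comp _) (hG := Category.id_comp _)
      (h₃ := Category.id_comp _) (h₄ := Category.id_comp _),
      comp_cons_of_eq (β := CellPath.id (.cons (unit A) (.single (unit A))))
        (βs := .single (unitCell A)) (h := rfl) (γ := .cons (idCell (unit A))
          (.cons (idCell (unit A)) (.single (unitCell A)) rfl) rfl) (hγ := HEq.rfl)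
        (hm := Category.id_comp _), CellPath.single_comp_single, idCell_mcomp, h₁]
    have h₂ := congrArg (fun x => mcomp x (.single (unitMul A)) (Category.id_comp _)
      (Category.id_comp _)) (unitMul_right A)
    rw [mcomp_assoc (hF := Category.id_comp _) (hG := Category.id_comp _)
      (h₃ := Category.id_comp _) (h₄ := Category.id_comp _),
      comp_cons_of_eq (β := .single (unitMul A)) (βs := .nil (𝟙 A)) (h := rfl)
        (γ := .single (unitMul A)) (hγ := HEq.rfl)
        (hm := Category.id_comp _), CellPath.single_comp, idCell_mcomp,
      show mcomp (unitCell A) (.nil (𝟙 A)) (Category.id_comp _) (Category.id_comp _) =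
        unitCell A from mcomp_id _] at h₂
    exact h₂
  · change mcomp _ (.cons (idCell (unit A)) (.cons (idCell (unit A)) (.single (unitCell A)) rfl)
      rfl) _ _ = _
    have h₁ : mcomp (unitMul A) (CellPath.id (.cons (unit A) (.single (unit A))))
      (Category.id_comp _) (Category.id_comp _) = unitMul A := mcomp_id _
    rw [mcomp_assoc (hF := Category.id_comp _) (hG := Category.id_comp _)
      (h₃ := Category.id_comp _) (h₄ := Category.id_comp _),
      CellPath.cons_comp_cons (hm := Category.id_comp _), CellPath.single_comp, unitMul_right,
      idCell_mcomp]
    exact h₁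

end VirtualEquipment
open VirtualEquipment

/-- The `E`-category `|A|`: its objects are the vertical arrows into `A`, with their domains as extents;
the hom from `a` to `b` is the restriction of the unit of `A` along `a` and `b` (the composite of the
companion of `a` and the conjoint of `b`); identities and composition are induced by those of the unit. -/
noncomputable def realization {E : Type u} [VirtualDoubleCategory.{w, p, v} E] [VirtualEquipment E] (A : E) :
    EnrichedCat.{max u v} E where
  obj := Σ X : E, (X ⟶ A)
  ext a := a.1
  hom a b := restr a.2 b.2 (unit A)
  ident a := lift (mcomp (unitCell A) (.nil a.2) (Category.comp_id a.2) (Category.comp_id a.2))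
    (Category.id_comp a.2) (Category.id_comp a.2)
  compos a b c := lift (mcomp (unitMul A)
      (.cons (restrCell a.2 b.2 (unit A)) (.single (restrCell b.2 c.2 (unit A))) rfl)
      (Category.comp_id a.2) (Category.comp_id c.2))
    (Category.id_comp a.2) (Category.id_comp c.2)
  ident_compos a b := by
    refine restr_ext (Category.id_comp _) (Category.id_comp _) ?_
    rw [show mcomp (restrCell a.2 b.2 (unit A)) (.single (idCell (restr a.2 b.2 (unit A))))
        (Category.id_comp _) (Category.id_comp _) = restrCell a.2 b.2 (unit A) from mcomp_id _,
      ← CellPath.single_comp (hf := Category.id_comp _) (hg := Category.id_comp _),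
      ← mcomp_assoc (hF' := Category.id_comp _) (hG' := Category.id_comp _)
        (h₁ := Category.id_comp _) (h₂ := Category.id_comp _), restrCell_lift,
      mcomp_assoc (hF := Category.id_comp _) (hG := Category.id_comp _)
        (h₃ := Category.comp_id _) (h₄ := Category.comp_id _),
      CellPath.cons_comp_cons (hm := Category.id_comp _), CellPath.single_comp_single,
      restrCell_lift, show mcomp (restrCell a.2 b.2 (unit A))
        (.single (idCell (restr a.2 b.2 (unit A))))
        (Category.id_comp _) (Category.id_comp _) = restrCell a.2 b.2 (unit A) from mcomp_id _]
    have h := congrArg (fun x => mcomp x (.single (restrCell a.2 b.2 (unit A)))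
      (Category.comp_id _) (Category.comp_id _)) (unitMul_left A)
    rw [mcomp_assoc (hF := Category.comp_id _) (hG := Category.comp_id _)
      (h₃ := Category.comp_id _) (h₄ := Category.comp_id _),
      comp_cons_of_eq (β := .nil a.2) (βs := .single (restrCell a.2 b.2 (unit A))) (h := rfl)
        (γ := .single (restrCell a.2 b.2 (unit A))) (hγ := HEq.rfl) (hm := Category.comp_id _),
      CellPath.single_comp_single, idCell_mcomp] at h
    exact h
  compos_ident a b := by
    refine restr_ext (Category.id_comp _) (Category.id_comp _) ?_
    rw [show mcomp (restrCell a.2 b.2 (unit A)) (.single (idCell (restr a.2 b.2 (unit A))))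
        (Category.id_comp _) (Category.id_comp _) = restrCell a.2 b.2 (unit A) from mcomp_id _,
      ← CellPath.single_comp (hf := Category.id_comp _) (hg := Category.id_comp _),
      ← mcomp_assoc (hF' := Category.id_comp _) (hG' := Category.id_comp _)
        (h₁ := Category.id_comp _) (h₂ := Category.id_comp _), restrCell_lift,
      mcomp_assoc (hF := Category.id_comp _) (hG := Category.id_comp _)
        (h₃ := Category.comp_id _) (h₄ := Category.comp_id _),
      CellPath.cons_comp_cons (hm := Category.id_comp _), CellPath.single_comp_single,
      restrCell_lift, show mcomp (restrCell a.2 b.2 (unit A))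
        (.single (idCell (restr a.2 b.2 (unit A))))
        (Category.id_comp _) (Category.id_comp _) = restrCell a.2 b.2 (unit A) from mcomp_id _]
    have h := congrArg (fun x => mcomp x (.single (restrCell a.2 b.2 (unit A)))
      (Category.comp_id _) (Category.comp_id _)) (unitMul_right A)
    rw [mcomp_assoc (hF := Category.comp_id _) (hG := Category.comp_id _)
      (h₃ := Category.comp_id _) (h₄ := Category.comp_id _),
      comp_cons_of_eq (β := .single (restrCell a.2 b.2 (unit A))) (βs := .nil b.2) (h := rfl)
        (γ := .single (restrCell a.2 b.2 (unit A))) (hγ := HEq.rfl) (hm := Category.comp_id _),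
      CellPath.single_comp, idCell_mcomp] at h
    exact h
  assoc a b c d := by
    refine restr_ext (Category.id_comp _) (Category.id_comp _) ?_
    have k : ∀ x y : Σ X : E, (X ⟶ A),
        mcomp (restrCell x.2 y.2 (unit A)) (.single (idCell (restr x.2 y.2 (unit A))))
          (Category.id_comp _) (Category.id_comp _) = restrCell x.2 y.2 (unit A) :=
      fun _ _ => mcomp_id _
    rw [← CellPath.single_comp (hf := Category.id_comp _) (hg := Category.id_comp _),
      ← CellPath.single_comp (hf := Category.id_comp _) (hg := Category.id_comp _),
      ← mcomp_assoc (hF' := Category.id_comp _) (hG' := Category.id_comp _)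
        (h₁ := Category.id_comp _) (h₂ := Category.id_comp _), restrCell_lift,
      ← mcomp_assoc (hF' := Category.id_comp _) (hG' := Category.id_comp _)
        (h₁ := Category.id_comp _) (h₂ := Category.id_comp _), restrCell_lift,
      mcomp_assoc (hF := Category.id_comp _) (hG := Category.id_comp _)
        (h₃ := Category.comp_id _) (h₄ := Category.comp_id _),
      mcomp_assoc (hF := Category.id_comp _) (hG := Category.id_comp _)
        (h₃ := Category.comp_id _) (h₄ := Category.comp_id _),
      CellPath.cons_comp_cons (hm := Category.id_comp _), CellPath.single_comp_single,
      CellPath.cons_comp_cons (hm := Category.id_comp _), CellPath.single_comp_single,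
      restrCell_lift, restrCell_lift, k, k]
    have h := congrArg (fun x => mcomp x (.cons (restrCell a.2 b.2 (unit A))
      (.cons (restrCell b.2 c.2 (unit A)) (.single (restrCell c.2 d.2 (unit A))) rfl) rfl)
      (Category.comp_id _) (Category.comp_id _)) (unitMul_assoc A)
    rw [mcomp_assoc (hF := Category.comp_id _) (hG := Category.comp_id _)
        (h₃ := Category.comp_id _) (h₄ := Category.comp_id _),
      mcomp_assoc (hF := Category.comp_id _) (hG := Category.comp_id _)
        (h₃ := Category.comp_id _) (h₄ := Category.comp_id _),
      comp_cons_of_eq (β := .cons (restrCell a.2 b.2 (unit A))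
          (.single (restrCell b.2 c.2 (unit A))) rfl)
        (βs := .single (restrCell c.2 d.2 (unit A))) (h := rfl)
        (γ := .cons (restrCell a.2 b.2 (unit A)) (.cons (restrCell b.2 c.2 (unit A))
          (.single (restrCell c.2 d.2 (unit A))) rfl) rfl) (hγ := HEq.rfl)
        (hm := Category.comp_id _),
      CellPath.single_comp_single, idCell_mcomp,
      CellPath.cons_comp_cons (hm := Category.comp_id _), CellPath.single_comp, idCell_mcomp] at h
    exact h
end VDC

/-!
The horizontal equivalence of `A` and `B` is obtained by evaluating everything at the identity
arrows: `J : |A| ⇸ |B|` has the value `J(1, 1) : A ⇸ B`, a cell of profunctors has its component at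
the tuple of identities, and it has to be shown that this component is a composite in `E` if the
cell is a composite of `E`-categories (`isComposite_of_map`).

Every profunctor `J : |A| ⇸ |B|` lies over `J(1, 1)`: there are cells `J(a, b) → J(1, 1)` over the
vertical arrows `a` and `b`, got from the actions of `|A|(1, a)` and `|B|(b, 1)`, which are
compatible with the actions (`Over.atOne`) and natural with respect to nullary and binary cells of
profunctors (`toOne_app_nil`, `toOne_app₂`). In the same way the profunctor `|H|` of restrictions of
a proarrow `H` lies over `H` (`Over.ofPro`).

Let `P₁, …, Pₖ` be profunctors lying over proarrows `H₁, …, Hₖ`. A cell `β : H₁, …, Hₖ → K` of `E`,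
composed with the cells `Pᵢ(aᵢ₋₁, aᵢ) → Hᵢ`, gives a family of cells `P₁(a₀, a₁), …, Pₖ(aₖ₋₁, aₖ) →
K`, and this family is a cell of profunctors into `K`, regarded as a profunctor between categories
with one object (`OverPath.extend`). For its equivariance, both sides factor through cells `H₁, …,
Hᵢ, U, Hᵢ₊₁, …, Hₖ → K` that restrict to `β` along the unit element of the unit `U`, and by the
universal property of `U` there is only one such cell. The value of the extension at the identities
gives `β` back (`OverPath.extend_app_pts`).

Now let `μ : P → L` be a composite of profunctors, and let `β : R, P(1, …, 1), S → K` be a test cell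
of `E`. It extends to a cell `|R|, P, |S| → K` of profunctors, which factors uniquely through `μ`.
The value of the factor at the identities is a factorization of `β` through `μ(1, …, 1)`. It is
unique because extension commutes with whiskering by `μ` (`extend_whisker`) and is injective.

Throughout, cells into a proarrow are treated as its generalized elements, and the actions of
profunctors and of units as operations on them (`act`), so that the laws of categories and
profunctors can be used at generalized elements.
-/

namespace VDC
open VDCStruct VirtualDoubleCategory VirtualEquipment

/-! ### Generalized elements of proarrows -/

section elements
variable {D : Type u} [VirtualDoubleCategory.{w, p, v} D]

/-- The composite `α(x, y)` of a globular binary cell `α : J, K → L` with two cells `x`, `y`.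
Reading cells into `J` as generalized elements of `J`, this is the value of the operation `α` at `x`
and `y`. The domain `P` of the result is the concatenation of those of `x` and `y`. -/
abbrev act {X Y Z : D} {J : Pro X Y} {K : Pro Y Z} {L : Pro X Z}
    (α : Cell (𝟙 X) (𝟙 Z) (.cons J (.single K)) L) {A M B : D} {f : A ⟶ X} {m : M ⟶ Y} {g : B ⟶ Z}
    {P₁ : Path D A M} {P₂ : Path D M B} {P : Path D A B} (x : Cell f m P₁ J) (y : Cell m g P₂ K)
    (h : P₁.append P₂ = P) : Cell f g P L :=
  mcomp α (.cons x (.single y) h) (Category.comp_id f) (Category.comp_id g)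

/-- The element of `J` at `f` given by a cell `u : () → J`. -/
abbrev elt {X : D} {J : Pro X X} (u : Cell (𝟙 X) (𝟙 X) (.nil X) J) {A : D} (f : A ⟶ X) :
    Cell f f (.nil A) J :=
  mcomp u (.nil f) (Category.comp_id f) (Category.comp_id f)

theorem elt_id {X : D} {J : Pro X X} (u : Cell (𝟙 X) (𝟙 X) (.nil X) J) : elt u (𝟙 X) = u :=
  mcomp_id u

theorem mcomp_single_idCell {A B A' B' : D} {f : A ⟶ A'} {g : B ⟶ B'} {J : Pro A B}
    {K : Pro A' B'} (c : Cell f g (.single J) K) :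
    mcomp c (.single (idCell J)) (Category.id_comp _) (Category.id_comp _) = c :=
  mcomp_id c

theorem mcomp_elt_nil {X : D} {J : Pro X X} (u : Cell (𝟙 X) (𝟙 X) (.nil X) J) {A B : D}
    {f : A ⟶ X} (g : B ⟶ A) {k : B ⟶ X} (h : g ≫ f = k) :
    mcomp (elt u f) (.nil g) h h = elt u k := by
  subst h
  rw [mcomp_assoc (hF := rfl) (hG := rfl) (h₃ := Category.comp_id _) (h₄ := Category.comp_id _),
    CellPath.comp_nil]

theorem mcomp_single_elt {X Y : D} {J : Pro X X} {K : Pro Y Y} {f : X ⟶ Y} {A : D} {a : A ⟶ X}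
    (v : Cell f f (.single J) K) (u : Cell (𝟙 X) (𝟙 X) (.nil X) J)
    (u' : Cell (𝟙 Y) (𝟙 Y) (.nil Y) K)
    (h : mcomp v (.single u) (Category.id_comp f) (Category.id_comp f) = elt u' f) {k : A ⟶ Y}
    (hk : a ≫ f = k) : mcomp v (.single (elt u a)) hk hk = elt u' k := by
  rw [← CellPath.single_comp (hf := Category.comp_id _) (hg := Category.comp_id _),
    ← mcomp_assoc (hF' := Category.id_comp _) (hG' := Category.id_comp _)
      (h₁ := hk) (h₂ := hk), h, mcomp_elt_nil]

theorem mcomp_single_mcomp {A B A' B' A'' B'' A₃ B₃ : D} {f : A ⟶ A'} {g : B ⟶ B'}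
    {f' : A' ⟶ A''} {g' : B' ⟶ B''} {f'' : A'' ⟶ A₃} {g'' : B'' ⟶ B₃}
    {F : A ⟶ A''} {G : B ⟶ B''} {F' : A' ⟶ A₃} {G' : B' ⟶ B₃} {F'' : A ⟶ A₃} {G'' : B ⟶ B₃}
    {P : Path D A B} {Q : Path D A' B'} {R : Pro A'' B''} {K : Pro A₃ B₃}
    (β : Cell f'' g'' (.single R) K) (α : Cell f' g' Q R) (γ : Cells f g P Q)
    (hF : f ≫ f' = F) (hG : g ≫ g' = G) (hF' : f' ≫ f'' = F') (hG' : g' ≫ g'' = G')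
    (h₁ : f ≫ F' = F'') (h₂ : g ≫ G' = G'') (h₃ : F ≫ f'' = F'') (h₄ : G ≫ g'' = G'') :
    mcomp β (.single (mcomp α γ hF hG)) h₃ h₄ = mcomp (mcomp β (.single α) hF' hG') γ h₁ h₂ := by
  rw [mcomp_assoc (hF := hF) (hG := hG) (h₃ := h₃) (h₄ := h₄), CellPath.single_comp]

section
variable {X Y Z W : D} {J : Pro X Y} {K : Pro Y Z} {L : Pro X Z}

theorem act_idCell (α : Cell (𝟙 X) (𝟙 Z) (.cons J (.single K)) L) :
    act α (idCell J) (idCell K) rfl = α := mcomp_id α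

/-- Composition with a list of cells distributes over the two arguments of an operation. -/
theorem act_mcomp (α : Cell (𝟙 X) (𝟙 Z) (.cons J (.single K)) L) {A M B A' M' B' : D}
    {f : A ⟶ X} {m : M ⟶ Y} {g : B ⟶ Z}
    {P₁ : Path D A M} {P₂ : Path D M B} {P : Path D A B} (x : Cell f m P₁ J) (y : Cell m g P₂ K)
    (h : P₁.append P₂ = P) {f' : A' ⟶ A} {m' : M' ⟶ M} {g' : B' ⟶ B} {R₁ : Path D A' M'}
    {R₂ : Path D M' B'} {R : Path D A' B'} (γ : Cells f' g' R P) (γ₁ : Cells f' m' R₁ P₁)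
    (γ₂ : Cells m' g' R₂ P₂)
    (k : R₁.append R₂ = R) (hγ : HEq γ (γ₁.append γ₂ k))
    {F : A' ⟶ X} {N : M' ⟶ Y} {G : B' ⟶ Z} (hf : f' ≫ f = F) (hm : m' ≫ m = N)
    (hg : g' ≫ g = G) :
    mcomp (act α x y h) γ hf hg = act α (mcomp x γ₁ hf hm) (mcomp y γ₂ hm hg) k := by
  rw [mcomp_assoc (hF := hf) (hG := hg) (h₃ := Category.comp_id _) (h₄ := Category.comp_id _),
    comp_cons_of_eq (hγ := hγ) (hm := hm), CellPath.single_comp]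

theorem act_act_idCell_right (α : Cell (𝟙 X) (𝟙 Z) (.cons J (.single K)) L) {J' : Pro X Y}
    (c : Cell (𝟙 X) (𝟙 Y) (.single J') J) {A M B : D} {f : A ⟶ X} {m : M ⟶ Y} {g : B ⟶ Z}
    {P₁ : Path D A M} {P₂ : Path D M B} {P : Path D A B} (x : Cell f m P₁ J') (y : Cell m g P₂ K)
    (h : P₁.append P₂ = P) :
    act (act α c (idCell K) rfl) x y h =
      act α (mcomp c (.single x) (Category.comp_id f) (Category.comp_id m)) y h :=
  (act_mcomp α c (idCell K) rfl (.cons x (.single y) h) (.single x) (.single y) h HEq.rfl _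
    (Category.comp_id m) _).trans (by rw [idCell_mcomp])

theorem act_act_idCell_left (α : Cell (𝟙 X) (𝟙 Z) (.cons J (.single K)) L) {K' : Pro Y Z}
    (c : Cell (𝟙 Y) (𝟙 Z) (.single K') K) {A M B : D} {f : A ⟶ X} {m : M ⟶ Y} {g : B ⟶ Z}
    {P₁ : Path D A M} {P₂ : Path D M B} {P : Path D A B} (x : Cell f m P₁ J) (y : Cell m g P₂ K')
    (h : P₁.append P₂ = P) :
    act (act α (idCell J) c rfl) x y h =
      act α x (mcomp c (.single y) (Category.comp_id m) (Category.comp_id g)) h :=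
  (act_mcomp α (idCell J) c rfl (.cons x (.single y) h) (.single x) (.single y) h HEq.rfl _
    (Category.comp_id m) _).trans (by rw [idCell_mcomp])

/-- An associative law between operations holds at all generalized elements. -/
theorem act_assoc {S : Pro X Z} {T : Pro Y W} {N : Pro Z W} {O : Pro X W}
    {α : Cell (𝟙 X) (𝟙 W) (.cons S (.single N)) O} {β : Cell (𝟙 X) (𝟙 Z) (.cons J (.single K)) S}
    {α' : Cell (𝟙 X) (𝟙 W) (.cons J (.single T)) O} {β' : Cell (𝟙 Y) (𝟙 W) (.cons K (.single N)) T}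
    (e : act α β (idCell N) rfl = act α' (idCell J) β' rfl)
    {A M M' B : D} {f : A ⟶ X} {m : M ⟶ Y} {m' : M' ⟶ Z} {g : B ⟶ W}
    {P₁ : Path D A M} {P₂ : Path D M M'} {P₃ : Path D M' B} {P₁₂ : Path D A M'} {P₂₃ : Path D M B}
    {P : Path D A B} (x : Cell f m P₁ J) (y : Cell m m' P₂ K) (z : Cell m' g P₃ N)
    (h₁ : P₁.append P₂ = P₁₂) (h₂ : P₁₂.append P₃ = P) (h₃ : P₂.append P₃ = P₂₃)
    (h₄ : P₁.append P₂₃ = P) :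
    act α (act β x y h₁) z h₂ = act α' x (act β' y z h₃) h₄ := by
  have e' := congrArg (fun c => mcomp c (.cons x (.cons y (.single z) h₃) h₄)
    (Category.comp_id f) (Category.comp_id g)) e
  subst h₃
  rw [act_mcomp α β (idCell N) rfl (.cons x (.cons y (.single z) rfl) h₄)
      (.cons x (.single y) h₁) (.single z) h₂ HEq.rfl _
      (Category.comp_id _) _,
    act_mcomp α' (idCell J) β' rfl (.cons x (.cons y (.single z) rfl) h₄)
      (.single x) (.cons y (.single z) rfl) h₄ HEq.rfl _
      (Category.comp_id _) _, idCell_mcomp, idCell_mcomp] at e'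
  exact e'

theorem act_elt_left {J : Pro X X} {K : Pro X Y} {α : Cell (𝟙 X) (𝟙 Y) (.cons J (.single K)) K}
    {u : Cell (𝟙 X) (𝟙 X) (.nil X) J} (e : act α u (idCell K) rfl = idCell K)
    {A B : D} {f : A ⟶ X} {g : B ⟶ Y} {P : Path D A B} (y : Cell f g P K)
    (h : (ProPath.nil A).append P = P) :
    act α (elt u f) y h = y := by
  have e' := congrArg (fun c => mcomp c (.single y) (Category.comp_id f) (Category.comp_id g)) e
  rw [act_mcomp α u (idCell K) rfl (.single y) (.nil f) (.single y) rfl HEq.rfl _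
      (Category.comp_id _) _,
    idCell_mcomp] at e'
  exact e'

theorem act_elt_right {K : Pro X Y} {J : Pro Y Y} {α : Cell (𝟙 X) (𝟙 Y) (.cons K (.single J)) K}
    {u : Cell (𝟙 Y) (𝟙 Y) (.nil Y) J} (e : act α (idCell K) u rfl = idCell K)
    {A B : D} {f : A ⟶ X} {g : B ⟶ Y} {P : Path D A B} (y : Cell f g P K)
    (h : P.append (.nil B) = P) :
    act α y (elt u g) h = y := by
  have e' := congrArg (fun c => mcomp c (.single y) (Category.comp_id f) (Category.comp_id g)) e
  rw [act_mcomp α (idCell K) u rfl _ (.single y) (.nil g) P.append_nil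
      (CellPath.append_nil _).symm _ (Category.comp_id _) _,
    idCell_mcomp] at e'
  exact e'

/-- A cell that is compatible with two operations is compatible with their values at all generalized
elements. -/
theorem mcomp_act {X' Y' Z' : D} {J' : Pro X' Y'} {K' : Pro Y' Z'} {L' : Pro X' Z'}
    {q : X ⟶ X'} {r : Y ⟶ Y'} {s : Z ⟶ Z'} {c : Cell q s (.single L) L'}
    {c₁ : Cell q r (.single J) J'} {c₂ : Cell r s (.single K) K'}
    {α : Cell (𝟙 X) (𝟙 Z) (.cons J (.single K)) L}
    {α' : Cell (𝟙 X') (𝟙 Z') (.cons J' (.single K')) L'}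
    (e : mcomp c (.single α) (Category.id_comp _) (Category.id_comp _) = act α' c₁ c₂ rfl)
    {A M B : D} {f : A ⟶ X} {m : M ⟶ Y} {g : B ⟶ Z}
    {P₁ : Path D A M} {P₂ : Path D M B} {P : Path D A B} (x : Cell f m P₁ J) (y : Cell m g P₂ K)
    (h : P₁.append P₂ = P) {F : A ⟶ X'} {N : M ⟶ Y'} {G : B ⟶ Z'} (hf : f ≫ q = F)
    (hm : m ≫ r = N) (hg : g ≫ s = G) :
    mcomp c (.single (act α x y h)) hf hg =
      act α' (mcomp c₁ (.single x) hf hm) (mcomp c₂ (.single y) hm hg) h := by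
  rw [mcomp_single_mcomp (hF' := Category.id_comp _) (hG' := Category.id_comp _) (h₁ := hf)
    (h₂ := hg), e]
  exact act_mcomp α' c₁ c₂ rfl _ (.single x) (.single y) h HEq.rfl hf hm hg

end

/-- If the right multiples of one nullary cell agree with the left multiples of another, then so
they do at all generalized elements. -/
theorem act_elt_comm {X Y : D} {J : Pro X Y} {K : Pro Y Y} {K' : Pro X X} {L : Pro X Y}
    {α : Cell (𝟙 X) (𝟙 Y) (.cons J (.single K)) L} {β : Cell (𝟙 X) (𝟙 Y) (.cons K' (.single J)) L}
    {u : Cell (𝟙 Y) (𝟙 Y) (.nil Y) K} {u' : Cell (𝟙 X) (𝟙 X) (.nil X) K'}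
    (e : act α (idCell J) u rfl = act β u' (idCell J) rfl) {A B : D} {f : A ⟶ X} {g : B ⟶ Y}
    {P : Path D A B} (x : Cell f g P J) (h : P.append (.nil B) = P)
    (h' : (ProPath.nil A).append P = P) :
    act α x (elt u g) h = act β (elt u' f) x h' := by
  have e' := congrArg (fun c => mcomp c (.single x) (Category.comp_id f) (Category.comp_id g)) e
  rw [act_mcomp α (idCell J) u rfl (.single x) (.single x) (.nil g) P.append_nil
      (CellPath.append_nil _).symm _ (Category.comp_id _) _,
    act_mcomp β u' (idCell J) rfl (.single x) (.nil f) (.single x) rfl HEq.rfl _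
      (Category.comp_id _) _, idCell_mcomp] at e'
  exact e'

end elements

/-! ### Actions of units -/

section units
variable {E : Type u} [VirtualDoubleCategory.{w, p, v} E] [VirtualEquipment E]

/-- Cells with a unit in their domain are determined by their composites with the unit element. -/
theorem unit_ext {A Z W Y₀ Y₁ : E} {f : Z ⟶ Y₀} {g : W ⟶ Y₁} (R : Path E Z A) (S : Path E A W)
    {K : Pro Y₀ Y₁} {x y : Cell f g (R.append (.cons (unit A) S)) K}
    (h : mcomp x (whisker R (unitCell A) S) (Category.id_comp f) (Category.id_comp g) =
      mcomp y (whisker R (unitCell A) S) (Category.id_comp f) (Category.id_comp g)) : x = y :=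
  (unitCell_isComposite A f g R S K _).unique h rfl

theorem exists_lunit {A B : E} (K : Pro A B) :
    ∃ l : Cell (𝟙 A) (𝟙 B) (.cons (unit A) (.single K)) K,
      act l (unitCell A) (idCell K) rfl = idCell K :=
  (unitCell_isComposite A (𝟙 A) (𝟙 B) (.nil A) (.single K) K (idCell K)).exists

/-- The action of the unit of `A` on a proarrow out of `A`. -/
noncomputable def lunit {A B : E} (K : Pro A B) :
    Cell (𝟙 A) (𝟙 B) (.cons (unit A) (.single K)) K :=
  (exists_lunit K).choose

theorem lunit_unitCell {A B : E} (K : Pro A B) :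
    act (lunit K) (unitCell A) (idCell K) rfl = idCell K :=
  (exists_lunit K).choose_spec

theorem exists_runit {A B : E} (K : Pro A B) :
    ∃ r : Cell (𝟙 A) (𝟙 B) (.cons K (.single (unit B))) K,
      act r (idCell K) (unitCell B) rfl = idCell K :=
  (unitCell_isComposite B (𝟙 A) (𝟙 B) (.single K) (.nil B) K (idCell K)).exists

/-- The action of the unit of `B` on a proarrow into `B`. -/
noncomputable def runit {A B : E} (K : Pro A B) :
    Cell (𝟙 A) (𝟙 B) (.cons K (.single (unit B))) K :=
  (exists_runit K).choose

theorem runit_unitCell {A B : E} (K : Pro A B) :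
    act (runit K) (idCell K) (unitCell B) rfl = idCell K :=
  (exists_runit K).choose_spec

theorem act_lunit_elt {A B X Y : E} (K : Pro A B) {f : X ⟶ A} {g : Y ⟶ B} {P : Path E X Y}
    (y : Cell f g P K) (h : (ProPath.nil X).append P = P) :
    act (lunit K) (elt (unitCell A) f) y h = y :=
  act_elt_left (lunit_unitCell K) y h

theorem act_runit_elt {A B X Y : E} (K : Pro A B) {f : X ⟶ A} {g : Y ⟶ B} {P : Path E X Y}
    (y : Cell f g P K) (h : P.append (.nil Y) = P) :
    act (runit K) y (elt (unitCell B) g) h = y :=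
  act_elt_right (runit_unitCell K) y h

theorem act_lunit_unitCell {A B Y : E} (K : Pro A B) {g : Y ⟶ B} {P : Path E A Y}
    (y : Cell (𝟙 A) g P K) (h : (ProPath.nil A).append P = P) :
    act (lunit K) (unitCell A) y h = y := by
  rw [← elt_id (unitCell A), act_lunit_elt]

theorem act_runit_unitCell {A B X : E} (K : Pro A B) {f : X ⟶ A} {P : Path E X B}
    (y : Cell f (𝟙 B) P K) (h : P.append (.nil B) = P) :
    act (runit K) y (unitCell B) h = y := by
  rw [← elt_id (unitCell B), act_runit_elt]

theorem act_unitMul_elt_left {A X Y : E} {f : X ⟶ A} {g : Y ⟶ A} {P : Path E X Y}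
    (y : Cell f g P (unit A)) (h : (ProPath.nil X).append P = P) :
    act (unitMul A) (elt (unitCell A) f) y h = y :=
  act_elt_left (unitMul_left A) y h

theorem act_unitMul_elt_right {A X Y : E} {f : X ⟶ A} {g : Y ⟶ A} {P : Path E X Y}
    (y : Cell f g P (unit A)) (h : P.append (.nil Y) = P) :
    act (unitMul A) y (elt (unitCell A) g) h = y :=
  act_elt_right (unitMul_right A) y h

/-- An operation on the unit that fixes the second argument when the first is the unit element is
the action of the unit. -/
theorem eq_lunit {A B : E} {K : Pro A B} {l : Cell (𝟙 A) (𝟙 B) (.cons (unit A) (.single K)) K}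
    (h : act l (unitCell A) (idCell K) rfl = idCell K) : l = lunit K :=
  unit_ext (.nil A) (.single K) (h.trans (lunit_unitCell K).symm)

theorem eq_runit {A B : E} {K : Pro A B} {r : Cell (𝟙 A) (𝟙 B) (.cons K (.single (unit B))) K}
    (h : act r (idCell K) (unitCell B) rfl = idCell K) : r = runit K :=
  unit_ext (.single K) (.nil B) (h.trans (runit_unitCell K).symm)

theorem lunit_assoc {A B : E} (K : Pro A B) :
    act (lunit K) (unitMul A) (idCell K) rfl = act (lunit K) (idCell (unit A)) (lunit K) rfl := by
  refine unit_ext (.nil A) (.cons (unit A) (.single K)) ?_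
  change mcomp _ (.cons (unitCell A) (.cons (idCell (unit A)) (.single (idCell K)) rfl) rfl) _ _ =
    mcomp _ (.cons (unitCell A) (.cons (idCell (unit A)) (.single (idCell K)) rfl) rfl) _ _
  rw [act_mcomp _ _ _ rfl
      (.cons (unitCell A) (.cons (idCell (unit A)) (.single (idCell K)) rfl) rfl)
      (.cons (unitCell A) (.single (idCell (unit A))) rfl) (.single (idCell K)) rfl
      HEq.rfl _ (Category.id_comp _) _,
    act_mcomp _ _ _ rfl
      (.cons (unitCell A) (.cons (idCell (unit A)) (.single (idCell K)) rfl) rfl)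
      (.single (unitCell A)) (.cons (idCell (unit A)) (.single (idCell K)) rfl) rfl
      HEq.rfl _ (Category.id_comp _) _, idCell_mcomp, idCell_mcomp, unitMul_left]
  exact (act_idCell _).trans ((act_lunit_unitCell K _ rfl).trans (act_idCell _)).symm

theorem runit_assoc {A B : E} (K : Pro A B) :
    act (runit K) (runit K) (idCell (unit B)) rfl =
      act (runit K) (idCell K) (unitMul B) rfl := by
  refine unit_ext (.cons K (.single (unit B))) (.nil B) ?_
  change mcomp _ (.cons (idCell K) (.cons (idCell (unit B)) (.single (unitCell B)) rfl) rfl) _ _ =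
    mcomp _ (.cons (idCell K) (.cons (idCell (unit B)) (.single (unitCell B)) rfl) rfl) _ _
  rw [act_mcomp _ _ _ rfl
      (.cons (idCell K) (.cons (idCell (unit B)) (.single (unitCell B)) rfl) rfl)
      (.cons (idCell K) (.single (idCell (unit B))) rfl) (.single (unitCell B)) rfl
      HEq.rfl _ (Category.id_comp _) _,
    act_mcomp _ _ _ rfl
      (.cons (idCell K) (.cons (idCell (unit B)) (.single (unitCell B)) rfl) rfl)
      (.single (idCell K)) (.cons (idCell (unit B)) (.single (unitCell B)) rfl) rfl
      HEq.rfl _ (Category.id_comp _) _, idCell_mcomp, idCell_mcomp, unitMul_right]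
  exact ((act_runit_unitCell K _ rfl).trans (act_idCell _)).trans (act_idCell _).symm

theorem lunit_runit {A B : E} (K : Pro A B) :
    act (runit K) (lunit K) (idCell (unit B)) rfl =
      act (lunit K) (idCell (unit A)) (runit K) rfl := by
  refine unit_ext (.nil A) (.cons K (.single (unit B))) ?_
  change mcomp _ (.cons (unitCell A) (.cons (idCell K) (.single (idCell (unit B))) rfl) rfl) _ _ =
    mcomp _ (.cons (unitCell A) (.cons (idCell K) (.single (idCell (unit B))) rfl) rfl) _ _
  rw [act_mcomp _ _ _ rfl
      (.cons (unitCell A) (.cons (idCell K) (.single (idCell (unit B))) rfl) rfl)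
      (.cons (unitCell A) (.single (idCell K)) rfl) (.single (idCell (unit B))) rfl
      HEq.rfl _ (Category.id_comp _) _,
    act_mcomp _ _ _ rfl
      (.cons (unitCell A) (.cons (idCell K) (.single (idCell (unit B))) rfl) rfl)
      (.single (unitCell A)) (.cons (idCell K) (.single (idCell (unit B))) rfl) rfl
      HEq.rfl _ (Category.id_comp _) _, idCell_mcomp, idCell_mcomp]
  refine (congrArg (fun x => act (runit K) x _ rfl) (lunit_unitCell K)).trans ?_
  exact (act_idCell _).trans ((act_lunit_unitCell K _ rfl).trans (act_idCell _)).symm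

theorem exists_unitMap {A B : E} (f : A ⟶ B) :
    ∃ c : Cell f f (.single (unit A)) (unit B),
      mcomp c (.single (unitCell A)) (Category.id_comp f) (Category.id_comp f) =
        elt (unitCell B) f :=
  (unitCell_isComposite A f f (.nil A) (.nil A) (unit B) (elt (unitCell B) f)).exists

/-- The cell between units induced by a vertical arrow. -/
noncomputable def unitMap {A B : E} (f : A ⟶ B) : Cell f f (.single (unit A)) (unit B) :=
  (exists_unitMap f).choose

theorem unitMap_unitCell {A B : E} (f : A ⟶ B) :
    mcomp (unitMap f) (.single (unitCell A)) (Category.id_comp f) (Category.id_comp f) =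
      elt (unitCell B) f :=
  (exists_unitMap f).choose_spec

theorem unitMap_unitMul {A B : E} (f : A ⟶ B) :
    mcomp (unitMap f) (.single (unitMul A)) (Category.id_comp f) (Category.id_comp f) =
      act (unitMul B) (unitMap f) (unitMap f) rfl := by
  refine unit_ext (.nil A) (.single (unit A)) ?_
  change mcomp _ (.cons (unitCell A) (.single (idCell (unit A))) rfl) _ _ =
    mcomp _ (.cons (unitCell A) (.single (idCell (unit A))) rfl) _ _
  rw [← mcomp_single_mcomp (hF := Category.id_comp _) (hG := Category.id_comp _)
      (h₃ := Category.id_comp _) (h₄ := Category.id_comp _), unitMul_left,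
    act_mcomp (unitMul B) (unitMap f) (unitMap f) rfl
      (.cons (unitCell A) (.single (idCell (unit A))) rfl) (.single (unitCell A))
      (.single (idCell (unit A))) rfl HEq.rfl _ (Category.id_comp _) _, unitMap_unitCell,
    act_unitMul_elt_left]

end units

/-! ### The `E`-category with one object -/

section point
variable {E : Type u} [VirtualDoubleCategory.{w, p, v} E] [VirtualEquipment E]

/-- The `E`-category with one object of extent `A`, whose hom is the unit of `A`. -/
@[reducible] noncomputable def point (A : E) : EnrichedCat.{t} E where
  obj := PUnit
  ext _ := A
  hom _ _ := unit A
  ident _ := unitCell A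
  compos _ _ _ := unitMul A
  ident_compos _ _ := unitMul_left A
  compos_ident _ _ := unitMul_right A
  assoc _ _ _ _ := unitMul_assoc A

/-- A proarrow as a profunctor between categories with one object. -/
@[reducible] noncomputable def pointPro {A B : E} (K : Pro A B) :
    Profunctor (point.{t} A) (point.{t} B) where
  pro _ _ := K
  lact _ _ _ := lunit K
  ract _ _ _ := runit K
  ident_lact _ _ := lunit_unitCell K
  ract_ident _ _ := runit_unitCell K
  compos_lact _ _ _ _ := lunit_assoc K
  ract_compos _ _ _ _ := runit_assoc K
  lact_ract _ _ _ _ := lunit_runit K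

end point

/-! ### The realization of an object -/

section realization
variable {E : Type u} [VirtualDoubleCategory.{w, p, v} E] [VirtualEquipment E]

namespace realization

/-- The vertical arrow that an object of `|A|` is. -/
abbrev arrow {A : E} (a : (realization A).obj) : (realization A).ext a ⟶ A := Sigma.snd a

/-- The identity of `A` as an object of `|A|`. -/
abbrev one (A : E) : (realization A).obj := ⟨A, 𝟙 A⟩

/-- The cartesian cell from a hom of `|A|` to the unit of `A`. -/
noncomputable abbrev toUnit {A : E} (a b : (realization A).obj) :
    Cell (arrow a) (arrow b) (.single ((realization A).hom a b)) (unit A) :=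
  restrCell (arrow a) (arrow b) (unit A)

theorem toUnit_ident {A : E} (a : (realization A).obj) :
    mcomp (toUnit a a) (.single ((realization A).ident a)) (Category.id_comp _)
      (Category.id_comp _) = elt (unitCell A) (arrow a) :=
  restrCell_lift _ _ _

theorem toUnit_compos {A : E} (a b c : (realization A).obj) :
    mcomp (toUnit a c) (.single ((realization A).compos a b c)) (Category.id_comp _)
      (Category.id_comp _) = act (unitMul A) (toUnit a b) (toUnit b c) rfl :=
  restrCell_lift _ _ _

theorem hom_ext {A X Y : E} {a b : (realization A).obj} {f : X ⟶ (realization A).ext a}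
    {g : Y ⟶ (realization A).ext b} {P : Path E X Y} {x y : Cell f g P ((realization A).hom a b)}
    {F : X ⟶ A} {G : Y ⟶ A} (hF : f ≫ arrow a = F) (hG : g ≫ arrow b = G)
    (h : mcomp (toUnit a b) (.single x) hF hG = mcomp (toUnit a b) (.single y) hF hG) : x = y :=
  restr_ext hF hG h

theorem toUnit_act {A : E} {a b c : (realization A).obj} {X Y Z : E}
    {f : X ⟶ (realization A).ext a} {m : Y ⟶ (realization A).ext b}
    {g : Z ⟶ (realization A).ext c} {P₁ : Path E X Y} {P₂ : Path E Y Z} {P : Path E X Z}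
    (x : Cell f m P₁ ((realization A).hom a b)) (y : Cell m g P₂ ((realization A).hom b c))
    (h : P₁.append P₂ = P) {F : X ⟶ A} {N : Y ⟶ A} {G : Z ⟶ A}
    (hf : f ≫ arrow a = F) (hm : m ≫ arrow b = N) (hg : g ≫ arrow c = G) :
    mcomp (toUnit a c) (.single (act ((realization A).compos a b c) x y h)) hf hg =
      act (unitMul A) (mcomp (toUnit a b) (.single x) hf hm)
        (mcomp (toUnit b c) (.single y) hm hg) h :=
  mcomp_act (toUnit_compos a b c) x y h hf hm hg

/-- The functor `|A| → I_Y`, where `I_Y` is the category with one object of extent `Y`, given by a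
vertical arrow `f : A → Y`. Its vertical arrow at an object `a` is `a ≫ f`. -/
@[reducible] noncomputable def toPoint {A Y : E} (f : A ⟶ Y) :
    realization A ⟶ point.{max u v} Y :=
  EnrichedFunctor.mk (C := realization A) (D := point Y) (fun _ => PUnit.unit)
    (fun a => arrow a ≫ f)
    (fun a b => mcomp (unitMap f) (.single (toUnit a b)) rfl rfl)
    (fun a => by
      rw [← mcomp_single_mcomp (hF := Category.id_comp _) (hG := Category.id_comp _)
        (h₃ := rfl) (h₄ := rfl), toUnit_ident,
        mcomp_single_elt _ _ _ (unitMap_unitCell f) rfl])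
    (fun a b c => by
      rw [← mcomp_single_mcomp (hF := Category.id_comp _) (hG := Category.id_comp _)
        (h₃ := rfl) (h₄ := rfl), toUnit_compos,
        mcomp_act (unitMap_unitMul f) _ _ rfl rfl rfl rfl])

end realization
end realization

/-! ### The realization of a proarrow -/

namespace realization
variable {E : Type u} [VirtualDoubleCategory.{w, p, v} E] [VirtualEquipment E]

section
variable {A B : E} (H : Pro A B)

/-- The left action of `|A|` on the restrictions of `H`, induced by the action of the unit of `A`.
-/
noncomputable abbrev lactRestr (a a' : (realization A).obj) (b : (realization B).obj) :
    Cell (𝟙 ((realization A).ext a)) (𝟙 ((realization B).ext b))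
      (.cons ((realization A).hom a a') (.single (restr (arrow a') (arrow b) H)))
      (restr (arrow a) (arrow b) H) :=
  lift (act (lunit H) (toUnit a a') (restrCell (arrow a') (arrow b) H) rfl)
    (Category.id_comp (arrow a)) (Category.id_comp (arrow b))

/-- The right action of `|B|` on the restrictions of `H`, induced by the action of the unit of `B`.
-/
noncomputable abbrev ractRestr (a : (realization A).obj) (b b' : (realization B).obj) :
    Cell (𝟙 ((realization A).ext a)) (𝟙 ((realization B).ext b'))
      (.cons (restr (arrow a) (arrow b) H) (.single ((realization B).hom b b')))
      (restr (arrow a) (arrow b') H) :=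
  lift (act (runit H) (restrCell (arrow a) (arrow b) H) (toUnit b b') rfl)
    (Category.id_comp (arrow a)) (Category.id_comp (arrow b'))

theorem restrCell_lactRestr (a a' : (realization A).obj) (b : (realization B).obj) :
    mcomp (restrCell (arrow a) (arrow b) H) (.single (lactRestr H a a' b)) (Category.id_comp _)
      (Category.id_comp _) =
      act (lunit H) (toUnit a a') (restrCell (arrow a') (arrow b) H) rfl :=
  restrCell_lift _ _ _

theorem restrCell_ractRestr (a : (realization A).obj) (b b' : (realization B).obj) :
    mcomp (restrCell (arrow a) (arrow b') H) (.single (ractRestr H a b b')) (Category.id_comp _)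
      (Category.id_comp _) =
      act (runit H) (restrCell (arrow a) (arrow b) H) (toUnit b b') rfl :=
  restrCell_lift _ _ _

/-- The profunctor `|A| ⇸ |B|` given by a proarrow `H : A ⇸ B`: its value at `a` and `b` is the
restriction of `H` along `a` and `b`. -/
noncomputable def ofPro : Profunctor (realization A) (realization B) where
  pro a b := restr (arrow a) (arrow b) H
  lact a a' b := lactRestr H a a' b
  ract a b b' := ractRestr H a b b'
  ident_lact a b := by
    refine restr_ext (Category.id_comp _) (Category.id_comp _) ?_
    refine (mcomp_act (restrCell_lactRestr H a a b) _ _ rfl (Category.id_comp _)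
      (Category.id_comp _) (Category.id_comp _)).trans ?_
    rw [toUnit_ident, mcomp_single_idCell, act_lunit_elt]
  ract_ident a b := by
    refine restr_ext (Category.id_comp _) (Category.id_comp _) ?_
    refine (mcomp_act (restrCell_ractRestr H a b b) _ _ rfl (Category.id_comp _)
      (Category.id_comp _) (Category.id_comp _)).trans ?_
    rw [toUnit_ident, mcomp_single_idCell, act_runit_elt]
  compos_lact a b c d := by
    refine restr_ext (Category.id_comp _) (Category.id_comp _) ?_
    refine (mcomp_act (restrCell_lactRestr H a c d) _ _ rfl (Category.id_comp _)
      (Category.id_comp _) (Category.id_comp _)).trans (Eq.trans ?_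
      (mcomp_act (restrCell_lactRestr H a b d) (idCell _) (lactRestr H b c d) rfl
      (Category.id_comp _) (Category.id_comp _) (Category.id_comp _)).symm)
    rw [toUnit_compos, mcomp_single_idCell, mcomp_single_idCell, restrCell_lactRestr]
    exact act_assoc (lunit_assoc H) _ _ _ rfl rfl rfl rfl
  ract_compos a b c d := by
    refine restr_ext (Category.id_comp _) (Category.id_comp _) ?_
    refine (mcomp_act (restrCell_ractRestr H a c d) _ _ rfl (Category.id_comp _)
      (Category.id_comp _) (Category.id_comp _)).trans (Eq.trans ?_
      (mcomp_act (restrCell_ractRestr H a b d) (idCell _) ((realization B).compos b c d) rfl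
      (Category.id_comp _) (Category.id_comp _) (Category.id_comp _)).symm)
    rw [toUnit_compos, mcomp_single_idCell, mcomp_single_idCell, restrCell_ractRestr]
    exact act_assoc (runit_assoc H) _ _ _ rfl rfl rfl rfl
  lact_ract a b c d := by
    refine restr_ext (Category.id_comp _) (Category.id_comp _) ?_
    refine (mcomp_act (restrCell_ractRestr H a c d) _ _ rfl (Category.id_comp _)
      (Category.id_comp _) (Category.id_comp _)).trans (Eq.trans ?_
      (mcomp_act (restrCell_lactRestr H a b d) (idCell _) (ractRestr H b c d) rfl
      (Category.id_comp _) (Category.id_comp _) (Category.id_comp _)).symm)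
    rw [mcomp_single_idCell, mcomp_single_idCell, restrCell_lactRestr, restrCell_ractRestr]
    exact act_assoc (lunit_runit H) _ _ _ rfl rfl rfl rfl

end
end realization

/-! ### Profunctors between realizations and their values at identities -/

namespace realization
variable {E : Type u} [VirtualDoubleCategory.{w, p, v} E] [VirtualEquipment E]

/-- The element of `|A|(1, a)` at `a` that comes from the unit of `A`. -/
noncomputable def inOne {A : E} (a : (realization A).obj) :
    Cell (arrow a) (𝟙 ((realization A).ext a)) (.nil _) ((realization A).hom (one A) a) :=
  lift (elt (unitCell A) (arrow a)) (Category.comp_id _) (Category.id_comp _)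

/-- The element of `|A|(a, 1)` at `a` that comes from the unit of `A`. -/
noncomputable def outOne {A : E} (a : (realization A).obj) :
    Cell (𝟙 ((realization A).ext a)) (arrow a) (.nil _) ((realization A).hom a (one A)) :=
  lift (elt (unitCell A) (arrow a)) (Category.id_comp _) (Category.comp_id _)

/-- The cell `|A|(a, b) → |A|(1, 1)` over `a` and `b`. -/
noncomputable def loop {A : E} (a b : (realization A).obj) :
    Cell (arrow a) (arrow b) (.single ((realization A).hom a b))
      ((realization A).hom (one A) (one A)) :=
  lift (toUnit a b) (Category.comp_id _) (Category.comp_id _)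

/-- The canonical cell from the unit of `A` to `|A|(1, 1)`. -/
noncomputable def ofUnit (A : E) :
    Cell (𝟙 A) (𝟙 A) (.single (unit A)) ((realization A).hom (one A) (one A)) :=
  lift (idCell (unit A)) (Category.comp_id _) (Category.comp_id _)

theorem toUnit_inOne {A : E} (a : (realization A).obj) :
    mcomp (toUnit (one A) a) (.single (inOne a)) (Category.comp_id _) (Category.id_comp _) =
      elt (unitCell A) (arrow a) :=
  restrCell_lift _ _ _

theorem toUnit_outOne {A : E} (a : (realization A).obj) :
    mcomp (toUnit a (one A)) (.single (outOne a)) (Category.id_comp _) (Category.comp_id _) =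
      elt (unitCell A) (arrow a) :=
  restrCell_lift _ _ _

theorem toUnit_loop {A : E} (a b : (realization A).obj) :
    mcomp (toUnit (one A) (one A)) (.single (loop a b)) (Category.comp_id _)
      (Category.comp_id _) = toUnit a b :=
  restrCell_lift _ _ _

theorem toUnit_ofUnit (A : E) :
    mcomp (toUnit (one A) (one A)) (.single (ofUnit A)) (Category.comp_id _)
      (Category.comp_id _) = idCell (unit A) :=
  restrCell_lift _ _ _

theorem ofUnit_unitCell (A : E) :
    mcomp (ofUnit A) (.single (unitCell A)) (Category.id_comp _) (Category.id_comp _) =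
      (realization A).ident (one A) := by
  refine hom_ext (a := one A) (b := one A) (Category.comp_id _) (Category.comp_id _) ?_
  refine (mcomp_single_mcomp (hF' := Category.comp_id _) (hG' := Category.comp_id _)
    (h₁ := Category.id_comp _) (h₂ := Category.id_comp _) ..).trans ?_
  refine (congrArg (fun z => mcomp z (.single (unitCell A)) (Category.id_comp _)
    (Category.id_comp _)) (toUnit_ofUnit A)).trans ?_
  exact (idCell_mcomp _).trans ((elt_id (unitCell A)).symm.trans (toUnit_ident (one A)).symm)

theorem ofUnit_toUnit {A : E} (a b : (realization A).obj) :
    mcomp (ofUnit A) (.single (toUnit a b)) (Category.comp_id _) (Category.comp_id _) =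
      loop a b := by
  refine hom_ext (a := one A) (b := one A) (Category.comp_id _) (Category.comp_id _) ?_
  refine (mcomp_single_mcomp (hF' := Category.comp_id _) (hG' := Category.comp_id _)
    (h₁ := Category.comp_id _) (h₂ := Category.comp_id _) ..).trans ?_
  refine (congrArg (fun z => mcomp z (.single (toUnit a b)) (Category.comp_id _)
    (Category.comp_id _)) (toUnit_ofUnit A)).trans ?_
  exact (idCell_mcomp _).trans (toUnit_loop a b).symm

theorem inOne_one (A : E) : inOne (one A) = (realization A).ident (one A) :=
  hom_ext (a := one A) (b := one A) (Category.comp_id _) (Category.comp_id _)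
    ((toUnit_inOne (one A)).trans (toUnit_ident (one A)).symm)

theorem outOne_one (A : E) : outOne (one A) = (realization A).ident (one A) :=
  hom_ext (a := one A) (b := one A) (Category.comp_id _) (Category.comp_id _)
    ((toUnit_outOne (one A)).trans (toUnit_ident (one A)).symm)

/-- The elements of `|A|(1, a)` at `a` form a natural family in `a`. -/
theorem compos_inOne {A : E} (a b : (realization A).obj) :
    act ((realization A).compos (one A) a b) (inOne a) (idCell ((realization A).hom a b)) rfl =
      act ((realization A).compos (one A) (one A) b) (loop a b) (inOne b) rfl := by
  refine hom_ext (a := one A) (b := b) (Category.comp_id _) (Category.id_comp _) ?_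
  refine (toUnit_act (a := one A) (b := a) (c := b) (inOne a) (idCell _) rfl (Category.comp_id _)
    (Category.id_comp _) (Category.id_comp _)).trans ?_
  refine Eq.trans ?_ (toUnit_act (a := one A) (b := one A) (c := b) (loop a b) (inOne b) rfl
    (Category.comp_id _) (Category.comp_id _) (Category.id_comp _)).symm
  rw [toUnit_inOne, toUnit_inOne, toUnit_loop]
  exact (act_unitMul_elt_left _ _).trans ((mcomp_single_idCell _).trans
    (act_unitMul_elt_right (toUnit a b) rfl).symm)

/-- The elements of `|A|(a, 1)` at `a` form a natural family in `a`. -/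
theorem compos_outOne {A : E} (a b : (realization A).obj) :
    act ((realization A).compos a b (one A)) (idCell ((realization A).hom a b)) (outOne b) rfl =
      act ((realization A).compos a (one A) (one A)) (outOne a) (loop a b) rfl := by
  refine hom_ext (a := a) (b := one A) (Category.id_comp _) (Category.comp_id _) ?_
  refine (toUnit_act (a := a) (b := b) (c := one A) (idCell _) (outOne b) rfl
    (Category.id_comp _) (Category.id_comp _) (Category.comp_id _)).trans ?_
  refine Eq.trans ?_ (toUnit_act (a := a) (b := one A) (c := one A) (outOne a) (loop a b) rfl
    (Category.id_comp _) (Category.comp_id _) (Category.comp_id _)).symm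
  rw [toUnit_outOne, toUnit_outOne, toUnit_loop]
  refine Eq.trans ?_ (act_unitMul_elt_left (toUnit a b) rfl).symm
  rw [mcomp_single_idCell]
  exact act_unitMul_elt_right (toUnit a b) rfl

/-- The two elements compose to the identity element of `|A|(1, 1)` at `a`. -/
theorem compos_inOne_outOne {A : E} (a : (realization A).obj) :
    act ((realization A).compos (one A) a (one A)) (inOne a) (outOne a) rfl =
      elt ((realization A).ident (one A)) (arrow a) := by
  refine hom_ext (a := one A) (b := one A) (Category.comp_id _) (Category.comp_id _) ?_
  refine (toUnit_act (a := one A) (b := a) (c := one A) (inOne a) (outOne a) rfl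
    (Category.comp_id _) (Category.id_comp _) (Category.comp_id _)).trans ?_
  refine Eq.trans ?_ (mcomp_single_elt (toUnit (one A) (one A)) _ _ (toUnit_ident (one A))
    (Category.comp_id (arrow a))).symm
  rw [toUnit_outOne, toUnit_inOne]
  exact act_unitMul_elt_left _ rfl

/-- Composed in the other order, the two elements give the identity of the object `a`. -/
theorem compos_outOne_inOne {A : E} (a : (realization A).obj) :
    act ((realization A).compos a (one A) a) (outOne a) (inOne a) rfl =
      (realization A).ident a := by
  refine hom_ext (Category.id_comp _) (Category.id_comp _) ?_
  refine (toUnit_act (a := a) (b := one A) (c := a) (outOne a) (inOne a) rfl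
    (Category.id_comp _) (Category.comp_id _) (Category.id_comp _)).trans ?_
  refine Eq.trans ?_ (toUnit_ident a).symm
  rw [toUnit_outOne, toUnit_inOne]
  exact act_unitMul_elt_left _ rfl

/-- A profunctor `J : |A| ⇸ |B|` lying over a proarrow `H : A ⇸ B`: cells `J(a, b) → H` over `a` and
`b`, compatible with the actions, of which the one at the identities has a section. -/
structure Over {A B : E} (J : Profunctor (realization A) (realization B)) (H : Pro A B) where
  cell : ∀ (a : (realization A).obj) (b : (realization B).obj),
    Cell (arrow a) (arrow b) (.single (J.pro a b)) H
  sec : Cell (𝟙 A) (𝟙 B) (.single H) (J.pro (one A) (one B))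
  cell_lact : ∀ (a a' : (realization A).obj) (b : (realization B).obj),
    mcomp (cell a b) (.single (J.lact a a' b)) (Category.id_comp _) (Category.id_comp _) =
      act (lunit H) (toUnit a a') (cell a' b) rfl
  cell_ract : ∀ (a : (realization A).obj) (b b' : (realization B).obj),
    mcomp (cell a b') (.single (J.ract a b b')) (Category.id_comp _) (Category.id_comp _) =
      act (runit H) (cell a b) (toUnit b b') rfl
  cell_sec : mcomp (cell (one A) (one B)) (.single sec) (Category.comp_id _) (Category.comp_id _) =
    idCell H

/-- The profunctor `|H|` lies over `H`. -/
noncomputable def Over.ofPro {A B : E} (H : Pro A B) : Over (realization.ofPro H) H where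
  cell a b := restrCell (arrow a) (arrow b) H
  sec := lift (idCell H) (Category.comp_id _) (Category.comp_id _)
  cell_lact a a' b := restrCell_lactRestr H a a' b
  cell_ract a b b' := restrCell_ractRestr H a b b'
  cell_sec := restrCell_lift _ _ _

section
variable {A B : E} (J : Profunctor (realization A) (realization B))

/-- The cell `J(a, b) → J(1, 1)` over `a` and `b`. -/
noncomputable def toOne (a : (realization A).obj) (b : (realization B).obj) :
    Cell (arrow a) (arrow b) (.single (J.pro a b)) (J.pro (one A) (one B)) :=
  act (J.ract (one A) b (one B)) (act (J.lact (one A) a b) (inOne a) (idCell (J.pro a b)) rfl)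
    (outOne b) rfl

/-- The value of `J(a, b) → J(1, 1)` at a generalized element `x` is the product of `x` with the
two elements `inOne a` and `outOne b`. -/
theorem toOne_mcomp {a : (realization A).obj} {b : (realization B).obj}
    {P : Path E ((realization A).ext a) ((realization B).ext b)}
    (x : Cell (𝟙 _) (𝟙 _) P (J.pro a b)) :
    mcomp (toOne J a b) (.single x) (Category.id_comp _) (Category.id_comp _) =
      act (J.ract (one A) b (one B)) (act (J.lact (one A) a b) (inOne a) x rfl)
        (outOne b) P.append_nil := by
  refine (act_mcomp _ _ _ rfl (.single x) (.single x) (.nil (𝟙 _)) P.append_nil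
    (CellPath.append_nil _).symm (Category.id_comp _) (Category.id_comp _)
    (Category.id_comp _)).trans ?_
  rw [show mcomp (outOne b) (.nil (𝟙 _)) (Category.id_comp _) (Category.id_comp _) = outOne b from
    mcomp_id _]
  refine congrArg (fun z => act _ z _ _) ?_
  refine (act_mcomp _ _ _ rfl (.single x) (.nil (𝟙 _)) (.single x) rfl
    HEq.rfl (Category.id_comp _) (Category.id_comp _) (Category.id_comp _)).trans ?_
  rw [show mcomp (inOne a) (.nil (𝟙 _)) (Category.id_comp _) (Category.id_comp _) = inOne a from
    mcomp_id _, idCell_mcomp]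
  rfl

theorem toOne_one : toOne J (one A) (one B) = idCell (J.pro (one A) (one B)) := by
  unfold toOne
  rw [inOne_one, outOne_one]
  refine Eq.trans ?_ (J.ract_ident (one A) (one B))
  exact congrArg (fun z => act (J.ract (one A) (one B) (one B)) z _ rfl)
    (J.ident_lact (one A) (one B))

/-- The action of the unit of `A` on `J(1, 1)` is the action of `|A|`. -/
theorem lunit_toUnit {a a' : (realization A).obj} {Y : E} {g : Y ⟶ B}
    {P₁ : Path E ((realization A).ext a') Y} {P : Path E ((realization A).ext a) Y}
    (y : Cell (arrow a') g P₁ (J.pro (one A) (one B)))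
    (h : ProPath.append (.single ((realization A).hom a a')) P₁ = P) :
    act (lunit (J.pro (one A) (one B))) (toUnit a a') y h =
      act (J.lact (one A) (one A) (one B)) (loop a a') y h := by
  have h₁ : act (J.lact (one A) (one A) (one B)) (ofUnit A) (idCell (J.pro (one A) (one B))) rfl =
      lunit (J.pro (one A) (one B)) := by
    refine eq_lunit ?_
    refine (act_act_idCell_right (J.lact (one A) (one A) (one B)) (ofUnit A) (unitCell A)
      (idCell _) rfl).trans ?_
    exact (congrArg (fun z => act (J.lact (one A) (one A) (one B)) z (idCell _) rfl)
      (ofUnit_unitCell A)).trans (J.ident_lact (one A) (one B))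
  rw [← h₁]
  exact (act_act_idCell_right (J.lact (one A) (one A) (one B)) (ofUnit A) (toUnit a a') y
    h).trans (congrArg (fun z => act (J.lact (one A) (one A) (one B)) z y h) (ofUnit_toUnit a a'))

/-- The action of the unit of `B` on `J(1, 1)` is the action of `|B|`. -/
theorem runit_toUnit {b b' : (realization B).obj} {X : E} {f : X ⟶ A}
    {P₁ : Path E X ((realization B).ext b)} {P : Path E X ((realization B).ext b')}
    (x : Cell f (arrow b) P₁ (J.pro (one A) (one B)))
    (h : P₁.append (.single ((realization B).hom b b')) = P) :
    act (runit (J.pro (one A) (one B))) x (toUnit b b') h =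
      act (J.ract (one A) (one B) (one B)) x (loop b b') h := by
  have h₁ : act (J.ract (one A) (one B) (one B)) (idCell (J.pro (one A) (one B))) (ofUnit B) rfl =
      runit (J.pro (one A) (one B)) := by
    refine eq_runit ?_
    refine (act_act_idCell_left (J.ract (one A) (one B) (one B)) (ofUnit B)
      (idCell (J.pro (one A) (one B))) (unitCell B) rfl).trans ?_
    exact (congrArg (fun z => act (J.ract (one A) (one B) (one B)) (idCell _) z rfl)
      (ofUnit_unitCell B)).trans (J.ract_ident (one A) (one B))
  rw [← h₁]
  exact (act_act_idCell_left (J.ract (one A) (one B) (one B)) (ofUnit B) x (toUnit b b')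
    h).trans (congrArg (fun z => act (J.ract (one A) (one B) (one B)) x z h) (ofUnit_toUnit b b'))

theorem toOne_lact (a a' : (realization A).obj) (b : (realization B).obj) :
    mcomp (toOne J a b) (.single (J.lact a a' b)) (Category.id_comp _) (Category.id_comp _) =
      act (lunit (J.pro (one A) (one B))) (toUnit a a') (toOne J a' b) rfl := by
  rw [toOne_mcomp]
  refine Eq.trans ?_ (lunit_toUnit J (toOne J a' b) rfl).symm
  unfold toOne
  refine Eq.trans ?_ (act_assoc (J.lact_ract (one A) (one A) b (one B)) (loop a a')
    (act (J.lact (one A) a' b) (inOne a') (idCell (J.pro a' b)) rfl) (outOne b) rfl rfl rfl rfl)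
  refine congrArg (fun z => act (J.ract (one A) b (one B)) z (outOne b) rfl) ?_
  -- Naturality of `inOne` moves the hom of `|A|` past it.
  refine Eq.trans ?_ (act_assoc (J.compos_lact (one A) (one A) a' b) (loop a a')
    (inOne a') (idCell (J.pro a' b)) rfl rfl rfl rfl)
  rw [← compos_inOne]
  refine Eq.trans ?_ (act_assoc (J.compos_lact (one A) a a' b) (inOne a)
    (idCell _) (idCell (J.pro a' b)) rfl rfl rfl rfl).symm
  rw [act_idCell]

theorem toOne_ract (a : (realization A).obj) (b b' : (realization B).obj) :
    mcomp (toOne J a b') (.single (J.ract a b b')) (Category.id_comp _) (Category.id_comp _) =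
      act (runit (J.pro (one A) (one B))) (toOne J a b) (toUnit b b') rfl := by
  rw [toOne_mcomp]
  refine Eq.trans ?_ (runit_toUnit J (toOne J a b) rfl).symm
  unfold toOne
  refine Eq.trans ?_ (act_assoc (J.ract_compos (one A) b (one B) (one B))
    (act (J.lact (one A) a b) (inOne a) (idCell (J.pro a b)) rfl) (outOne b) (loop b b')
    rfl rfl rfl rfl).symm
  rw [← compos_outOne]
  refine Eq.trans ?_ (act_assoc (J.ract_compos (one A) b b' (one B))
    (act (J.lact (one A) a b) (inOne a) (idCell (J.pro a b)) rfl) (idCell _) (outOne b')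
    rfl rfl rfl rfl)
  refine congrArg (fun z => act (J.ract (one A) b' (one B)) z (outOne b') rfl) ?_
  refine Eq.trans ?_ (act_assoc (J.lact_ract (one A) a b b') (inOne a)
    (idCell (J.pro a b)) (idCell _) rfl rfl rfl rfl).symm
  rw [act_idCell]

/-- A profunctor `J : |A| ⇸ |B|` lies over its value at the identities. -/
noncomputable def Over.atOne : Over J (J.pro (one A) (one B)) where
  cell := toOne J
  sec := idCell _
  cell_lact := toOne_lact J
  cell_ract := toOne_ract J
  cell_sec := by
    rw [toOne_one]
    exact idCell_mcomp _

end
end realization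

/-! ### Naturality in cells of profunctors -/

namespace ProfCell
variable {E : Type u} [VirtualDoubleCategory.{w, p, v} E]

theorem nil_equivariant {C : EnrichedCat.{t} E} {L : Profunctor C C}
    (μ : ProfCell (𝟙 C) (𝟙 C) (.nil C) L) (a b : C.obj) :
    act (L.lact a b b) (idCell (C.hom a b)) (μ.app (.nil b)) rfl =
      act (L.ract a a b) (μ.app (.nil a)) (idCell (C.hom a b)) rfl :=
  (mcomp_id _).symm.trans ((μ.equivariant (.here a (.nil b))).trans (mcomp_id _))

section
variable {C D H : EnrichedCat.{t} E} {J : Profunctor C D} {K : Profunctor D H} {L : Profunctor C H}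

/-- The components of a cell `J, K → L` of profunctors. -/
abbrev app₂ (μ : ProfCell (𝟙 C) (𝟙 H) (.cons J (.single K)) L) (c : C.obj) (d : D.obj) (h : H.obj) :
    Cell (𝟙 (C.ext c)) (𝟙 (H.ext h)) (.cons (J.pro c d) (.single (K.pro d h))) (L.pro c h) :=
  μ.app (.cons c (.cons d (.nil h)))

variable (μ : ProfCell (𝟙 C) (𝟙 H) (.cons J (.single K)) L)

theorem app₂_lact (c c' : C.obj) (d : D.obj) (h : H.obj) :
    act (app₂ μ c d h) (J.lact c c' d) (idCell (K.pro d h)) rfl =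
      act (L.lact c c' h) (idCell (C.hom c c')) (app₂ μ c' d h) rfl :=
  ((mcomp_id _).symm.trans (μ.equivariant (.here c (.cons c' (.cons d (.nil h)))))).symm

theorem app₂_middle (c : C.obj) (d d' : D.obj) (h : H.obj) :
    act (app₂ μ c d' h) (J.ract c d d') (idCell (K.pro d' h)) rfl =
      act (app₂ μ c d h) (idCell (J.pro c d)) (K.lact d d' h) rfl := by
  have e := μ.equivariant (.there c (.here d (.cons d' (.nil h))))
  refine Eq.trans ?_ (e.trans ?_)
  · exact congrArg (fun x => mcomp (app₂ μ c d' h) x _ _) (CellPath.comp_id _).symm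
  · exact congrArg (fun x => mcomp (app₂ μ c d h) x _ _) (CellPath.id_comp _)

theorem app₂_ract (c : C.obj) (d : D.obj) (h h' : H.obj) :
    act (L.ract c h h') (app₂ μ c d h) (idCell (H.hom h h')) rfl =
      act (app₂ μ c d h') (idCell (J.pro c d)) (K.ract d h h') rfl := by
  have e := μ.equivariant (.there c (.there d (.here h (.nil h'))))
  refine Eq.trans ?_ (e.symm.trans ?_)
  · refine Eq.trans (mcomp_id _).symm ?_
    refine congrArg (fun x => mcomp _ x _ _) ?_
    exact ((CellPath.id_comp _).trans
      (congrArg (fun x => CellPath.cons (idCell (J.pro c d)) x rfl) (CellPath.id_comp _))).symm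
  · refine congrArg (fun x => mcomp (app₂ μ c d h') x _ _) ?_
    refine (CellPath.id_comp _).trans ?_
    exact congrArg (fun x => CellPath.cons (idCell (J.pro c d)) x rfl) (CellPath.comp_id _)

end
end ProfCell

namespace realization
variable {E : Type u} [VirtualDoubleCategory.{w, p, v} E] [VirtualEquipment E]

/-- Naturality of the cells `L(a, a) → L(1, 1)` with respect to a nullary cell of profunctors. -/
theorem toOne_app_nil {A : E} {L : Profunctor (realization A) (realization A)}
    (μ : ProfCell (𝟙 _) (𝟙 _) (.nil (realization A)) L) (a : (realization A).obj) :
    mcomp (toOne L a a) (.single (μ.app (.nil a))) (Category.id_comp _) (Category.id_comp _) =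
      elt (μ.app (.nil (one A))) (arrow a) := by
  refine (toOne_mcomp L (μ.app (.nil a))).trans ?_
  have e : act (L.lact (one A) a a) (inOne a) (μ.app (.nil a)) rfl =
      act (L.ract (one A) (one A) a) (elt (μ.app (.nil (one A))) (arrow a)) (inOne a) rfl := by
    rw [← act_elt_comm (μ.nil_equivariant (one A) a) (inOne a) rfl rfl]
    exact congrArg (fun z => act (L.lact (one A) a a) (inOne a) z rfl)
      (elt_id (μ.app (.nil a))).symm
  refine (congrArg (fun z => act (L.ract (one A) a (one A)) z (outOne a) rfl) e).trans ?_
  refine (act_assoc (L.ract_compos (one A) (one A) a (one A)) _ _ _ rfl rfl rfl rfl).trans ?_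
  rw [compos_inOne_outOne]
  exact act_elt_right (L.ract_ident (one A) (one A)) _ rfl

/-- Naturality of the cells `L(a, c) → L(1, 1)` with respect to a binary cell of profunctors. The
objects `b` of the middle category are moved to `1` and back by the middle equivariance. -/
theorem toOne_app₂ {A B C : E} {J : Profunctor (realization A) (realization B)}
    {K : Profunctor (realization B) (realization C)} {L : Profunctor (realization A) (realization C)}
    (μ : ProfCell (𝟙 _) (𝟙 _) (.cons J (.single K)) L) (a : (realization A).obj)
    (b : (realization B).obj) (c : (realization C).obj) :
    mcomp (toOne L a c) (.single (μ.app₂ a b c)) (Category.id_comp _) (Category.id_comp _) =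
      act (μ.app₂ (one A) (one B) (one C)) (toOne J a b) (toOne K b c) rfl := by
  let x := act (J.lact (one A) a b) (inOne a) (idCell (J.pro a b)) rfl
  let y := act (K.ract b c (one C)) (idCell (K.pro b c)) (outOne c) rfl
  have hl : mcomp (toOne L a c) (.single (μ.app₂ a b c)) (Category.id_comp _) (Category.id_comp _) =
      act (μ.app₂ (one A) b (one C)) x y rfl := by
    refine (toOne_mcomp L (μ.app₂ a b c)).trans ?_
    rw [← act_idCell (μ.app₂ a b c),
      ← act_assoc (μ.app₂_lact (one A) a b c) (inOne a) (idCell _) (idCell _) rfl rfl rfl rfl]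
    exact act_assoc (μ.app₂_ract (one A) b c (one C)) x (idCell _) (outOne c) rfl rfl rfl rfl
  have hK : toOne K b c = act (K.lact (one B) b (one C)) (inOne b) y rfl :=
    act_assoc (K.lact_ract (one B) b c (one C)) (inOne b) (idCell _) (outOne c) rfl rfl rfl rfl
  rw [hl, hK]
  refine Eq.trans ?_ (act_assoc (μ.app₂_middle (one A) b (one B) (one C)) x (outOne b)
    (act (K.lact (one B) b (one C)) (inOne b) y rfl) rfl rfl rfl rfl).symm
  refine congrArg (fun z => act (μ.app₂ (one A) b (one C)) x z rfl) ?_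
  refine Eq.trans ?_ (act_assoc (K.compos_lact b (one B) b (one C)) (outOne b) (inOne b) y
    rfl rfl rfl rfl)
  rw [compos_outOne_inOne]
  refine Eq.trans ?_ (congrArg (fun z => act (K.lact b b (one C)) z y rfl)
    (elt_id ((realization B).ident b)))
  exact (act_elt_left (K.ident_lact b (one C)) y rfl).symm

end realization

/-! ### Lists of profunctors over lists of proarrows -/

section cases
variable {E : Type u} [VirtualDoubleCategory.{w, p, v} E]

/-- Case analysis of tuples of objects along the empty list. -/
@[elab_as_elim]
def Pts.nilCases {C : EnrichedCat.{t} E} {c : C.obj}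
    {motive : ∀ {d : C.obj}, Pts (.nil C) c d → Sort*} (nil : motive (.nil c)) :
    ∀ {d : C.obj} (e : Pts (.nil C) c d), motive e
  | _, .nil _ => nil

/-- Case analysis of tuples of objects along a nonempty list. -/
@[elab_as_elim]
def Pts.consCases {C D H : EnrichedCat.{t} E} {J : Profunctor C D} {P : ProfPath D H} {c : C.obj}
    {h : H.obj} {motive : Pts (.cons J P) c h → Sort*}
    (cons : ∀ {d : D.obj} (e : Pts P d h), motive (.cons c e)) : ∀ e : Pts (.cons J P) c h, motive e
  | .cons _ e => cons e

/-- Case analysis of the positions of an inserted hom in the empty list. -/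
@[elab_as_elim]
def Ins.nilCases {C : EnrichedCat.{t} E} {c : C.obj}
    {motive : ∀ {d : C.obj}, Ins (.nil C) c d → Sort*}
    (here : ∀ {a : C.obj}, motive (.here c (.nil a))) :
    ∀ {d : C.obj} (s : Ins (.nil C) c d), motive s
  | _, .here _ (.nil _) => here

/-- Case analysis of the positions of an inserted hom in a nonempty list. -/
@[elab_as_elim]
def Ins.consCases {C D H : EnrichedCat.{t} E} {J : Profunctor C D} {P : ProfPath D H} {c : C.obj}
    {h : H.obj} {motive : Ins (.cons J P) c h → Sort*}
    (here : ∀ {a : C.obj} {d : D.obj} (e : Pts P d h), motive (.here c (.cons a e)))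
    (there : ∀ {d : D.obj} (s : Ins P d h), motive (.there c s)) :
    ∀ s : Ins (.cons J P) c h, motive s
  | .here _ (.cons _ e) => here e
  | .there _ s => there s

end cases

namespace realization
variable {E : Type u} [VirtualDoubleCategory.{w, p, v} E] [VirtualEquipment E]

/-- Lists of profunctors between realizations lying over lists of proarrows. -/
inductive OverPath : ∀ {A B : E}, ProfPath (realization A) (realization B) → Path E A B →
    Type (max (u + 2) (v + 2) (p + 1) (w + 1))
  | nil (A : E) : OverPath (.nil (realization A)) (.nil A)
  | cons {A M B : E} {J : Profunctor (realization A) (realization M)} {H : Pro A M}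
      {P : ProfPath (realization M) (realization B)} {Q : Path E M B} (x : Over J H)
      (T : OverPath P Q) : OverPath (.cons J P) (.cons H Q)

namespace OverPath

/-- The cells into the proarrows of `Q`, over the vertical arrows of a tuple of objects along `P`.
-/
noncomputable def cells : ∀ {A B : E} {P : ProfPath (realization A) (realization B)}
    {Q : Path E A B} (_ : OverPath P Q) {a : (realization A).obj} {b : (realization B).obj}
    (e : Pts P a b),
    Cells (arrow a) (arrow b) e.eval Q
  | _, _, _, _, .nil _, a, _, e =>
    Pts.nilCases (motive := fun e => Cells (arrow a) (arrow _) e.eval _) (.nil (arrow a)) e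
  | _, _, _, _, .cons x T, a, _, e =>
    Pts.consCases (motive := fun e => Cells _ _ e.eval _)
      (fun {m} e => .cons (x.cell a m) (cells T e) rfl) e

/-- The tuple of identities. -/
@[reducible] noncomputable def pts : ∀ {A B : E} {P : ProfPath (realization A) (realization B)}
    {Q : Path E A B} (_ : OverPath P Q), Pts P (one A) (one B)
  | _, _, _, _, .nil A => .nil (one A)
  | _, _, _, _, .cons (A := A) _ T => .cons (one A) (pts T)

/-- The sections of the cells at the tuple of identities. -/
noncomputable def sec : ∀ {A B : E} {P : ProfPath (realization A) (realization B)}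
    {Q : Path E A B} (T : OverPath P Q), Cells (𝟙 A) (𝟙 B) Q T.pts.eval
  | _, _, _, _, .nil A => .nil (𝟙 A)
  | _, _, _, _, .cons x T => .cons x.sec (sec T) rfl

/-- The list `Q` with a unit inserted at the place where `s` inserts a hom into `P`. -/
noncomputable def insBase : ∀ {A B : E} {P : ProfPath (realization A) (realization B)}
    {Q : Path E A B} (_ : OverPath P Q) {a : (realization A).obj} {b : (realization B).obj}
    (_ : Ins P a b), Path E A B
  | _, _, _, _, .nil A, _, _, _ => .cons (unit A) (.nil A)
  | A, _, _, _, .cons (H := H) (Q := Q) _ T, _, _, s =>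
    Ins.consCases (motive := fun _ => Path E _ _) (fun _ => .cons (unit A) (.cons H Q))
      (fun s => .cons H (insBase T s)) s

/-- The cells into the proarrows of `Q` and the inserted unit, over the vertical arrows of a tuple
of objects along `P` with an inserted hom. -/
noncomputable def insCells : ∀ {A B : E} {P : ProfPath (realization A) (realization B)}
    {Q : Path E A B} (T : OverPath P Q) {a : (realization A).obj} {b : (realization B).obj}
    (s : Ins P a b), Cells (arrow a) (arrow b) s.eval (T.insBase s)
  | A, _, _, _, .nil _, a, _, s =>
    Ins.nilCases (motive := fun s => Cells (arrow a) (arrow _) s.eval (.cons (unit A) (.nil A)))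
      (fun {a'} => .single (toUnit a a')) s
  | _, _, _, _, .cons x T, a, b, s =>
    Ins.consCases (motive := fun s => Cells (arrow a) (arrow b) s.eval ((cons x T).insBase s))
      (fun {a' d} e => .cons (toUnit a a') (.cons (x.cell a' d) (T.cells e) rfl) rfl)
      (fun {d} s => .cons (x.cell a d) (insCells T s) rfl) s

/-- Identity cells and, at the place of the inserted unit, its unit element. -/
noncomputable def insUnit : ∀ {A B : E} {P : ProfPath (realization A) (realization B)}
    {Q : Path E A B} (T : OverPath P Q) {a : (realization A).obj} {b : (realization B).obj}
    (s : Ins P a b), Cells (𝟙 A) (𝟙 B) Q (T.insBase s)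
  | _, _, _, _, .nil A, _, _, _ => .single (unitCell A)
  | A, _, _, _, .cons (H := H) (Q := Q) x T, _, _, s =>
    Ins.consCases (motive := fun s => Cells _ _ _ ((cons x T).insBase s))
      (fun _ => .cons (unitCell A) (.id (.cons H Q)) rfl)
      (fun s => .cons (idCell H) (insUnit T s) rfl) s

end OverPath
end realization

/-! ### Absorption of an inserted unit -/

namespace realization
variable {E : Type u} [VirtualDoubleCategory.{w, p, v} E] [VirtualEquipment E]

/-- The lists of cells `id, …, id, η, id, …, id` in which `η` is the unit element of a unit. -/
inductive UnitInsertion : ∀ {A B : E} {Q N : Path E A B}, Cells (𝟙 A) (𝟙 B) Q N → Prop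
  | mk {A M B : E} (R : Path E A M) (S : Path E M B) : UnitInsertion (whisker R (unitCell M) S)

theorem UnitInsertion.cons {A B C : E} {Q N : Path E A B} {η : Cells (𝟙 A) (𝟙 B) Q N}
    (h : UnitInsertion η) (H : Pro C A) :
    UnitInsertion (CellPath.cons (idCell H) η rfl) := by
  cases h with
  | mk R S => exact .mk (.cons H R) S

/-- Cells with a unit inserted in their domain are determined by their composites with the unit
element. -/
theorem UnitInsertion.ext {A B Y₀ Y₁ : E} {Q N : Path E A B} {η : Cells (𝟙 A) (𝟙 B) Q N}
    (h : UnitInsertion η) {f : A ⟶ Y₀} {g : B ⟶ Y₁} {K : Pro Y₀ Y₁} {x y : Cell f g N K}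
    (e : mcomp x η (Category.id_comp f) (Category.id_comp g) =
      mcomp y η (Category.id_comp f) (Category.id_comp g)) : x = y := by
  cases h with
  | mk R S => exact unit_ext R S e

namespace OverPath

theorem unitInsertion_insUnit {A B : E} {P : ProfPath (realization A) (realization B)}
    {Q : Path E A B} (T : OverPath P Q) {a : (realization A).obj} {b : (realization B).obj}
    (s : Ins P a b) : UnitInsertion (T.insUnit s) := by
  induction T with
  | nil A => exact .mk (.nil A) (.nil A)
  | @cons A M B J H P Q x T ih =>
    cases s using Ins.consCases with
    | @here a' d e =>
      exact .mk (.nil A) (.cons H Q)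
    | @there d s =>
      exact (ih s).cons H

/-- The values of `insBase`, `insCells`, `insUnit` at a hom inserted in front. They are not
definitional equations because the lists are defined by recursion on `T`. -/
theorem ins_here {A B : E} {P : ProfPath (realization A) (realization B)}
    {Q : Path E A B} (T : OverPath P Q) (a : (realization A).obj) {a' : (realization A).obj}
    {b : (realization B).obj} (e : Pts P a' b) :
    T.insBase (.here a e) = .cons (unit A) Q ∧
      HEq (T.insCells (.here a e)) (CellPath.cons (toUnit a a') (T.cells e) rfl) ∧
      HEq (T.insUnit (.here a e)) (CellPath.cons (unitCell A) (.id Q) rfl) := by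
  cases T with
  | nil A =>
    cases e using Pts.nilCases
    exact ⟨rfl, HEq.rfl, HEq.rfl⟩
  | cons x T =>
    cases e using Pts.consCases
    exact ⟨rfl, HEq.rfl, HEq.rfl⟩

/-- Absorbing an inserted hom to its left, by the right action of a profunctor, lies over the
absorption `l` of the inserted unit, and `l` undoes the insertion of the unit element. Only a hom
inserted in front has no profunctor to its left. -/
theorem absorbLeft_cells {A B : E} {P : ProfPath (realization A) (realization B)}
    {Q : Path E A B} (T : OverPath P Q) {a : (realization A).obj} {b : (realization B).obj}
    (s : Ins P a b) : (∃ (a' : (realization A).obj) (e : Pts P a' b), s = .here a e) ∨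
      ∃ (e : Pts P a b) (φ : Cells (𝟙 _) (𝟙 _) s.eval e.eval)
        (l : Cells (𝟙 A) (𝟙 B) (T.insBase s) Q), s.absorbLeft = ⟨.plain e, φ⟩ ∧
        l.comp (T.insUnit s) (Category.id_comp _) (Category.id_comp _) = .id Q ∧
        (T.cells e).comp φ (Category.id_comp _) (Category.id_comp _) =
          l.comp (T.insCells s) (Category.comp_id _) (Category.comp_id _) := by
  induction T with
  | nil A =>
    cases s using Ins.nilCases
    exact .inl ⟨_, _, rfl⟩
  | @cons A M B J H P Q x T ih =>
    cases s using Ins.consCases with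
    | @here a' d e =>
      exact .inl ⟨_, _, rfl⟩
    | @there d s =>
      right
      rcases ih s with ⟨d', e, rfl⟩ | ⟨e, φ, l, h₁, h₂, h₃⟩
      · obtain ⟨hb, hc, hu⟩ := T.ins_here d e
        -- The lists at `.here` are generalized to variables so that the equations can be substituted.
        have key : ∀ (N : Path E M B) (hN : N = .cons (unit M) Q)
            (Λ : Cells (arrow d) (arrow b) (.cons ((realization M).hom d d') e.eval) N)
            (hΛ : HEq Λ (CellPath.cons (toUnit d d') (T.cells e) rfl))
            (η : Cells (𝟙 M) (𝟙 B) Q N)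
            (hη : HEq η (CellPath.cons (unitCell M) (.id Q) rfl)),
            ∃ l : Cells (𝟙 A) (𝟙 B) (.cons H N) (.cons H Q),
              l.comp (CellPath.cons (idCell H) η rfl) (Category.id_comp _) (Category.id_comp _) =
                .id (.cons H Q) ∧
              CellPath.comp (CellPath.cons (x.cell a d') (T.cells e) rfl)
                (CellPath.cons (J.ract a d d') (.id e.eval) rfl) (Category.id_comp _)
                (Category.id_comp _) =
              l.comp (CellPath.cons (x.cell a d) Λ rfl) (Category.comp_id _)
                (Category.comp_id _) := by
          rintro _ rfl Λ hΛ η hη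
          cases hΛ
          cases hη
          refine ⟨.cons (runit H) (.id Q) rfl, ?_, ?_⟩
          · refine (comp_cons_of_eq (β := .cons (idCell H) (.single (unitCell M)) rfl)
              (βs := .id Q) (h := rfl) (hγ := HEq.rfl) (hm := Category.id_comp _) ..).trans ?_
            rw [CellPath.id_comp]
            exact congrArg (fun z => CellPath.cons z (.id Q) rfl) (runit_unitCell H)
          · refine (comp_cons_of_eq (β := .single (J.ract a d d')) (βs := .id e.eval) (h := rfl)
              (hγ := HEq.rfl) (hm := Category.id_comp _) ..).trans ?_
            refine Eq.trans ?_ (comp_cons_of_eq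
              (β := .cons (x.cell a d) (.single (toUnit d d')) rfl) (βs := T.cells e) (h := rfl)
              (hγ := HEq.rfl) (hm := Category.comp_id _) ..).symm
            rw [CellPath.id_comp, CellPath.comp_id, x.cell_ract]
        obtain ⟨l, h₁, h₂⟩ := key _ hb _ hc _ hu
        refine ⟨.cons a e, .cons (J.ract a d d') (.id e.eval) rfl, l, ?_, h₁, h₂⟩
        simp only [Ins.absorbLeft, Gen.cons, Word.cons]
        congr 1
        exact CellPath.comp_id _
      · refine ⟨.cons a e, .cons (idCell _) φ rfl, .cons (idCell H) l rfl, ?_, ?_, ?_⟩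
        · simp only [Ins.absorbLeft]
          rw [h₁, Gen.cons_plain]
        · refine (CellPath.cons_comp_cons (hm := Category.id_comp _) ..).trans ?_
          rw [h₂, idCell_mcomp]
          rfl
        · refine (CellPath.cons_comp_cons (hm := Category.id_comp _) ..).trans ?_
          refine Eq.trans ?_ (CellPath.cons_comp_cons (hm := Category.comp_id _) ..).symm
          rw [h₃, idCell_mcomp, mcomp_single_idCell]

/-- Absorbing an inserted hom to its right, by the left action of a profunctor, lies over an
absorption `l` of the inserted unit, and `l` undoes the insertion of the unit element. A hom
inserted at the end has no profunctor to its right; there `l` leaves a unit at the end of the list.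
-/
theorem absorbRight_cells {A B : E} {P : ProfPath (realization A) (realization B)}
    {Q : Path E A B} (T : OverPath P Q) {a : (realization A).obj} {b : (realization B).obj}
    (s : Ins P a b) :
    (∃ (b' : (realization B).obj) (e : Pts P a b')
        (φ : Cells (𝟙 _) (𝟙 _) s.eval (e.eval.append (.single ((realization B).hom b' b))))
        (l : Cells (𝟙 A) (𝟙 B) (T.insBase s) (Q.append (.single (unit B)))),
        s.absorbRight = ⟨.tail e, φ⟩ ∧
        l.comp (T.insUnit s) (Category.id_comp _) (Category.id_comp _) =
          (CellPath.id Q).append (.single (unitCell B)) Q.append_nil ∧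
        ((T.cells e).append (.single (toUnit b' b)) rfl).comp φ (Category.id_comp _)
          (Category.id_comp _) =
          l.comp (T.insCells s) (Category.comp_id _) (Category.comp_id _)) ∨
      ∃ (e : Pts P a b) (φ : Cells (𝟙 _) (𝟙 _) s.eval e.eval)
        (l : Cells (𝟙 A) (𝟙 B) (T.insBase s) Q), s.absorbRight = ⟨.plain e, φ⟩ ∧
        l.comp (T.insUnit s) (Category.id_comp _) (Category.id_comp _) = .id Q ∧
        (T.cells e).comp φ (Category.id_comp _) (Category.id_comp _) =
          l.comp (T.insCells s) (Category.comp_id _) (Category.comp_id _) := by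
  induction T with
  | nil A =>
    cases s using Ins.nilCases
    refine .inl ⟨a, .nil a, .id _, .id _, rfl, CellPath.id_comp _, ?_⟩
    exact (CellPath.comp_id _).trans (CellPath.id_comp _).symm
  | @cons A M B J H P Q x T ih =>
    cases s using Ins.consCases with
    | @here a' d e =>
      right
      refine ⟨.cons a e, .cons (J.lact a a' d) (.id e.eval) rfl, .cons (lunit H) (.id Q) rfl, rfl,
        ?_, ?_⟩
      · refine (comp_cons_of_eq (β := .cons (unitCell A) (.single (idCell H)) rfl)
          (βs := .id Q) (h := rfl) (hγ := HEq.rfl) (hm := Category.id_comp _) ..).trans ?_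
        rw [CellPath.id_comp]
        exact congrArg (fun z => CellPath.cons z (.id Q) rfl) (lunit_unitCell H)
      · refine (comp_cons_of_eq (β := .single (J.lact a a' d)) (βs := .id e.eval) (h := rfl)
          (hγ := HEq.rfl) (hm := Category.id_comp _) ..).trans ?_
        refine Eq.trans ?_ (comp_cons_of_eq
          (β := .cons (toUnit a a') (.single (x.cell a' d)) rfl) (βs := T.cells e) (h := rfl)
          (hγ := HEq.rfl) (hm := Category.comp_id _) ..).symm
        rw [CellPath.id_comp, CellPath.comp_id, x.cell_lact]
    | @there d s =>
      rcases ih s with ⟨b', e, φ, l, h₁, h₂, h₃⟩ | ⟨e, φ, l, h₁, h₂, h₃⟩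
      · left
        refine ⟨b', .cons a e, .cons (idCell _) φ rfl, .cons (idCell H) l rfl, ?_, ?_, ?_⟩
        · simp only [Ins.absorbRight]
          rw [h₁, Gen.cons_tail]
        · refine (CellPath.cons_comp_cons (hm := Category.id_comp _) ..).trans ?_
          rw [h₂, idCell_mcomp]
          exact eq_of_heq (CellPath.cons_heq _ Q.append_nil.symm rfl (by congr! 1) _ _)
        · refine (CellPath.cons_comp_cons (hm := Category.id_comp _) ..).trans ?_
          refine Eq.trans ?_ (CellPath.cons_comp_cons (hm := Category.comp_id _) ..).symm
          rw [h₃, idCell_mcomp, mcomp_single_idCell]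
      · right
        refine ⟨.cons a e, .cons (idCell _) φ rfl, .cons (idCell H) l rfl, ?_, ?_, ?_⟩
        · simp only [Ins.absorbRight]
          rw [h₁, Gen.cons_plain]
        · refine (CellPath.cons_comp_cons (hm := Category.id_comp _) ..).trans ?_
          rw [h₂, idCell_mcomp]
          rfl
        · refine (CellPath.cons_comp_cons (hm := Category.id_comp _) ..).trans ?_
          refine Eq.trans ?_ (CellPath.cons_comp_cons (hm := Category.comp_id _) ..).symm
          rw [h₃, idCell_mcomp, mcomp_single_idCell]

end OverPath
end realization

/-! ### Extension of cells to cells of profunctors -/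

namespace realization
variable {E : Type u} [VirtualDoubleCategory.{w, p, v} E] [VirtualEquipment E]

namespace OverPath
section extend
variable {A B : E} {P : ProfPath (realization A) (realization B)} {Q : Path E A B}

/-- The components of the extension of a cell `β` of `E` to a cell of profunctors. -/
noncomputable def extendApp (T : OverPath P Q) {Y₀ Y₁ : E} {f : A ⟶ Y₀} {g : B ⟶ Y₁}
    {K : Pro Y₀ Y₁} (β : Cell f g Q K) :
    Comps (toPoint f) (toPoint g) P (pointPro.{max u v} K) :=
  fun e => mcomp β (T.cells e) rfl rfl

variable (T : OverPath P Q) {Y₀ Y₁ : E} {f : A ⟶ Y₀} {g : B ⟶ Y₁} {K : Pro Y₀ Y₁}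
  (β : Cell f g Q K) {a : (realization A).obj} {b : (realization B).obj}

/-- If an inserted hom is absorbed by a profunctor of the list, then the composite comes from a cell
with a unit inserted in its domain that restricts to `β` along the unit element. -/
theorem extendApp_plain (s : Ins P a b) (e : Pts P a b) (φ : Cells (𝟙 _) (𝟙 _) s.eval e.eval)
    (l : Cells (𝟙 A) (𝟙 B) (T.insBase s) Q)
    (h₂ : l.comp (T.insUnit s) (Category.id_comp _) (Category.id_comp _) = .id Q)
    (h₃ : (T.cells e).comp φ (Category.id_comp _) (Category.id_comp _) =
      l.comp (T.insCells s) (Category.comp_id _) (Category.comp_id _)) :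
    ∃ x : Cell f g (T.insBase s) K,
      mcomp x (T.insUnit s) (Category.id_comp _) (Category.id_comp _) = β ∧
      mcomp (T.extendApp β e) φ (Category.id_comp _) (Category.id_comp _) =
        mcomp x (T.insCells s) rfl rfl := by
  refine ⟨mcomp β l (Category.id_comp _) (Category.id_comp _), ?_, ?_⟩
  · rw [mcomp_assoc (hF := Category.id_comp _) (hG := Category.id_comp _)
      (h₃ := Category.id_comp _) (h₄ := Category.id_comp _), h₂, mcomp_id]
  · rw [mcomp_assoc (hF := Category.comp_id _) (hG := Category.comp_id _)
      (h₃ := rfl) (h₄ := rfl), ← h₃]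
    exact mcomp_assoc ..

/-- The left-hand side of the equivariance of the extension comes from a cell with a unit inserted
in its domain that restricts to `β` along the unit element. -/
theorem extendApp_absorbLeft (s : Ins P a b) :
    ∃ x : Cell f g (T.insBase s) K,
      mcomp x (T.insUnit s) (Category.id_comp _) (Category.id_comp _) = β ∧
      mcomp (s.absorbLeft.word.app (T.extendApp β)) s.absorbLeft.cells (Category.id_comp _)
        (Category.id_comp _) = mcomp x (T.insCells s) rfl rfl := by
  rcases T.absorbLeft_cells s with ⟨a', e, rfl⟩ | ⟨e, φ, l, h₁, h₂, h₃⟩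
  · obtain ⟨hb, hc, hu⟩ := T.ins_here a e
    -- The lists at `.here` are generalized to variables so that the equations can be substituted.
    have key : ∀ (N : Path E A B) (hN : N = .cons (unit A) Q)
        (Λ : Cells (arrow a) (arrow b) (.cons ((realization A).hom a a') e.eval) N)
        (hΛ : HEq Λ (CellPath.cons (toUnit a a') (T.cells e) rfl))
        (η : Cells (𝟙 A) (𝟙 B) Q N)
        (hη : HEq η (CellPath.cons (unitCell A) (.id Q) rfl)),
        ∃ x : Cell f g N K, mcomp x η (Category.id_comp _) (Category.id_comp _) = β ∧
          mcomp (lunit K) (.cons (mcomp (unitMap f) (.single (toUnit a a')) rfl rfl)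
            (.single (T.extendApp β e)) rfl) (Category.comp_id _) (Category.comp_id _) =
          mcomp x Λ rfl rfl := by
      rintro _ rfl Λ hΛ η hη
      cases hΛ
      cases hη
      refine ⟨act (lunit K) (unitMap f) β rfl, ?_, ?_⟩
      · rw [act_mcomp (lunit K) (unitMap f) β rfl (.cons (unitCell A) (.id Q) rfl)
          (.single (unitCell A)) (.id Q) rfl HEq.rfl (Category.id_comp _) (Category.id_comp _)
          (Category.id_comp _), unitMap_unitCell, mcomp_id, act_lunit_elt]
      · exact (act_mcomp (lunit K) (unitMap f) β rfl (.cons (toUnit a a') (T.cells e) rfl)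
          (.single (toUnit a a')) (T.cells e) rfl HEq.rfl rfl rfl rfl).symm
    obtain ⟨x, h₁, h₂⟩ := key _ hb _ hc _ hu
    exact ⟨x, h₁, (mcomp_id _).trans h₂⟩
  · rw [h₁]
    exact T.extendApp_plain β s e φ l h₂ h₃

/-- The right-hand side of the equivariance of the extension comes from a cell with a unit inserted
in its domain that restricts to `β` along the unit element. -/
theorem extendApp_absorbRight (s : Ins P a b) :
    ∃ x : Cell f g (T.insBase s) K,
      mcomp x (T.insUnit s) (Category.id_comp _) (Category.id_comp _) = β ∧
      mcomp (s.absorbRight.word.app (T.extendApp β)) s.absorbRight.cells (Category.id_comp _)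
        (Category.id_comp _) = mcomp x (T.insCells s) rfl rfl := by
  rcases T.absorbRight_cells s with ⟨b', e, φ, l, h₁, h₂, h₃⟩ | ⟨e, φ, l, h₁, h₂, h₃⟩
  · rw [h₁]
    refine ⟨mcomp (act (runit K) β (unitMap g) rfl) l (Category.id_comp _) (Category.id_comp _),
      ?_, ?_⟩
    · rw [mcomp_assoc (hF := Category.id_comp _) (hG := Category.id_comp _)
        (h₃ := Category.id_comp _) (h₄ := Category.id_comp _), h₂,
        act_mcomp (runit K) β (unitMap g) rfl
          ((CellPath.id Q).append (.single (unitCell B)) Q.append_nil) (.id Q)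
          (.single (unitCell B)) Q.append_nil HEq.rfl (Category.id_comp _) (Category.id_comp _)
          (Category.id_comp _), unitMap_unitCell, mcomp_id, act_runit_elt]
    · rw [mcomp_assoc (hF := Category.comp_id _) (hG := Category.comp_id _)
        (h₃ := rfl) (h₄ := rfl), ← h₃]
      refine Eq.trans ?_ (mcomp_assoc (hF' := rfl) (hG' := rfl) (h₁ := Category.id_comp _)
        (h₂ := Category.id_comp _) ..)
      refine congrArg (fun z => mcomp z φ (Category.id_comp _) (Category.id_comp _)) ?_
      exact (act_mcomp (runit K) β (unitMap g) rfl _ (T.cells e)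
        (.single (toUnit b' b)) rfl HEq.rfl rfl rfl rfl).symm
  · rw [h₁]
    exact T.extendApp_plain β s e φ l h₂ h₃

/-- The extension of a cell `β` of `E` to a cell of profunctors. Both sides of the equivariance at
an inserted hom come from cells that have a unit inserted in their domain and restrict to `β` along
the unit element; by the universal property of the unit there is only one such cell. -/
noncomputable def extend : ProfCell (toPoint f) (toPoint g) P (pointPro.{max u v} K) where
  app := T.extendApp β
  equivariant s := by
    obtain ⟨x, hx, hx'⟩ := T.extendApp_absorbLeft β s
    obtain ⟨y, hy, hy'⟩ := T.extendApp_absorbRight β s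
    rw [hx', hy', (T.unitInsertion_insUnit s).ext (hx.trans hy.symm)]

end extend

theorem cells_sec {A B : E} {P : ProfPath (realization A) (realization B)} {Q : Path E A B}
    (T : OverPath P Q) :
    (T.cells T.pts).comp T.sec (Category.comp_id _) (Category.comp_id _) = .id Q := by
  induction T with
  | nil A => exact CellPath.comp_nil _ _ _ _
  | cons x T ih =>
    refine (CellPath.cons_comp_cons (hm := Category.comp_id _) ..).trans ?_
    exact (congrArg (fun z => CellPath.cons _ z rfl) ih).trans
      (congrArg (fun z => CellPath.cons z (.id _) rfl) x.cell_sec)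

/-- A cell is recovered from its extension. -/
theorem extend_app_pts {A B : E} {P : ProfPath (realization A) (realization B)} {Q : Path E A B}
    (T : OverPath P Q) {Y₀ Y₁ : E} {f : A ⟶ Y₀} {g : B ⟶ Y₁} {K : Pro Y₀ Y₁}
    (β : Cell f g Q K) (hf : 𝟙 A ≫ 𝟙 A ≫ f = f) (hg : 𝟙 B ≫ 𝟙 B ≫ g = g) :
    mcomp ((T.extend β).app T.pts) T.sec hf hg = β := by
  refine (mcomp_assoc (hF := Category.comp_id _) (hG := Category.comp_id _)
    (h₃ := Category.id_comp _) (h₄ := Category.id_comp _) ..).trans ?_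
  exact (congrArg (fun z => mcomp β z (Category.id_comp _) (Category.id_comp _))
    T.cells_sec).trans (mcomp_id β)

/-- Concatenation of lists of profunctors over lists of proarrows. -/
noncomputable def append : ∀ {A M B : E} {P : ProfPath (realization A) (realization M)}
    {Q : Path E A M} {P' : ProfPath (realization M) (realization B)} {Q' : Path E M B} (_ : OverPath P Q)
    (_ : OverPath P' Q'), OverPath (P.append P') (Q.append Q')
  | _, _, _, _, _, _, _, .nil _, T' => T'
  | _, _, _, _, _, _, _, .cons x T, T' => .cons x (append T T')

section append
variable {A M B : E} {P : ProfPath (realization A) (realization M)} {Q : Path E A M}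
  {P' : ProfPath (realization M) (realization B)} {Q' : Path E M B} (T : OverPath P Q)
  (T' : OverPath P' Q')

theorem cells_append {a : (realization A).obj} {m : (realization M).obj}
    {b : (realization B).obj} (e : Pts P a m) (e' : Pts P' m b) :
    (T.append T').cells (e.append e') =
      CellPath.append (T.cells e) (T'.cells e') (e.eval_append e') := by
  induction T with
  | nil A =>
    cases e using Pts.nilCases
    rfl
  | cons x T ih =>
    cases e using Pts.consCases with
    | @cons d e =>
      change CellPath.cons (x.cell a d) ((T.append T').cells (e.append e')) rfl = _
      rw [ih]
      exact eq_of_heq (CellPath.cons_heq _ (e.eval_append e').symm rfl (by congr! 1) _ _)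

theorem pts_append : (T.append T').pts = T.pts.append T'.pts := by
  induction T with
  | nil A => rfl
  | cons x T ih => exact congrArg (Pts.cons _) (ih T')

theorem sec_append (h : Q.append Q' = Q.append Q') :
    HEq (T.append T').sec (CellPath.append T.sec T'.sec h) := by
  induction T with
  | nil A => rfl
  | cons x T ih =>
    refine CellPath.cons_heq _ rfl ?_ (ih T' rfl) _ _
    exact (congrArg Pts.eval (pts_append T T')).trans (Pts.eval_append _ _).symm

end append

end OverPath

/-- The list of profunctors `|J₁|, …, |Jₖ|`. -/
noncomputable def profPath : ∀ {A B : E}, Path E A B → ProfPath (realization A) (realization B)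
  | _, _, .nil A => .nil (realization A)
  | _, _, .cons H Q => .cons (ofPro H) (profPath Q)

/-- The list `|J₁|, …, |Jₖ|` lies over `J₁, …, Jₖ`. -/
noncomputable def OverPath.ofPath : ∀ {A B : E} (Q : Path E A B), OverPath (profPath Q) Q
  | _, _, .nil A => .nil A
  | _, _, .cons H Q => .cons (.ofPro H) (ofPath Q)

end realization

/-! ### Evaluation of composites at identities -/

/-- The components of a composite along identity functors. -/
theorem ProfCell.mcomp_app {E : Type u} [VirtualDoubleCategory.{w, p, v} E]
    {C D C' D' : EnrichedCat.{t} E} {F : C ⟶ C'} {G : D ⟶ D'} {P Q : ProfPath C D}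
    {K : Profunctor C' D'} (β : ProfCell F G Q K) (αs : ProfCells (𝟙 C) (𝟙 D) P Q)
    {c : C.obj} {d : D.obj} (e : Pts P c d) :
    ProfCell.app (mcomp (D := EnrichedCat.{t} E) β αs (Category.id_comp F) (Category.id_comp G)) e =
      mcomp (β.app (image αs e).pts) (image αs e).cells (Category.id_comp (farr F c))
        (Category.id_comp (farr G d)) :=
  eq_of_heq ((ProfCell.mcomp_app_heq β αs (Category.id_comp F) (Category.id_comp G) e).trans
    (CellPath.mcomp_congr (β.app (image αs e).pts) (image αs e).cells rfl (Category.id_comp _)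
      rfl (Category.id_comp _)))

namespace realization
variable {E : Type u} [VirtualDoubleCategory.{w, p, v} E] [VirtualEquipment E]

/-- A globular cell `μ` of profunctors between realizations that lies over a cell `μ₀` of `E`. -/
structure Over.Map {A B : E} {P : ProfPath (realization A) (realization B)} {Q : Path E A B}
    {L : Profunctor (realization A) (realization B)} {H : Pro A B} (T : OverPath P Q)
    (x : Over L H) (μ : ProfCell (𝟙 _) (𝟙 _) P L) (μ₀ : Cell (𝟙 A) (𝟙 B) Q H) : Prop where
  cell_app : ∀ {a : (realization A).obj} {b : (realization B).obj} (e : Pts P a b),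
    mcomp (x.cell a b) (.single (μ.app e)) (Category.id_comp (arrow a))
      (Category.id_comp (arrow b)) =
      mcomp μ₀ (T.cells e) (Category.comp_id (arrow a)) (Category.comp_id (arrow b))
  app_sec : mcomp (μ.app T.pts) T.sec (Category.id_comp (𝟙 A)) (Category.id_comp (𝟙 B)) =
    mcomp x.sec (.single μ₀) (Category.id_comp (𝟙 A)) (Category.id_comp (𝟙 B))

section
variable {A B : E} {P : ProfPath (realization A) (realization B)} {Q : Path E A B}
  {L : Profunctor (realization A) (realization B)} {H : Pro A B} {T : OverPath P Q}
  {x : Over L H} {μ : ProfCell (𝟙 (realization A)) (𝟙 (realization B)) P L}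
  {μ₀ : Cell (𝟙 A) (𝟙 B) Q H}

/-- The cells `μ, id, …, id` of profunctors, evaluated at a tuple of objects. -/
theorem image_whisker_nil {W : E} {PS : ProfPath (realization B) (realization W)}
    {a : (realization A).obj} {b : (realization B).obj} {w : (realization W).obj}
    (e₁ : Pts P a b) (e₂ : Pts PS b w) (e : Pts (P.append PS) a w) (he : e = e₁.append e₂)
    (hr : e₁.eval.append e₂.eval = e.eval) :
    image (whisker (D := EnrichedCat.{max u v} E) (.nil _) μ PS) e =
      ⟨.cons a e₂, .cons (μ.app e₁) (.id e₂.eval) hr⟩ := by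
  refine (image_cons μ (CellPath.id PS) rfl e₁ e₂ e (heq_of_eq he) hr).trans ?_
  rw [image_id]
  rfl

theorem image_whisker_cons {Z M W : E} {J : Profunctor (realization Z) (realization M)}
    {PR : ProfPath (realization M) (realization A)}
    {PS : ProfPath (realization B) (realization W)}
    {z : (realization Z).obj} {m : (realization M).obj} {w : (realization W).obj}
    (e : Pts (PR.append (P.append PS)) m w) :
    image (whisker (D := EnrichedCat.{max u v} E) (.cons J PR) μ PS) (.cons z e) =
      ⟨.cons z (image (whisker (D := EnrichedCat.{max u v} E) PR μ PS) e).pts,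
        .cons (idCell (J.pro z m))
          (image (whisker (D := EnrichedCat.{max u v} E) PR μ PS) e).cells rfl⟩ :=
  image_cons (ProfCell.id J) (whisker (D := EnrichedCat.{max u v} E) PR μ PS) rfl
    (.cons z (.nil m)) e (.cons z e) HEq.rfl rfl

/-- The cells over a list of proarrows are natural with respect to whiskered cells of profunctors.
-/
theorem cells_image_whisker (h : Over.Map T x μ μ₀) {Z W : E}
    {PR : ProfPath (realization Z) (realization A)} {R : Path E Z A} (TR : OverPath PR R)
    {PS : ProfPath (realization B) (realization W)} {S : Path E B W} (TS : OverPath PS S)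
    {z : (realization Z).obj} {w : (realization W).obj}
    (e : Pts (PR.append (P.append PS)) z w) :
    CellPath.comp ((TR.append (.cons x TS)).cells
        (image (whisker (D := EnrichedCat.{max u v} E) PR μ PS) e).pts)
      (image (whisker (D := EnrichedCat.{max u v} E) PR μ PS) e).cells
      (Category.id_comp (arrow z)) (Category.id_comp (arrow w)) =
    (whisker R μ₀ S).comp ((TR.append (T.append TS)).cells e) (Category.comp_id (arrow z))
      (Category.comp_id (arrow w)) := by
  induction TR with
  | nil A =>
    obtain ⟨b, e₁, e₂, rfl⟩ := Pts.exists_append (P := P) (Q := PS) e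
    rw [image_whisker_nil e₁ e₂ _ rfl (e₁.eval_append e₂)]
    refine (comp_cons_of_eq (x.cell z b) (TS.cells e₂) rfl (.single (μ.app e₁)) (.id e₂.eval)
      (e₁.eval_append e₂) _ HEq.rfl (Category.id_comp _) (Category.id_comp _)
      (Category.id_comp _)).trans ?_
    refine Eq.trans ?_ (comp_cons_of_eq μ₀ (.id S) rfl (T.cells e₁) (TS.cells e₂)
      (e₁.eval_append e₂) _ (heq_of_eq (T.cells_append TS e₁ e₂)) (Category.comp_id _)
      (Category.comp_id _) (Category.comp_id _)).symm
    rw [h.cell_app, CellPath.comp_id, CellPath.id_comp]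
  | cons y TR ih =>
    cases e using Pts.consCases with
    | @cons d e =>
      rw [image_whisker_cons]
      refine (CellPath.cons_comp_cons (hm := Category.id_comp _) ..).trans ?_
      refine Eq.trans ?_ (CellPath.cons_comp_cons (hm := Category.comp_id _) ..).symm
      refine (congrArg (fun c => CellPath.cons c _ rfl) (mcomp_single_idCell _)).trans ?_
      refine Eq.trans ?_ (congrArg (fun c => CellPath.cons c _ rfl) (idCell_mcomp _)).symm
      exact congrArg (fun c => CellPath.cons _ c rfl) (ih h e)

/-- The sections over a list of proarrows are natural with respect to whiskered cells of
profunctors. -/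
theorem image_whisker_pts (h : Over.Map T x μ μ₀) {Z W : E}
    {PR : ProfPath (realization Z) (realization A)} {R : Path E Z A} (TR : OverPath PR R)
    {PS : ProfPath (realization B) (realization W)} {S : Path E B W} (TS : OverPath PS S) :
    ∃ ψ, image (whisker (D := EnrichedCat.{max u v} E) PR μ PS) (TR.append (T.append TS)).pts =
        ⟨(TR.append (.cons x TS)).pts, ψ⟩ ∧
      CellPath.comp ψ (TR.append (T.append TS)).sec (Category.id_comp (𝟙 Z))
        (Category.id_comp (𝟙 W)) =
      CellPath.comp (TR.append (.cons x TS)).sec (whisker R μ₀ S) (Category.id_comp (𝟙 Z))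
        (Category.id_comp (𝟙 W)) := by
  induction TR with
  | nil A =>
    have hr : T.pts.eval.append TS.pts.eval = (T.append TS).pts.eval :=
      (Pts.eval_append _ _).trans (congrArg Pts.eval (T.pts_append TS)).symm
    refine ⟨.cons (μ.app T.pts) (.id TS.pts.eval) hr,
      image_whisker_nil T.pts TS.pts _ (T.pts_append TS) hr, ?_⟩
    refine (comp_cons_of_eq (μ.app T.pts) (.id TS.pts.eval) hr T.sec TS.sec rfl
      (T.append TS).sec (T.sec_append TS rfl) (Category.id_comp _) (Category.id_comp _)
      (Category.id_comp _)).trans ?_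
    refine Eq.trans ?_ (comp_cons_of_eq x.sec TS.sec rfl (.single μ₀) (.id S) rfl _ HEq.rfl
      (Category.id_comp _) (Category.id_comp _) (Category.id_comp _)).symm
    refine (congrArg (fun c => CellPath.cons c _ rfl) h.app_sec).trans
      (congrArg (fun c => CellPath.cons _ c rfl) ?_)
    exact (CellPath.id_comp TS.sec).trans (CellPath.comp_id TS.sec).symm
  | cons y TR ih =>
    obtain ⟨ψ, h₁, h₂⟩ := ih h
    refine ⟨.cons (idCell _) ψ rfl, ?_, ?_⟩
    · refine (image_whisker_cons (TR.append (T.append TS)).pts).trans ?_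
      rw [h₁]
      rfl
    · refine (CellPath.cons_comp_cons (hm := Category.id_comp _) ..).trans ?_
      refine Eq.trans ?_ (CellPath.cons_comp_cons (hm := Category.id_comp _) ..).symm
      refine (congrArg (fun c => CellPath.cons c _ rfl) (idCell_mcomp _)).trans ?_
      refine Eq.trans ?_ (congrArg (fun c => CellPath.cons c _ rfl)
        (mcomp_single_idCell _)).symm
      exact congrArg (fun c => CellPath.cons _ c rfl) h₂

/-- Extension of cells commutes with whiskering. -/
theorem extend_whisker (h : Over.Map T x μ μ₀) {Z W : E}
    {PR : ProfPath (realization Z) (realization A)} {R : Path E Z A} (TR : OverPath PR R)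
    {PS : ProfPath (realization B) (realization W)} {S : Path E B W} (TS : OverPath PS S)
    {Y₀ Y₁ : E} {f : Z ⟶ Y₀} {g : W ⟶ Y₁} {K : Pro Y₀ Y₁}
    (β : Cell f g (R.append (.cons H S)) K) :
    mcomp (D := EnrichedCat.{max u v} E) ((TR.append (.cons x TS)).extend β) (whisker PR μ PS)
      (Category.id_comp (toPoint f)) (Category.id_comp (toPoint g)) =
    (TR.append (T.append TS)).extend (mcomp β (whisker R μ₀ S) (Category.id_comp f)
      (Category.id_comp g)) := by
  refine ProfCell.ext fun {z w} e => ?_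
  refine (ProfCell.mcomp_app ((TR.append (.cons x TS)).extend β) _ e).trans ?_
  refine (mcomp_assoc (hF := Category.id_comp (arrow z)) (hG := Category.id_comp (arrow w))
    (h₃ := rfl) (h₄ := rfl) ..).trans ?_
  refine Eq.trans ?_ (mcomp_assoc (hF := Category.comp_id (arrow z))
    (hG := Category.comp_id (arrow w)) (h₃ := rfl) (h₄ := rfl) ..).symm
  exact congrArg (fun c => mcomp β c rfl rfl) (cells_image_whisker h TR TS e)

/-- A cell of `E` over which a composite of profunctors lies is a composite. A test cell is extended
to profunctors, factored there, and the factor is evaluated at the identities; two factors of a test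
cell have the same extension, hence are equal. -/
theorem isComposite_of_map (h : Over.Map T x μ μ₀)
    (hμ : IsComposite (D := EnrichedCat.{max u v} E) μ) : IsComposite μ₀ := by
  intro Z W Y₀ Y₁ f g R S K β
  -- The remaining proarrows `R`, `S` of the test cell are replaced by the profunctors `|R|`, `|S|`.
  let TR := OverPath.ofPath R
  let TS := OverPath.ofPath S
  obtain ⟨Γ, hΓ, hu⟩ := hμ (toPoint f) (toPoint g) (profPath R) (profPath S) (pointPro K)
    ((TR.append (T.append TS)).extend β)
  obtain ⟨ψ, h₁, h₂⟩ := image_whisker_pts h TR TS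
  have hf : 𝟙 Z ≫ 𝟙 Z ≫ f = f := by simp
  have hg : 𝟙 W ≫ 𝟙 W ≫ g = g := by simp
  refine ⟨mcomp (ProfCell.app Γ (TR.append (.cons x TS)).pts) (TR.append (.cons x TS)).sec hf hg,
    ?_, ?_⟩
  · have h₃ : mcomp (ProfCell.app Γ (TR.append (.cons x TS)).pts) ψ (Category.id_comp (𝟙 Z ≫ f))
        (Category.id_comp (𝟙 W ≫ g)) =
        ((TR.append (T.append TS)).extend β).app (TR.append (T.append TS)).pts := by
      rw [← hΓ]
      refine Eq.trans ?_ (ProfCell.mcomp_app Γ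
        (whisker (D := EnrichedCat.{max u v} E) (profPath R) μ (profPath S))
        (TR.append (T.append TS)).pts).symm
      rw [h₁]
      rfl
    refine Eq.trans ?_ ((TR.append (T.append TS)).extend_app_pts β hf hg)
    refine (mcomp_assoc (hF := Category.id_comp (𝟙 Z)) (hG := Category.id_comp (𝟙 W))
      (h₃ := hf) (h₄ := hg) ..).trans ?_
    refine (congrArg (fun c => mcomp (ProfCell.app Γ (TR.append (.cons x TS)).pts) c hf hg)
      h₂.symm).trans ?_
    refine (mcomp_assoc (hF' := Category.id_comp (𝟙 Z ≫ f)) (hG' := Category.id_comp (𝟙 W ≫ g))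
      (h₁ := hf) (h₂ := hg) ..).symm.trans ?_
    exact congrArg (fun c => mcomp c (TR.append (T.append TS)).sec hf hg) h₃
  · intro β' hβ'
    have h₃ := hu ((TR.append (.cons x TS)).extend β')
      ((extend_whisker h TR TS β').trans (by rw [hβ']))
    rw [← h₃]
    exact ((TR.append (.cons x TS)).extend_app_pts β' hf hg).symm

end

section
variable {A B C : E}

/-- A nullary cell of profunctors lies over its value at the identity. -/
theorem map_app_nil {L : Profunctor (realization A) (realization A)}
    (μ : ProfCell (𝟙 _) (𝟙 _) (.nil (realization A)) L) :
    Over.Map (.nil A) (.atOne L) μ (μ.app (.nil (one A))) where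
  cell_app e := by
    cases e using Pts.nilCases
    exact toOne_app_nil μ _
  app_sec := (mcomp_id _).trans (idCell_mcomp _).symm

/-- A binary cell of profunctors lies over its value at the identities. -/
theorem map_app₂ {J : Profunctor (realization A) (realization B)}
    {K : Profunctor (realization B) (realization C)} {L : Profunctor (realization A) (realization C)}
    (μ : ProfCell (𝟙 _) (𝟙 _) (.cons J (.single K)) L) :
    Over.Map (.cons (.atOne J) (.cons (.atOne K) (.nil C))) (.atOne L) μ
      (μ.app₂ (one A) (one B) (one C)) where
  cell_app e := by
    cases e using Pts.consCases with
    | cons e =>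
      cases e using Pts.consCases with
      | cons e =>
        cases e using Pts.nilCases
        exact toOne_app₂ μ _ _ _
  app_sec := (mcomp_id _).trans (idCell_mcomp _).symm

theorem unitOf_one {L : Profunctor (realization A) (realization A)}
    (h : UnitOf (D := EnrichedCat.{max u v} E) (realization A) L) :
    UnitOf A (L.pro (one A) (one A)) :=
  let ⟨μ, hμ⟩ := h
  ⟨_, isComposite_of_map (map_app_nil μ) hμ⟩

theorem compositeOf_one {J : Profunctor (realization A) (realization B)}
    {K : Profunctor (realization B) (realization C)} {L : Profunctor (realization A) (realization C)}
    (h : CompositeOf (D := EnrichedCat.{max u v} E) (X := realization A) (Y := realization C)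
      (.cons J (.single K)) L) :
    CompositeOf (X := A) (Y := C) (.cons (J.pro (one A) (one B)) (.single (K.pro (one B) (one C))))
      (L.pro (one A) (one C)) :=
  let ⟨μ, hμ⟩ := h
  ⟨_, isComposite_of_map (map_app₂ μ) hμ⟩

theorem mcomp_app_single {J K L : Profunctor (realization A) (realization B)}
    (ψ : ProfCell (𝟙 (realization A)) (𝟙 (realization B)) (.single K) L)
    (φ : ProfCell (𝟙 (realization A)) (𝟙 (realization B)) (.single J) K)
    (a : (realization A).obj) (b : (realization B).obj) :
    ProfCell.app (mcomp (D := EnrichedCat.{max u v} E) ψ (.single φ) (Category.id_comp _)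
      (Category.id_comp _)) (.cons a (.nil b)) =
    mcomp (ψ.app (.cons a (.nil b))) (.single (φ.app (.cons a (.nil b)))) (Category.id_comp _)
      (Category.id_comp _) := by
  refine (ProfCell.mcomp_app ψ _ _).trans ?_
  rw [CellPath.single, image_single]
  rfl

theorem proIso_one {J K : Profunctor (realization A) (realization B)}
    (h : ProIso (D := EnrichedCat.{max u v} E) (X := realization A) (Y := realization B) J K) :
    ProIso (X := A) (Y := B) (J.pro (one A) (one B)) (K.pro (one A) (one B)) := by
  obtain ⟨φ, ψ, h₁, h₂⟩ := h
  refine ⟨ProfCell.app φ (.cons (one A) (.nil (one B))),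
    ProfCell.app ψ (.cons (one A) (.nil (one B))), ?_, ?_⟩
  · exact (mcomp_app_single ψ φ (one A) (one B)).symm.trans
      (congrArg (fun c => ProfCell.app c (.cons (one A) (.nil (one B)))) h₁)
  · exact (mcomp_app_single φ ψ (one A) (one B)).symm.trans
      (congrArg (fun c => ProfCell.app c (.cons (one A) (.nil (one B)))) h₂)

end
end realization

end VDC

theorem mainTheorem4 {E : Type u} [VDC.VirtualDoubleCategory.{w, p, v} E] [VDC.VirtualEquipment E]
    (A B : E)
    (h : VDC.HorizontallyEquivalent (VDC.realization A) (VDC.realization B)) :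
    VDC.HorizontallyEquivalent A B := by
  obtain ⟨J, K, L, U, M, V, hL, hM, hU, hV, hLU, hMV⟩ := h
  exact ⟨_, _, _, _, _, _, VDC.realization.compositeOf_one hL, VDC.realization.compositeOf_one hM,
    VDC.realization.unitOf_one hU, VDC.realization.unitOf_one hV, VDC.realization.proIso_one hLU,
    VDC.realization.proIso_one hMV⟩
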